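/- **Setting.** Let $N\ge 1$, let $\Omega\subset\mathbb{R}^N$ be non-empty, open, bounded and convex, and let $\rho_0,\rho_1\in C^1(\Omega)$ be non-negative with $c_\rho<\rho<c_\rho^{-1}$ in $\Omega$ for some constant $c_\rho>0$, where $\rho:=\rho_0+\rho_1$; write $\mathrm d\rho_{(i)}=\rho_{(i)}\,\mathrm dx$. For $A\subset\Omega$ let $A^1$ be the set of points of $\Omega$ at which $A$ has Lebesgue density $1$, let $A^c:=\Omega\setminus A$, and put $\operatorname{sdist}(x,A):=\operatorname{dist}(x,A^1)-\operatorname{dist}(x,\Omega\setminus A^1)$. For $\varepsilon>0$ and measurable $u:\Omega\to\mathbb R$ let $$\mathrm{TV}_\varepsilon(u):=\frac1\varepsilon\left[\int_\Omega\Big(\operatorname*{ess\,sup}_{B(x,\varepsilon)\cap\Omega}u-u(x)\Big)\mathrm d\rho_0(x)+\int_\Omega\Big(u(x)-\operatorname*{ess\,inf}_{B(x,\varepsilon)\cap\Omega}u\Big)\mathrm d\rho_1(x)\right]\in[0,\infty].$$ For a Borel set $A\subset\Omega$ with $|A|>0$ and $|\Omega\setminus A|>0$ consider the problem $$w^*_\varepsilon:=\operatorname*{arg\,min}_{u\in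 L^2(\Omega)}\ \frac1{2\varepsilon}\int_\Omega|u-\operatorname{sdist}(\cdot,A^c)|^2\,\mathrm d\rho+\mathrm{TV}_\varepsilon(u),$$ and define $S_\varepsilon(A):=\{w^*_\varepsilon>0\}$, where the representative of $w^*_\varepsilon$ is chosen such that $\{w^*_\varepsilon>0\}=\{w^*_\varepsilon>0\}^1$. If $|A|=0$ put $S_\varepsilon(A):=\emptyset$, and if $|\Omega\setminus A|=0$ put $S_\varepsilon(A):=\Omega$. **Sub- and superflows.** Let $t_0<t_1$ and let $A(t)\subset\Omega$, $t\in[t_0,t_1]$, be Borel sets whose closure is compact and contained in $\Omega$, such that every ball centred at a point of $\partial A(t)$ meets both $A(t)$ and its complement in positive measure, and such that $\Gamma:=\bigcup_{t_0\le t\le t_1}\partial A(t)\times\{t\}$ is compact. Put $d(x,t):=\operatorname{sdist}(x,A(t)^c)$. The family is a *subflow* if there are a relatively open set $B\subset\Omega\times[t_0,t_1]$ with $\Gamma\subset B$ and a number $\delta>0$ such that $d$, $\partial_td$, $\nabla d$, $\nabla^2d$ exist and are continuous on $B$ and $$\partial_td(x,t)\ \ge\ \frac1{\rho(x)}\operatorname{div}\big(\rho(x)\nabla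 d(x,t)\big)+\delta\qquad\text{for all }(x,t)\in B.$$ It is a *superflow* if the same holds with $\delta<0$ and with $\le$ in place of $\ge$. **Theorem.** 1. (Well-posedness) For every $\varepsilon>0$ and every Borel set $A\subset\Omega$ with $|A|>0$ and $|\Omega\setminus A|>0$, the minimizer $w^*_\varepsilon$ exists and is unique up to equality almost everywhere. 2. (Monotonicity) For every $\varepsilon>0$ and all Borel sets $A'\subset A\subset\Omega$ we have $S_\varepsilon(A')\subset S_\varepsilon(A)$. 3. (Consistency with weighted mean curvature flow) For every subflow $[t_0,t_1]\ni t\mapsto A(t)$ there is $\varepsilon_0>0$ such that $S_\varepsilon(A(t))\subset A(t+\varepsilon)$ for all $0<\varepsilon<\varepsilon_0$ and all $t\in[t_0,t_1-\varepsilon]$. For every superflow $[t_0,t_1]\ni t\mapsto A(t)$ there is $\varepsilon_0>0$ such that $A(t+\varepsilon)\subset S_\varepsilon(A(t))$ for all $0<\varepsilon<\varepsilon_0$ and all $t\in[t_0,t_1-\varepsilon]$. -/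

import Mathlib

open MeasureTheory Set Filter Topology

noncomputable section

namespace AdvMCF

/-- The points of `Ω` at which `A` has Lebesgue density one; the set written `A¹`. -/
def densityOne {N : ℕ} (Ω A : Set (EuclideanSpace ℝ (Fin N))) :
    Set (EuclideanSpace ℝ (Fin N)) :=
  {x ∈ Ω | Tendsto (fun r : ℝ => volume (A ∩ Metric.ball x r) / volume (Metric.ball x r))
    (𝓝[>] 0) (𝓝 1)}

/-- The signed distance function of `A` relative to `Ω`:
`sdist(x, A) = dist(x, A¹) - dist(x, Ω \ A¹)`.
It is meaningful if both `A` and `Ω \ A` have positive measure. -/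
def sdist {N : ℕ} (Ω A : Set (EuclideanSpace ℝ (Fin N))) (x : EuclideanSpace ℝ (Fin N)) : ℝ :=
  Metric.infDist x (densityOne Ω A) - Metric.infDist x (Ω \ densityOne Ω A)

/-- The standing assumptions on the densities `ρ₀, ρ₁` on `Ω`. -/
structure AdmissibleDensities {N : ℕ} (Ω : Set (EuclideanSpace ℝ (Fin N)))
    (ρ₀ ρ₁ : EuclideanSpace ℝ (Fin N) → ℝ) : Prop where
  contDiffOn_zero : ContDiffOn ℝ 1 ρ₀ Ω
  contDiffOn_one : ContDiffOn ℝ 1 ρ₁ Ω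
  nonneg_zero : ∀ x ∈ Ω, 0 ≤ ρ₀ x
  nonneg_one : ∀ x ∈ Ω, 0 ≤ ρ₁ x
  bounds : ∃ c : ℝ, 0 < c ∧ ∀ x ∈ Ω, c < ρ₀ x + ρ₁ x ∧ ρ₀ x + ρ₁ x < c⁻¹

/-- Essential supremum of `u` over `B(x, ε) ∩ Ω`, with values in the extended reals. -/
def localEssSup {N : ℕ} (Ω : Set (EuclideanSpace ℝ (Fin N))) (ε : ℝ)
    (u : EuclideanSpace ℝ (Fin N) → ℝ) (x : EuclideanSpace ℝ (Fin N)) : EReal :=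
  essSup (fun y => (u y : EReal)) (volume.restrict (Metric.ball x ε ∩ Ω))

/-- Essential infimum of `u` over `B(x, ε) ∩ Ω`, with values in the extended reals. -/
def localEssInf {N : ℕ} (Ω : Set (EuclideanSpace ℝ (Fin N))) (ε : ℝ)
    (u : EuclideanSpace ℝ (Fin N) → ℝ) (x : EuclideanSpace ℝ (Fin N)) : EReal :=
  essInf (fun y => (u y : EReal)) (volume.restrict (Metric.ball x ε ∩ Ω))

/-- The nonlocal total variation `TV_ε(u)`, with values in `[0, ∞]`. -/
def nonlocalTV {N : ℕ} (Ω : Set (EuclideanSpace ℝ (Fin N)))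
    (ρ₀ ρ₁ : EuclideanSpace ℝ (Fin N) → ℝ) (ε : ℝ)
    (u : EuclideanSpace ℝ (Fin N) → ℝ) : ENNReal :=
  ENNReal.ofReal (1 / ε) *
    ((∫⁻ x in Ω, (localEssSup Ω ε u x - (u x : EReal)).toENNReal * ENNReal.ofReal (ρ₀ x)) +
      ∫⁻ x in Ω, ((u x : EReal) - localEssInf Ω ε u x).toENNReal * ENNReal.ofReal (ρ₁ x))

/-- The energy `(1 / 2ε) ∫_Ω |u - f|² dρ + TV_ε(u)` with `ρ = ρ₀ + ρ₁`. -/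
def energy {N : ℕ} (Ω : Set (EuclideanSpace ℝ (Fin N)))
    (ρ₀ ρ₁ : EuclideanSpace ℝ (Fin N) → ℝ) (ε : ℝ)
    (f u : EuclideanSpace ℝ (Fin N) → ℝ) : ENNReal :=
  ENNReal.ofReal (1 / (2 * ε)) *
      (∫⁻ x in Ω, ENNReal.ofReal (|u x - f x| ^ 2) * ENNReal.ofReal (ρ₀ x + ρ₁ x)) +
    nonlocalTV Ω ρ₀ ρ₁ ε u

/-- `w` minimizes the energy with data `f` over `L²(Ω)`. -/
def IsMinimizer {N : ℕ} (Ω : Set (EuclideanSpace ℝ (Fin N)))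
    (ρ₀ ρ₁ : EuclideanSpace ℝ (Fin N) → ℝ) (ε : ℝ)
    (f w : EuclideanSpace ℝ (Fin N) → ℝ) : Prop :=
  MemLp w 2 (volume.restrict Ω) ∧
    ∀ u : EuclideanSpace ℝ (Fin N) → ℝ, MemLp u 2 (volume.restrict Ω) →
      energy Ω ρ₀ ρ₁ ε f w ≤ energy Ω ρ₀ ρ₁ ε f u

/-- The minimizer `w*` of the energy with data `sdist(·, Ω \ A)`. -/
def schemeMinimizer {N : ℕ} (Ω : Set (EuclideanSpace ℝ (Fin N)))
    (ρ₀ ρ₁ : EuclideanSpace ℝ (Fin N) → ℝ) (ε : ℝ) (A : Set (EuclideanSpace ℝ (Fin N))) :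
    EuclideanSpace ℝ (Fin N) → ℝ :=
  Classical.epsilon fun w => IsMinimizer Ω ρ₀ ρ₁ ε (sdist Ω (Ω \ A)) w

open Classical in
/-- The one-step operator `S_ε(A) = {w* > 0}`, where the representative of `w*` is the one whose
positivity set consists of its points of density one. If `A` or `Ω \ A` is a null set, then
`sdist(·, Ω \ A)` is `-∞` or `+∞` identically, and `S_ε(A)` is `∅` or `Ω`, respectively. -/
def oneStep {N : ℕ} (Ω : Set (EuclideanSpace ℝ (Fin N)))
    (ρ₀ ρ₁ : EuclideanSpace ℝ (Fin N) → ℝ) (ε : ℝ) (A : Set (EuclideanSpace ℝ (Fin N))) :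
    Set (EuclideanSpace ℝ (Fin N)) :=
  if volume A = 0 then ∅
  else if volume (Ω \ A) = 0 then Ω
  else densityOne Ω {x ∈ Ω | 0 < schemeMinimizer Ω ρ₀ ρ₁ ε A x}

/-- Well-posedness of the minimization problem that defines `S_ε`: for every Borel set `A ⊆ Ω`
which is nontrivial up to null sets, a minimizer exists and is unique almost everywhere. -/
def SchemeWellPosed {N : ℕ} (Ω : Set (EuclideanSpace ℝ (Fin N)))
    (ρ₀ ρ₁ : EuclideanSpace ℝ (Fin N) → ℝ) (ε : ℝ) : Prop :=
  ∀ A : Set (EuclideanSpace ℝ (Fin N)), MeasurableSet A → A ⊆ Ω →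
    volume A ≠ 0 → volume (Ω \ A) ≠ 0 →
    ∃ w, IsMinimizer Ω ρ₀ ρ₁ ε (sdist Ω (Ω \ A)) w ∧
      ∀ w', IsMinimizer Ω ρ₀ ρ₁ ε (sdist Ω (Ω \ A)) w' → w' =ᵐ[volume.restrict Ω] w

/-- Monotonicity of an operator on the Borel subsets of `Ω`. -/
def IsMonotoneOperator {N : ℕ} (Ω : Set (EuclideanSpace ℝ (Fin N)))
    (S : Set (EuclideanSpace ℝ (Fin N)) → Set (EuclideanSpace ℝ (Fin N))) : Prop :=
  ∀ A' A : Set (EuclideanSpace ℝ (Fin N)), MeasurableSet A' → MeasurableSet A →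
    A' ⊆ A → A ⊆ Ω → S A' ⊆ S A

/-- The divergence `∑ᵢ ∂ᵢ Fᵢ` of a vector field. -/
def divergence {N : ℕ} (F : EuclideanSpace ℝ (Fin N) → EuclideanSpace ℝ (Fin N))
    (x : EuclideanSpace ℝ (Fin N)) : ℝ :=
  ∑ i : Fin N, (fderiv ℝ F x (EuclideanSpace.single i 1)) i

/-- `(1 / ρ) div(ρ ∇u)`. -/
def weightedLaplacian {N : ℕ} (ρ u : EuclideanSpace ℝ (Fin N) → ℝ)
    (x : EuclideanSpace ℝ (Fin N)) : ℝ :=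
  1 / ρ x * divergence (fun y => ρ y • gradient u y) x

/-- `d` is once continuously differentiable in time and twice in space on `B`, where `B` is
relatively open in (an open set) `× [t₀, t₁]`; all derivatives are jointly continuous on `B`. -/
structure IsC21On {N : ℕ} (t₀ t₁ : ℝ) (d : EuclideanSpace ℝ (Fin N) → ℝ → ℝ)
    (B : Set (EuclideanSpace ℝ (Fin N) × ℝ)) : Prop where
  continuousOn : ContinuousOn (fun p : EuclideanSpace ℝ (Fin N) × ℝ => d p.1 p.2) B
  differentiable_time : ∀ p ∈ B, DifferentiableWithinAt ℝ (d p.1) (Icc t₀ t₁) p.2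
  continuousOn_time : ContinuousOn
    (fun p : EuclideanSpace ℝ (Fin N) × ℝ => derivWithin (d p.1) (Icc t₀ t₁) p.2) B
  differentiable_space : ∀ p ∈ B, DifferentiableAt ℝ (fun y => d y p.2) p.1
  continuousOn_gradient : ContinuousOn
    (fun p : EuclideanSpace ℝ (Fin N) × ℝ => gradient (fun y => d y p.2) p.1) B
  differentiable_gradient : ∀ p ∈ B, DifferentiableAt ℝ (gradient fun y => d y p.2) p.1
  continuousOn_hessian : ContinuousOn
    (fun p : EuclideanSpace ℝ (Fin N) × ℝ => fderiv ℝ (gradient fun y => d y p.2) p.1) B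

/-- The signed distance function `d(x, t) = sdist(x, Ω \ A(t))` of an evolution; it is positive
inside `A(t)`. -/
def flowDist {N : ℕ} (Ω : Set (EuclideanSpace ℝ (Fin N)))
    (A : ℝ → Set (EuclideanSpace ℝ (Fin N))) (x : EuclideanSpace ℝ (Fin N)) (t : ℝ) : ℝ :=
  sdist Ω (Ω \ A t) x

/-- The space-time boundary `⋃_{t₀ ≤ t ≤ t₁} ∂A(t) × {t}`. -/
def spaceTimeBoundary {N : ℕ} (t₀ t₁ : ℝ) (A : ℝ → Set (EuclideanSpace ℝ (Fin N))) :
    Set (EuclideanSpace ℝ (Fin N) × ℝ) :=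
  {p | p.2 ∈ Icc t₀ t₁ ∧ p.1 ∈ frontier (A p.2)}

/-- `t ↦ A(t) ⊂⊂ Ω`, `t ∈ [t₀, t₁]`, is a smooth evolution of Borel sets with regularity
neighbourhood `B`. -/
structure IsSmoothEvolution {N : ℕ} (Ω : Set (EuclideanSpace ℝ (Fin N))) (t₀ t₁ : ℝ)
    (A : ℝ → Set (EuclideanSpace ℝ (Fin N)))
    (B : Set (EuclideanSpace ℝ (Fin N) × ℝ)) : Prop where
  lt : t₀ < t₁
  measurableSet : ∀ t ∈ Icc t₀ t₁, MeasurableSet (A t)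
  isCompact_closure : ∀ t ∈ Icc t₀ t₁, IsCompact (closure (A t))
  closure_subset : ∀ t ∈ Icc t₀ t₁, closure (A t) ⊆ Ω
  /-- The topological boundary is the measure-theoretic one: it does not see null sets. -/
  boundary_essential : ∀ t ∈ Icc t₀ t₁, ∀ x ∈ frontier (A t), ∀ r : ℝ, 0 < r →
    volume (A t ∩ Metric.ball x r) ≠ 0 ∧ volume (Metric.ball x r \ A t) ≠ 0
  /-- The space-time boundary is compact: no piece of the boundary disappears suddenly. -/
  isCompact_boundary : IsCompact (spaceTimeBoundary t₀ t₁ A)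
  relatively_open : ∃ U : Set (EuclideanSpace ℝ (Fin N) × ℝ), IsOpen U ∧
    B = U ∩ (Ω ×ˢ Icc t₀ t₁)
  boundary_subset : spaceTimeBoundary t₀ t₁ A ⊆ B
  regular : IsC21On t₀ t₁ (flowDist Ω A) B

/-- Subflows of `∂ₜ d = (1 / ρ) div(ρ ∇d)`. -/
def IsSubflow {N : ℕ} (Ω : Set (EuclideanSpace ℝ (Fin N)))
    (ρ : EuclideanSpace ℝ (Fin N) → ℝ) (t₀ t₁ : ℝ)
    (A : ℝ → Set (EuclideanSpace ℝ (Fin N))) : Prop :=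
  ∃ B : Set (EuclideanSpace ℝ (Fin N) × ℝ), IsSmoothEvolution Ω t₀ t₁ A B ∧
    ∃ δ : ℝ, 0 < δ ∧ ∀ p ∈ B,
      weightedLaplacian ρ (fun y => flowDist Ω A y p.2) p.1 + δ ≤
        derivWithin (flowDist Ω A p.1) (Icc t₀ t₁) p.2

/-- Superflows of `∂ₜ d = (1 / ρ) div(ρ ∇d)`. -/
def IsSuperflow {N : ℕ} (Ω : Set (EuclideanSpace ℝ (Fin N)))
    (ρ : EuclideanSpace ℝ (Fin N) → ℝ) (t₀ t₁ : ℝ)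
    (A : ℝ → Set (EuclideanSpace ℝ (Fin N))) : Prop :=
  ∃ B : Set (EuclideanSpace ℝ (Fin N) × ℝ), IsSmoothEvolution Ω t₀ t₁ A B ∧
    ∃ δ : ℝ, δ < 0 ∧ ∀ p ∈ B,
      derivWithin (flowDist Ω A p.1) (Icc t₀ t₁) p.2 ≤
        weightedLaplacian ρ (fun y => flowDist Ω A y p.2) p.1 + δ

/-- Consistency of a family of operators `S ε` with the flow `∂ₜ d = (1 / ρ) div(ρ ∇d)`. -/
def IsConsistent {N : ℕ} (Ω : Set (EuclideanSpace ℝ (Fin N)))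
    (ρ : EuclideanSpace ℝ (Fin N) → ℝ)
    (S : ℝ → Set (EuclideanSpace ℝ (Fin N)) → Set (EuclideanSpace ℝ (Fin N))) : Prop :=
  (∀ (t₀ t₁ : ℝ) (A : ℝ → Set (EuclideanSpace ℝ (Fin N))), IsSubflow Ω ρ t₀ t₁ A →
    ∃ ε₀ : ℝ, 0 < ε₀ ∧ ∀ ε : ℝ, 0 < ε → ε < ε₀ → ∀ t ∈ Icc t₀ (t₁ - ε),
      S ε (A t) ⊆ A (t + ε)) ∧
  (∀ (t₀ t₁ : ℝ) (A : ℝ → Set (EuclideanSpace ℝ (Fin N))), IsSuperflow Ω ρ t₀ t₁ A →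
    ∃ ε₀ : ℝ, 0 < ε₀ ∧ ∀ ε : ℝ, 0 < ε → ε < ε₀ → ∀ t ∈ Icc t₀ (t₁ - ε),
      A (t + ε) ⊆ S ε (A t))

end AdvMCF

end

noncomputable section

namespace AdvMCF

/-! ### The essential oscillation above a level -/

section Egap

variable {α : Type*} [MeasurableSpace α]

/-! Well-posedness and monotonicity are convex analysis. Written through `gap`, the nonlocal total
variation is convex, lower semicontinuous under a.e. convergence and submodular: TV(u ⊔ v) + TV(u ⊓
v) ≤ TV(u) + TV(v). The quadratic term is uniformly convex because ρ₀ + ρ₁ is bounded below. Uniform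
convexity (`energy_midpoint_add_le`) makes minimizing sequences Cauchy in L² and minimizers unique.
Submodularity gives the comparison principle `IsMinimizer.ae_le`, and the signed distance increases
with the set.

Consistency is a barrier argument. For a subflow with signed distance d, put g = d(·, t + ε) - εc
and let v be g truncated to [-a, a]. It is enough that the minimizer w with data d(·, t) satisfies
min(w, a) ≤ v a.e.: then w > 0 forces d(·, t + ε) ≥ εc > 0, so that density points of {w > 0} lie in
A(t + ε).

The inequality rests on a one-sided first variation of TV_ε at v. Near the boundary |∇g| = 1, so ∇g
is constant along its own integral lines, these are straight, and g(x + s∇g(x)) = g(x) + s. The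
essential supremum of v over B(x, ε) is therefore almost reached at x + s∇g(x) as s increases to ε,
and testing v + φ at this single point bounds its gap from below. The infimum is treated by the
shift in the opposite direction. Changing variables with the Jacobian bound det(1 + sD²g) ≤ exp(sΔg)
produces TV(v + φ) ≥ TV(v) - ∫ φ (F₀ + F₁) for bounded φ ≥ 0 vanishing where g ≥ a. Here Fᵢ is
div(ρᵢ∇g) plus a small constant near the interface and a large constant away from it
(`IsTube.toReal_gapInt_clampFun_le`, `IsTube.transportBounds`).

Testing minimality of w against w - φ with φ = (min(w, a) - v)⁺ then gives φ = 0, provided F₀ + F₁ ≤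
ρ(v - d(·, t))/ε where g < a (`IsTube.min_le_clampFun`). Near the interface this is the mean value
theorem in time together with the strict subflow inequality, whose margin δ pays for all errors.
Away from it, v - d(·, t) is bounded below by a positive multiple of a, and the factor 1/ε wins.
Compactness of the space-time boundary makes the constants uniform in t
(`FlowTube.eventually_min_le_clampFun`).

Superflows reduce to the same estimate by reflection: replace d and w by -d and -w and exchange ρ₀
with ρ₁ (`IsMinimizer.neg`). The geometric input is that, in Ω, d is plus or minus the distance to
the topological boundary, and that |∇d| = 1 holds on the whole regularity neighbourhood, the
boundary included (`IsEssential.norm_gradient_sdist`). -/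

/-- The essential supremum of the positive part of `u - c`. -/
def egap (ν : Measure α) (u : α → ℝ) (c : ℝ) : ENNReal :=
  essSup (fun y => ENNReal.ofReal (u y - c)) ν

variable {ν : Measure α} {u v : α → ℝ} {b c d : ℝ}

/-- The bridge from essential suprema to a.e. inequalities. The sign of `b` matters because
`ENNReal.ofReal` forgets negative values. -/
lemma egap_le_iff (hb : 0 ≤ b) :
    egap ν u c ≤ ENNReal.ofReal b ↔ ∀ᵐ y ∂ν, u y ≤ c + b := by
  constructor
  · intro h
    filter_upwards [ENNReal.ae_le_essSup (μ := ν) (fun y => ENNReal.ofReal (u y - c))] with y hy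
    have := (ENNReal.ofReal_le_ofReal_iff hb).1 (hy.trans h)
    linarith
  · intro h
    refine essSup_le_of_ae_le _ ?_
    filter_upwards [h] with y hy
    exact ENNReal.ofReal_le_ofReal (by linarith)

lemma ae_le_of_egap_ne_top (h : egap ν u c ≠ ⊤) :
    ∀ᵐ y ∂ν, u y ≤ c + (egap ν u c).toReal :=
  (egap_le_iff ENNReal.toReal_nonneg).1 (ENNReal.ofReal_toReal h).ge

lemma egap_congr (h : u =ᵐ[ν] v) : egap ν u c = egap ν v c :=
  essSup_congr_ae (h.mono fun y hy => by simp only [hy])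

/-- Truncation at zero commutes with the essential supremum, so the `EReal`-valued integrand of the
energy can be replaced by a quantity that stays in `ENNReal` and needs no case distinction at ±∞. -/
lemma toENNReal_essSup_sub (ν : Measure α) (u : α → ℝ) (c : ℝ) :
    (essSup (fun y => (u y : EReal)) ν - (c : EReal)).toENNReal = egap ν u c := by
  apply le_antisymm
  · have h : essSup (fun y => (u y : EReal)) ν ≤ (egap ν u c : EReal) + c := by
      refine essSup_le_of_ae_le _ ?_
      filter_upwards [ENNReal.ae_le_essSup (μ := ν) (fun y => ENNReal.ofReal (u y - c))] with y hy
      have h1 : (u y : EReal) ≤ ((ENNReal.ofReal (u y - c) : ENNReal) : EReal) + c := by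
        rw [EReal.coe_ennreal_ofReal, ← EReal.coe_add, EReal.coe_le_coe_iff]
        linarith [le_max_left (u y - c) 0]
      exact h1.trans (add_le_add (EReal.coe_ennreal_le_coe_ennreal_iff.2 hy) le_rfl)
    have h2 : essSup (fun y => (u y : EReal)) ν - (c : EReal) ≤ (egap ν u c : EReal) :=
      EReal.sub_le_of_le_add h
    calc _ ≤ ((egap ν u c : EReal)).toENNReal := EReal.toENNReal_le_toENNReal h2
      _ = _ := EReal.toENNReal_coe
  · refine essSup_le_of_ae_le _ ?_
    filter_upwards [ae_le_essSup (μ := ν) (f := fun y => (u y : EReal))] with y hy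
    have : ENNReal.ofReal (u y - c) = ((u y : EReal) - c).toENNReal := by
      rw [← EReal.coe_sub, EReal.toENNReal_of_ne_top (EReal.coe_ne_top _), EReal.toReal_coe]
    rw [this]
    exact EReal.toENNReal_le_toENNReal (EReal.sub_le_sub hy le_rfl)

lemma toENNReal_sub_essInf (ν : Measure α) (u : α → ℝ) (c : ℝ) :
    ((c : EReal) - essInf (fun y => (u y : EReal)) ν).toENNReal = egap ν (-u) (-c) := by
  rw [← toENNReal_essSup_sub]
  congr 1
  have h : essSup (fun y => (((-u) y : ℝ) : EReal)) ν = - essInf (fun y => (u y : EReal)) ν := by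
    have h2 : (fun y => (((-u) y : ℝ) : EReal)) = - fun y => (u y : EReal) := by
      ext y; simp
    rw [h2]
    exact EReal.limsup_neg
  rw [h, EReal.coe_neg, sub_eq_add_neg, sub_eq_add_neg, neg_neg, add_comm]

lemma egap_midpoint (c d : ℝ) :
    egap ν (fun y => (u y + v y) / 2) ((c + d) / 2) ≤
      ENNReal.ofReal (1 / 2) * (egap ν u c + egap ν v d) := by
  calc egap ν (fun y => (u y + v y) / 2) ((c + d) / 2)
      ≤ essSup (fun y => ENNReal.ofReal (1 / 2) *
          ((fun y => ENNReal.ofReal (u y - c)) + fun y => ENNReal.ofReal (v y - d)) y) ν := by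
        refine essSup_mono_ae (Eventually.of_forall fun y => ?_)
        simp only [Pi.add_apply]
        have : (u y + v y) / 2 - (c + d) / 2 = 1 / 2 * ((u y - c) + (v y - d)) := by ring
        rw [this, ENNReal.ofReal_mul (by norm_num)]
        gcongr
        exact ENNReal.ofReal_add_le
    _ ≤ _ := by
        rw [ENNReal.essSup_const_mul]
        gcongr
        exact ENNReal.essSup_add_le _ _

/-- With a and b the two gaps, c + a and d + b are a.e. upper bounds of u and v. If c + a ≤ d + b
they bound u ⊓ v and u ⊔ v in this order. Otherwise they exchange roles: c + a bounds u ⊔ v, d + b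
bounds u ⊓ v, and the sum of the excesses over d and c is still a + b. -/
lemma egap_sup_add_egap_inf_le_of_le (h : c ≤ d) :
    egap ν (u ⊔ v) d + egap ν (u ⊓ v) c ≤ egap ν u c + egap ν v d := by
  by_cases h1 : egap ν u c = ⊤
  · simp [h1]
  by_cases h2 : egap ν v d = ⊤
  · simp [h2]
  have hu := ae_le_of_egap_ne_top h1
  have hv := ae_le_of_egap_ne_top h2
  rw [← ENNReal.ofReal_toReal h1, ← ENNReal.ofReal_toReal h2]
  set a := (egap ν u c).toReal
  set b := (egap ν v d).toReal
  have ha : 0 ≤ a := ENNReal.toReal_nonneg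
  have hb : 0 ≤ b := ENNReal.toReal_nonneg
  rcases le_total (c + a) (d + b) with hab | hab
  · rw [add_comm]
    refine add_le_add ((egap_le_iff ha).2 ?_) ((egap_le_iff hb).2 ?_)
    · filter_upwards [hu] with y hy
      exact inf_le_left.trans hy
    · filter_upwards [hu, hv] with y hy hy'
      exact sup_le (hy.trans hab) hy'
  · rw [← ENNReal.ofReal_add ha hb]
    have e : a + b = (c + a - d) + (d + b - c) := by ring
    have p1 : 0 ≤ c + a - d := by linarith
    have p2 : 0 ≤ d + b - c := by linarith
    rw [e, ENNReal.ofReal_add p1 p2]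
    refine add_le_add ((egap_le_iff p1).2 ?_) ((egap_le_iff p2).2 ?_)
    · filter_upwards [hu, hv] with y hy hy'
      refine sup_le ?_ ?_ <;> linarith
    · filter_upwards [hv] with y hy
      refine inf_le_right.trans ?_
      linarith

lemma egap_sup_add_egap_inf_le (c d : ℝ) :
    egap ν (u ⊔ v) (c ⊔ d) + egap ν (u ⊓ v) (c ⊓ d) ≤ egap ν u c + egap ν v d := by
  rcases le_total c d with h | h
  · rw [sup_eq_right.2 h, inf_eq_left.2 h]
    exact egap_sup_add_egap_inf_le_of_le h
  · rw [sup_eq_left.2 h, inf_eq_right.2 h, sup_comm u, inf_comm u, add_comm (egap ν u c)]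
    exact egap_sup_add_egap_inf_le_of_le h

/-- A monotone map carries the bound c + a to a bound, and the increments of F and G over [c, c + a]
add up to a. It plays the role of a coarea formula: the total variation is at least the sum over the
parts of u below and above a level. -/
lemma egap_comp_add_egap_comp_le {F G : ℝ → ℝ} (hF : Monotone F) (hG : Monotone G)
    (hFG : ∀ s, F s + G s = s) (u : α → ℝ) (c : ℝ) :
    egap ν (F ∘ u) (F c) + egap ν (G ∘ u) (G c) ≤ egap ν u c := by
  by_cases h1 : egap ν u c = ⊤
  · simp [h1]
  have hu := ae_le_of_egap_ne_top h1
  rw [← ENNReal.ofReal_toReal h1]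
  set a := (egap ν u c).toReal
  have ha : 0 ≤ a := ENNReal.toReal_nonneg
  have hF0 : 0 ≤ F (c + a) - F c := sub_nonneg.2 (hF (by linarith))
  have hG0 : 0 ≤ G (c + a) - G c := sub_nonneg.2 (hG (by linarith))
  have e : a = (F (c + a) - F c) + (G (c + a) - G c) := by
    have := hFG (c + a); have := hFG c; linarith
  rw [e, ENNReal.ofReal_add hF0 hG0]
  refine add_le_add ((egap_le_iff hF0).2 ?_) ((egap_le_iff hG0).2 ?_)
  · filter_upwards [hu] with y hy
    have := hF hy
    simp only [Function.comp_apply]; linarith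
  · filter_upwards [hu] with y hy
    have := hG hy
    simp only [Function.comp_apply]; linarith

lemma egap_le_liminf {f : ℕ → α → ℝ} {e : ℕ → ℝ}
    (hf : ∀ᵐ y ∂ν, Tendsto (fun n => f n y) atTop (𝓝 (u y))) (he : Tendsto e atTop (𝓝 c)) :
    egap ν u c ≤ liminf (fun n => egap ν (f n) (e n)) atTop := by
  have h := ENNReal.essSup_liminf_le (μ := ν) (fun n y => ENNReal.ofReal (f n y - e n))
  refine le_trans (essSup_mono_ae ?_) h
  filter_upwards [hf] with y hy
  exact ((ENNReal.continuous_ofReal.tendsto _).comp (hy.sub he)).liminf_eq.ge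

end Egap

/-! ### The nonlocal gap function -/

section Gap

variable {N : ℕ} {Ω : Set (EuclideanSpace ℝ (Fin N))} {ε : ℝ}
  {u v : EuclideanSpace ℝ (Fin N) → ℝ} {x : EuclideanSpace ℝ (Fin N)}

/-- The amount by which the essential supremum of `u` over `B(x, ε) ∩ Ω` exceeds `u x`. -/
def gap (Ω : Set (EuclideanSpace ℝ (Fin N))) (ε : ℝ) (u : EuclideanSpace ℝ (Fin N) → ℝ)
    (x : EuclideanSpace ℝ (Fin N)) : ENNReal :=
  egap (volume.restrict (Metric.ball x ε ∩ Ω)) u (u x)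

lemma nonlocalTV_eq (Ω : Set (EuclideanSpace ℝ (Fin N)))
    (ρ₀ ρ₁ : EuclideanSpace ℝ (Fin N) → ℝ) (ε : ℝ) (u : EuclideanSpace ℝ (Fin N) → ℝ) :
    nonlocalTV Ω ρ₀ ρ₁ ε u = ENNReal.ofReal (1 / ε) *
      ((∫⁻ x in Ω, gap Ω ε u x * ENNReal.ofReal (ρ₀ x)) +
        ∫⁻ x in Ω, gap Ω ε (-u) x * ENNReal.ofReal (ρ₁ x)) := by
  simp only [nonlocalTV, localEssSup, localEssInf, toENNReal_essSup_sub, toENNReal_sub_essInf,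
    gap, Pi.neg_apply]

lemma gap_le_of_forall {b : ℝ} (hΩ : MeasurableSet Ω) (hb : 0 ≤ b)
    (h : ∀ y ∈ Ω, dist y x < ε → u y ≤ u x + b) : gap Ω ε u x ≤ ENNReal.ofReal b :=
  (egap_le_iff hb).2 (ae_restrict_of_forall_mem (Metric.isOpen_ball.measurableSet.inter hΩ)
    fun y hy => h y hy.2 hy.1)

lemma gap_congr_ae (h : u =ᵐ[volume.restrict Ω] v) :
    gap Ω ε u =ᵐ[volume.restrict Ω] gap Ω ε v := by
  filter_upwards [h] with x hx
  simp only [gap, hx]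
  exact egap_congr (ae_mono (Measure.restrict_mono inter_subset_right le_rfl) h)

/-- An open ball is the union of countably many smaller concentric balls, so positive measure is
already seen in one of them, and that one lies in the ε-ball of every nearby centre. -/
lemma isOpen_setOf_measure_ball_inter_ne_zero (S : Set (EuclideanSpace ℝ (Fin N))) (ε : ℝ) :
    IsOpen {x | volume (Metric.ball x ε ∩ S) ≠ 0} := by
  rw [Metric.isOpen_iff]
  intro x hx
  have hU : Metric.ball x ε ∩ S = ⋃ k : ℕ, Metric.ball x (ε - 1 / ((k : ℝ) + 1)) ∩ S := by
    ext y
    simp only [mem_inter_iff, Metric.mem_ball, mem_iUnion]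
    constructor
    · rintro ⟨h1, h2⟩
      obtain ⟨k, hk⟩ := exists_nat_one_div_lt (sub_pos.2 h1)
      exact ⟨k, by linarith, h2⟩
    · rintro ⟨k, h1, h2⟩
      have : 0 < 1 / ((k : ℝ) + 1) := by positivity
      exact ⟨by linarith, h2⟩
  have : ∃ k : ℕ, volume (Metric.ball x (ε - 1 / ((k : ℝ) + 1)) ∩ S) ≠ 0 := by
    by_contra! hcon
    apply hx
    rw [hU]
    exact measure_iUnion_null hcon
  obtain ⟨k, hk⟩ := this
  refine ⟨1 / ((k : ℝ) + 1), by positivity, fun y hy => ?_⟩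
  refine fun h0 => hk (measure_mono_null (inter_subset_inter_left _ ?_) h0)
  intro z hz
  rw [Metric.mem_ball] at *
  linarith [dist_triangle z x y, dist_comm x y]

/-- Almost every value of `u` is seen by all gaps in its range. -/
lemma ae_forall_le_gap (hΩ : MeasurableSet Ω) (ε : ℝ) (hu : Measurable u) :
    ∀ᵐ z ∂volume.restrict Ω, ∀ x, dist z x < ε → ENNReal.ofReal (u z - u x) ≤ gap Ω ε u x := by
  -- Only rational levels are tested, so a single null set of z serves all centres x at once. This
  -- uniformity is what later permits evaluation at a shifted point z that depends on x.
  have hS : ∀ q : ℚ, ∀ᵐ z ∂volume.restrict Ω, (q : ℝ) < u z →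
      ∀ r > 0, volume (Metric.ball z r ∩ (Ω ∩ {y | (q : ℝ) < u y})) ≠ 0 := by
    intro q
    rw [ae_restrict_iff' hΩ, ae_iff]
    refine measure_null_of_locally_null _ fun z hz => ?_
    simp only [mem_ofPred_eq, Classical.not_imp, not_forall, not_not] at hz
    obtain ⟨hzΩ, hzq, r, hr, h0⟩ := hz
    refine ⟨Metric.ball z r ∩ _, inter_mem (mem_nhdsWithin_of_mem_nhds (Metric.ball_mem_nhds z hr))
      self_mem_nhdsWithin, measure_mono_null ?_ h0⟩
    rintro y ⟨hy1, hy2⟩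
    simp only [mem_ofPred_eq, Classical.not_imp] at hy2
    exact ⟨hy1, hy2.1, hy2.2.1⟩
  filter_upwards [ae_all_iff.2 hS] with z hz x hzx
  by_contra! hlt
  have hne : gap Ω ε u x ≠ ⊤ := hlt.ne_top
  have hlt' : u x + (gap Ω ε u x).toReal < u z := by
    rw [← ENNReal.ofReal_toReal hne, ENNReal.ofReal_lt_ofReal_iff'] at hlt
    linarith [hlt.1]
  obtain ⟨q, hq1, hq2⟩ := exists_rat_btwn hlt'
  have hr : 0 < ε - dist z x := by linarith
  apply hz q hq2 _ hr
  have hae := ae_le_of_egap_ne_top (u := u) (c := u x) hne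
  have hms : MeasurableSet (Ω ∩ {y | (q : ℝ) < u y}) :=
    hΩ.inter (measurableSet_lt measurable_const hu)
  rw [ae_restrict_iff' (Metric.isOpen_ball.measurableSet.inter hΩ), ae_iff] at hae
  refine measure_mono_null ?_ hae
  rintro y ⟨hy1, hy2, hy3⟩
  simp only [mem_ofPred_eq, Classical.not_imp, not_le]
  refine ⟨⟨?_, hy2⟩, lt_trans hq1 hy3⟩
  rw [Metric.mem_ball] at *
  linarith [dist_triangle y z x]

/-- The gap exceeds c exactly when some rational q > u x + c is exceeded by u on a non-null part of
the ball. This describes the superlevel set by countably many measurable and open conditions. -/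
lemma measurable_gap (hΩ : MeasurableSet Ω) (ε : ℝ) (hu : Measurable u) :
    Measurable (gap Ω ε u) := by
  refine measurable_of_Ioi fun c => ?_
  by_cases hc : c = ⊤
  · simp [hc]
  have : gap Ω ε u ⁻¹' Ioi c = ⋃ q : ℚ, {x | u x + c.toReal < q} ∩
      {x | volume (Metric.ball x ε ∩ (Ω ∩ {y | (q : ℝ) < u y})) ≠ 0} := by
    ext x
    simp only [mem_preimage, mem_Ioi, mem_iUnion, mem_inter_iff, mem_ofPred_eq]
    have key : c < gap Ω ε u x ↔
        volume (⋃ q : ℚ, {y | u x + c.toReal < q} ∩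
          (Metric.ball x ε ∩ (Ω ∩ {y | (q : ℝ) < u y}))) ≠ 0 := by
      rw [← not_le, not_iff_comm, not_not]
      rw [show (gap Ω ε u x ≤ c) = (gap Ω ε u x ≤ ENNReal.ofReal c.toReal) by
        rw [ENNReal.ofReal_toReal hc]]
      unfold gap
      rw [egap_le_iff ENNReal.toReal_nonneg,
        ae_restrict_iff' (Metric.isOpen_ball.measurableSet.inter hΩ), ae_iff]
      have : {a | ¬(a ∈ Metric.ball x ε ∩ Ω → u a ≤ u x + c.toReal)} =
          ⋃ q : ℚ, {y | u x + c.toReal < q} ∩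
          (Metric.ball x ε ∩ (Ω ∩ {y | (q : ℝ) < u y})) := by
        ext y
        simp only [mem_ofPred_eq, Classical.not_imp, not_le, mem_iUnion, mem_inter_iff]
        constructor
        · rintro ⟨⟨h1, h2⟩, h3⟩
          obtain ⟨q, hq1, hq2⟩ := exists_rat_btwn h3
          exact ⟨q, hq1, h1, h2, hq2⟩
        · rintro ⟨q, hq1, h1, h2, hq2⟩
          exact ⟨⟨h1, h2⟩, hq1.trans hq2⟩
      rw [this]
    rw [key, Ne, measure_iUnion_null_iff]
    push Not
    refine exists_congr fun q => ?_
    by_cases hq : u x + c.toReal < q <;> simp [hq]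
  rw [this]
  refine MeasurableSet.iUnion fun q => MeasurableSet.inter ?_ ?_
  · exact measurableSet_lt (hu.add_const _) measurable_const
  · exact (isOpen_setOf_measure_ball_inter_ne_zero _ ε).measurableSet

lemma aemeasurable_gap (hΩ : MeasurableSet Ω) (ε : ℝ)
    (hu : AEMeasurable u (volume.restrict Ω)) :
    AEMeasurable (gap Ω ε u) (volume.restrict Ω) :=
  ⟨gap Ω ε (hu.mk u), measurable_gap hΩ ε hu.measurable_mk, gap_congr_ae hu.ae_eq_mk⟩

lemma gap_midpoint (u v : EuclideanSpace ℝ (Fin N) → ℝ) (x : EuclideanSpace ℝ (Fin N)) :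
    gap Ω ε (fun y => (u y + v y) / 2) x ≤ ENNReal.ofReal (1 / 2) * (gap Ω ε u x + gap Ω ε v x) :=
  egap_midpoint _ _

lemma gap_sup_add_gap_inf_le (u v : EuclideanSpace ℝ (Fin N) → ℝ)
    (x : EuclideanSpace ℝ (Fin N)) :
    gap Ω ε (u ⊔ v) x + gap Ω ε (u ⊓ v) x ≤ gap Ω ε u x + gap Ω ε v x :=
  egap_sup_add_egap_inf_le _ _

lemma gap_comp_add_gap_comp_le {F G : ℝ → ℝ} (hF : Monotone F) (hG : Monotone G)
    (hFG : ∀ s, F s + G s = s) (u : EuclideanSpace ℝ (Fin N) → ℝ)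
    (x : EuclideanSpace ℝ (Fin N)) :
    gap Ω ε (F ∘ u) x + gap Ω ε (G ∘ u) x ≤ gap Ω ε u x :=
  egap_comp_add_egap_comp_le hF hG hFG u (u x)

lemma gap_le_liminf {f : ℕ → EuclideanSpace ℝ (Fin N) → ℝ}
    (hf : ∀ᵐ y ∂volume.restrict Ω, Tendsto (fun n => f n y) atTop (𝓝 (u y))) :
    ∀ᵐ x ∂volume.restrict Ω, gap Ω ε u x ≤ liminf (fun n => gap Ω ε (f n) x) atTop := by
  filter_upwards [hf] with x hx
  exact egap_le_liminf (ae_mono (Measure.restrict_mono inter_subset_right le_rfl) hf) hx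

end Gap

/-! ### The weighted integral of the gap function and the nonlocal total variation -/

section TV

variable {N : ℕ} {Ω : Set (EuclideanSpace ℝ (Fin N))} {ε : ℝ}
  {ρ ρ₀ ρ₁ u v : EuclideanSpace ℝ (Fin N) → ℝ}

/-- The integral of the gap function with density `ρ`. -/
def gapInt (Ω : Set (EuclideanSpace ℝ (Fin N))) (ε : ℝ) (ρ u : EuclideanSpace ℝ (Fin N) → ℝ) :
    ENNReal :=
  ∫⁻ x in Ω, gap Ω ε u x * ENNReal.ofReal (ρ x)

lemma nonlocalTV_eq_gapInt : nonlocalTV Ω ρ₀ ρ₁ ε u =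
    ENNReal.ofReal (1 / ε) * (gapInt Ω ε ρ₀ u + gapInt Ω ε ρ₁ (-u)) :=
  nonlocalTV_eq Ω ρ₀ ρ₁ ε u

lemma gapInt_congr_ae (h : u =ᵐ[volume.restrict Ω] v) : gapInt Ω ε ρ u = gapInt Ω ε ρ v :=
  lintegral_congr_ae ((gap_congr_ae (ε := ε) h).mono fun x hx => by simp only [hx])

lemma aemeasurable_gap_mul (hΩ : MeasurableSet Ω) (hρ : AEMeasurable ρ (volume.restrict Ω))
    (hu : AEMeasurable u (volume.restrict Ω)) :
    AEMeasurable (fun x => gap Ω ε u x * ENNReal.ofReal (ρ x)) (volume.restrict Ω) :=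
  (aemeasurable_gap hΩ ε hu).mul hρ.ennreal_ofReal

lemma gapInt_midpoint (hΩ : MeasurableSet Ω) (hρ : AEMeasurable ρ (volume.restrict Ω))
    (hu : AEMeasurable u (volume.restrict Ω)) :
    gapInt Ω ε ρ (fun y => (u y + v y) / 2) ≤
      ENNReal.ofReal (1 / 2) * (gapInt Ω ε ρ u + gapInt Ω ε ρ v) := by
  unfold gapInt
  rw [← lintegral_add_left' (aemeasurable_gap_mul hΩ hρ hu), ← lintegral_const_mul' _ _ (by simp)]
  refine lintegral_mono fun x => ?_
  dsimp only
  rw [← add_mul, ← mul_assoc]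
  gcongr
  exact gap_midpoint u v x

lemma gapInt_sup_add_gapInt_inf_le (hΩ : MeasurableSet Ω)
    (hρ : AEMeasurable ρ (volume.restrict Ω)) (hu : AEMeasurable u (volume.restrict Ω)) :
    gapInt Ω ε ρ (u ⊔ v) + gapInt Ω ε ρ (u ⊓ v) ≤ gapInt Ω ε ρ u + gapInt Ω ε ρ v := by
  unfold gapInt
  rw [← lintegral_add_left' (aemeasurable_gap_mul hΩ hρ hu)]
  refine (le_lintegral_add _ _).trans (lintegral_mono fun x => ?_)
  dsimp only
  rw [← add_mul, ← add_mul]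
  exact mul_le_mul_left (gap_sup_add_gap_inf_le u v x) _

lemma gapInt_comp_add_gapInt_comp_le {F G : ℝ → ℝ} (hF : Monotone F) (hG : Monotone G)
    (hFG : ∀ s, F s + G s = s) :
    gapInt Ω ε ρ (F ∘ u) + gapInt Ω ε ρ (G ∘ u) ≤ gapInt Ω ε ρ u := by
  unfold gapInt
  refine (le_lintegral_add _ _).trans (lintegral_mono fun x => ?_)
  dsimp only
  rw [← add_mul]
  exact mul_le_mul_left (gap_comp_add_gap_comp_le hF hG hFG u x) _

lemma gapInt_le_liminf (hΩ : MeasurableSet Ω) (hρ : AEMeasurable ρ (volume.restrict Ω))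
    {f : ℕ → EuclideanSpace ℝ (Fin N) → ℝ} (hfm : ∀ n, AEMeasurable (f n) (volume.restrict Ω))
    (hf : ∀ᵐ y ∂volume.restrict Ω, Tendsto (fun n => f n y) atTop (𝓝 (u y))) :
    gapInt Ω ε ρ u ≤ liminf (fun n => gapInt Ω ε ρ (f n)) atTop := by
  refine le_trans (lintegral_mono_ae ?_)
    (lintegral_liminf_le' fun n => aemeasurable_gap_mul (ε := ε) hΩ hρ (hfm n))
  filter_upwards [gap_le_liminf (ε := ε) hf] with x hx
  refine le_trans (mul_le_mul_left hx _) ?_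
  rw [mul_comm, ← ENNReal.liminf_const_mul_of_ne_top ENNReal.ofReal_ne_top]
  simp only [mul_comm, le_refl]

lemma nonlocalTV_congr_ae (h : u =ᵐ[volume.restrict Ω] v) :
    nonlocalTV Ω ρ₀ ρ₁ ε u = nonlocalTV Ω ρ₀ ρ₁ ε v := by
  rw [nonlocalTV_eq_gapInt, nonlocalTV_eq_gapInt, gapInt_congr_ae h,
    gapInt_congr_ae (h.mono fun x hx => by simp [hx] : -u =ᵐ[volume.restrict Ω] -v)]

lemma nonlocalTV_neg : nonlocalTV Ω ρ₁ ρ₀ ε (-u) = nonlocalTV Ω ρ₀ ρ₁ ε u := by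
  rw [nonlocalTV_eq_gapInt, nonlocalTV_eq_gapInt, neg_neg, add_comm]

lemma nonlocalTV_midpoint (hΩ : MeasurableSet Ω) (hρ₀ : AEMeasurable ρ₀ (volume.restrict Ω))
    (hρ₁ : AEMeasurable ρ₁ (volume.restrict Ω)) (hu : AEMeasurable u (volume.restrict Ω)) :
    nonlocalTV Ω ρ₀ ρ₁ ε (fun y => (u y + v y) / 2) ≤
      ENNReal.ofReal (1 / 2) * (nonlocalTV Ω ρ₀ ρ₁ ε u + nonlocalTV Ω ρ₀ ρ₁ ε v) := by
  simp only [nonlocalTV_eq_gapInt]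
  have e : (-fun y => (u y + v y) / 2) = fun y => ((-u) y + (-v) y) / 2 := by
    ext y; simp; ring
  rw [← mul_add, mul_left_comm, e]
  gcongr
  refine (add_le_add (gapInt_midpoint hΩ hρ₀ hu) (gapInt_midpoint hΩ hρ₁ hu.neg)).trans_eq ?_
  ring

lemma nonlocalTV_sup_add_nonlocalTV_inf_le (hΩ : MeasurableSet Ω)
    (hρ₀ : AEMeasurable ρ₀ (volume.restrict Ω)) (hρ₁ : AEMeasurable ρ₁ (volume.restrict Ω))
    (hu : AEMeasurable u (volume.restrict Ω)) :
    nonlocalTV Ω ρ₀ ρ₁ ε (u ⊔ v) + nonlocalTV Ω ρ₀ ρ₁ ε (u ⊓ v) ≤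
      nonlocalTV Ω ρ₀ ρ₁ ε u + nonlocalTV Ω ρ₀ ρ₁ ε v := by
  simp only [nonlocalTV_eq_gapInt]
  have e1 : -(u ⊔ v) = -u ⊓ -v := neg_sup _ _
  have e2 : -(u ⊓ v) = -u ⊔ -v := neg_inf _ _
  rw [← mul_add, ← mul_add, e1, e2]
  refine mul_le_mul_right ?_ _
  have h0 := gapInt_sup_add_gapInt_inf_le (ε := ε) (v := v) hΩ hρ₀ hu
  have h1 := gapInt_sup_add_gapInt_inf_le (ε := ε) (v := -v) hΩ hρ₁ hu.neg
  calc _ = (gapInt Ω ε ρ₀ (u ⊔ v) + gapInt Ω ε ρ₀ (u ⊓ v)) +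
        (gapInt Ω ε ρ₁ (-u ⊔ -v) + gapInt Ω ε ρ₁ (-u ⊓ -v)) := by ring
    _ ≤ _ := add_le_add h0 h1
    _ = _ := by ring

lemma nonlocalTV_comp_add_nonlocalTV_comp_le {F G : ℝ → ℝ} (hF : Monotone F) (hG : Monotone G)
    (hFG : ∀ s, F s + G s = s) :
    nonlocalTV Ω ρ₀ ρ₁ ε (F ∘ u) + nonlocalTV Ω ρ₀ ρ₁ ε (G ∘ u) ≤ nonlocalTV Ω ρ₀ ρ₁ ε u := by
  simp only [nonlocalTV_eq_gapInt]
  rw [← mul_add]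
  refine mul_le_mul_right ?_ _
  have h0 := gapInt_comp_add_gapInt_comp_le (Ω := Ω) (ε := ε) (ρ := ρ₀) (u := u) hF hG hFG
  -- For the term in -u the decomposition of the identity is reflected: s ↦ -F(-s) and s ↦ -G(-s)
  -- are again monotone and add up to s.
  have h1 := gapInt_comp_add_gapInt_comp_le (Ω := Ω) (ε := ε) (ρ := ρ₁) (u := -u)
    (F := fun s => - F (-s)) (G := fun s => - G (-s))
    (fun s t h => neg_le_neg (hF (neg_le_neg h))) (fun s t h => neg_le_neg (hG (neg_le_neg h)))
    (fun s => by have := hFG (-s); linarith)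
  have e1 : (fun s => - F (-s)) ∘ (-u) = -(F ∘ u) := by ext; simp
  have e2 : (fun s => - G (-s)) ∘ (-u) = -(G ∘ u) := by ext; simp
  rw [e1, e2] at h1
  calc _ = (gapInt Ω ε ρ₀ (F ∘ u) + gapInt Ω ε ρ₀ (G ∘ u)) +
        (gapInt Ω ε ρ₁ (-(F ∘ u)) + gapInt Ω ε ρ₁ (-(G ∘ u))) := by ring
    _ ≤ _ := add_le_add h0 h1

lemma liminf_add_liminf_le (f g : ℕ → ENNReal) :
    liminf f atTop + liminf g atTop ≤ liminf (fun n => f n + g n) atTop := by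
  rw [liminf_eq_iSup_iInf_of_nat, liminf_eq_iSup_iInf_of_nat, liminf_eq_iSup_iInf_of_nat]
  refine ENNReal.iSup_add_iSup_le fun i j => ?_
  refine le_iSup_of_le (max i j) (le_iInf₂ fun k hk => ?_)
  exact add_le_add (iInf₂_le k ((le_max_left i j).trans hk))
    (iInf₂_le k ((le_max_right i j).trans hk))

lemma nonlocalTV_le_liminf (hΩ : MeasurableSet Ω) (hρ₀ : AEMeasurable ρ₀ (volume.restrict Ω))
    (hρ₁ : AEMeasurable ρ₁ (volume.restrict Ω))
    {f : ℕ → EuclideanSpace ℝ (Fin N) → ℝ} (hfm : ∀ n, AEMeasurable (f n) (volume.restrict Ω))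
    (hf : ∀ᵐ y ∂volume.restrict Ω, Tendsto (fun n => f n y) atTop (𝓝 (u y))) :
    nonlocalTV Ω ρ₀ ρ₁ ε u ≤ liminf (fun n => nonlocalTV Ω ρ₀ ρ₁ ε (f n)) atTop := by
  simp only [nonlocalTV_eq_gapInt]
  rw [ENNReal.liminf_const_mul_of_ne_top ENNReal.ofReal_ne_top]
  gcongr
  refine le_trans (add_le_add (gapInt_le_liminf hΩ hρ₀ hfm hf)
    (gapInt_le_liminf (f := fun n => -f n) hΩ hρ₁ (fun n => (hfm n).neg) ?_))
    (liminf_add_liminf_le _ _)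
  filter_upwards [hf] with y hy
  exact hy.neg

end TV

/-! ### Existence, uniqueness and comparison of minimizers -/

section Energy

variable {N : ℕ} {Ω : Set (EuclideanSpace ℝ (Fin N))} {ε : ℝ}
  {ρ₀ ρ₁ f g u v w : EuclideanSpace ℝ (Fin N) → ℝ}

lemma energy_congr_ae (h : u =ᵐ[volume.restrict Ω] v) :
    energy Ω ρ₀ ρ₁ ε f u = energy Ω ρ₀ ρ₁ ε f v := by
  unfold energy
  rw [nonlocalTV_congr_ae h]
  congr 2
  exact lintegral_congr_ae (h.mono fun x hx => by simp only [hx])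

/-- Negation turns the essential infimum into an essential supremum, so exchanging the densities
restores the energy. This symmetry carries the subflow estimate over to superflows. -/
lemma energy_neg : energy Ω ρ₁ ρ₀ ε (-f) (-u) = energy Ω ρ₀ ρ₁ ε f u := by
  unfold energy
  rw [nonlocalTV_neg]
  congr 2
  refine lintegral_congr fun x => ?_
  rw [add_comm (ρ₁ x), Pi.neg_apply, Pi.neg_apply, neg_sub_neg, abs_sub_comm]

lemma IsMinimizer.congr_ae (hw : IsMinimizer Ω ρ₀ ρ₁ ε f w) (h : w =ᵐ[volume.restrict Ω] v) :
    IsMinimizer Ω ρ₀ ρ₁ ε f v :=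
  ⟨hw.1.ae_eq h, fun u hu => energy_congr_ae (ρ₀ := ρ₀) (ρ₁ := ρ₁) h ▸ hw.2 u hu⟩

lemma IsMinimizer.neg (hw : IsMinimizer Ω ρ₀ ρ₁ ε f w) : IsMinimizer Ω ρ₁ ρ₀ ε (-f) (-w) := by
  refine ⟨hw.1.neg, fun u hu => ?_⟩
  have h := hw.2 (-u) hu.neg
  rw [← energy_neg (u := -u), neg_neg] at h
  rwa [energy_neg]

lemma aemeasurable_ofReal_abs_sub_sq {α : Type*} [MeasurableSpace α] {μ : Measure α}
    {a b : α → ℝ} (ha : AEMeasurable a μ) (hb : AEMeasurable b μ) :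
    AEMeasurable (fun x => ENNReal.ofReal (|a x - b x| ^ 2)) μ := by
  simp only [sq_abs]
  exact ((ha.sub hb).pow_const 2).ennreal_ofReal

lemma aemeasurable_fidelity {α : Type*} [MeasurableSpace α] {μ : Measure α}
    {a b r s : α → ℝ} (ha : AEMeasurable a μ) (hb : AEMeasurable b μ) (hr : AEMeasurable r μ)
    (hs : AEMeasurable s μ) :
    AEMeasurable (fun x => ENNReal.ofReal (|a x - b x| ^ 2) * ENNReal.ofReal (r x + s x)) μ :=
  (aemeasurable_ofReal_abs_sub_sq ha hb).mul (hr.add hs).ennreal_ofReal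

/-- The fidelity term obeys the parallelogram identity, with defect a quarter of ρ|u - v|², and the
total variation is midpoint convex. Both existence and uniqueness follow from this one inequality.
-/
lemma energy_midpoint_add_le (hΩ : MeasurableSet Ω) (hρ₀ : AEMeasurable ρ₀ (volume.restrict Ω))
    (hρ₁ : AEMeasurable ρ₁ (volume.restrict Ω)) (hf : AEMeasurable f (volume.restrict Ω))
    (hu : AEMeasurable u (volume.restrict Ω)) (hv : AEMeasurable v (volume.restrict Ω))
    {c : ℝ} (hc0 : 0 ≤ c) (hc : ∀ x ∈ Ω, c ≤ ρ₀ x + ρ₁ x) :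
    energy Ω ρ₀ ρ₁ ε f (fun y => (u y + v y) / 2) +
      ENNReal.ofReal (1 / (2 * ε)) * (ENNReal.ofReal (c / 4) *
        ∫⁻ x in Ω, ENNReal.ofReal (|u x - v x| ^ 2)) ≤
      ENNReal.ofReal (1 / 2) * (energy Ω ρ₀ ρ₁ ε f u + energy Ω ρ₀ ρ₁ ε f v) := by
  have hQ : (∫⁻ x in Ω, ENNReal.ofReal (|(u x + v x) / 2 - f x| ^ 2) *
        ENNReal.ofReal (ρ₀ x + ρ₁ x)) +
      (ENNReal.ofReal (c / 4) * ∫⁻ x in Ω, ENNReal.ofReal (|u x - v x| ^ 2)) ≤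
      ENNReal.ofReal (1 / 2) *
        ((∫⁻ x in Ω, ENNReal.ofReal (|u x - f x| ^ 2) * ENNReal.ofReal (ρ₀ x + ρ₁ x)) +
          ∫⁻ x in Ω, ENNReal.ofReal (|v x - f x| ^ 2) * ENNReal.ofReal (ρ₀ x + ρ₁ x)) := by
    rw [← lintegral_const_mul'' _ (aemeasurable_ofReal_abs_sub_sq hu hv),
      ← lintegral_add_right' _ ((aemeasurable_ofReal_abs_sub_sq hu hv).const_mul _),
      ← lintegral_add_left' (aemeasurable_fidelity hu hf hρ₀ hρ₁), ← lintegral_const_mul' _ _ ENNReal.ofReal_ne_top]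
    refine setLIntegral_mono' hΩ fun x hx => ?_
    have hρx : 0 ≤ ρ₀ x + ρ₁ x := hc0.trans (hc x hx)
    rw [← ENNReal.ofReal_mul (by positivity), ← ENNReal.ofReal_mul (by positivity),
      ← ENNReal.ofReal_mul (by positivity), ← ENNReal.ofReal_mul (by positivity),
      ← ENNReal.ofReal_add (by positivity) (by positivity),
      ← ENNReal.ofReal_add (by positivity) (by positivity), ← ENNReal.ofReal_mul (by positivity)]
    refine ENNReal.ofReal_le_ofReal ?_
    simp only [sq_abs]
    nlinarith [mul_nonneg (sub_nonneg.2 (hc x hx)) (sq_nonneg (u x - v x))]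
  unfold energy
  have hT := nonlocalTV_midpoint (ε := ε) (v := v) hΩ hρ₀ hρ₁ hu
  calc _ = ENNReal.ofReal (1 / (2 * ε)) *
        ((∫⁻ x in Ω, ENNReal.ofReal (|(u x + v x) / 2 - f x| ^ 2) *
          ENNReal.ofReal (ρ₀ x + ρ₁ x)) +
        (ENNReal.ofReal (c / 4) * ∫⁻ x in Ω, ENNReal.ofReal (|u x - v x| ^ 2))) +
        nonlocalTV Ω ρ₀ ρ₁ ε (fun y => (u y + v y) / 2) := by ring
    _ ≤ _ := add_le_add (mul_le_mul_right hQ _) hT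
    _ = _ := by ring

lemma energy_le_liminf (hΩ : MeasurableSet Ω) (hρ₀ : AEMeasurable ρ₀ (volume.restrict Ω))
    (hρ₁ : AEMeasurable ρ₁ (volume.restrict Ω)) (hf : AEMeasurable f (volume.restrict Ω))
    {u_ : ℕ → EuclideanSpace ℝ (Fin N) → ℝ} (hum : ∀ n, AEMeasurable (u_ n) (volume.restrict Ω))
    (hu : ∀ᵐ y ∂volume.restrict Ω, Tendsto (fun n => u_ n y) atTop (𝓝 (u y))) :
    energy Ω ρ₀ ρ₁ ε f u ≤ liminf (fun n => energy Ω ρ₀ ρ₁ ε f (u_ n)) atTop := by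
  unfold energy
  refine le_trans ?_ (liminf_add_liminf_le _ _)
  rw [ENNReal.liminf_const_mul_of_ne_top ENNReal.ofReal_ne_top]
  refine add_le_add (mul_le_mul_right ?_ _) (nonlocalTV_le_liminf hΩ hρ₀ hρ₁ hum hu)
  refine le_trans (lintegral_mono_ae ?_) (lintegral_liminf_le' fun n => ?_)
  · filter_upwards [hu] with x hx
    have h1 : Tendsto (fun n => ENNReal.ofReal (|u_ n x - f x| ^ 2) *
        ENNReal.ofReal (ρ₀ x + ρ₁ x)) atTop
        (𝓝 (ENNReal.ofReal (|u x - f x| ^ 2) * ENNReal.ofReal (ρ₀ x + ρ₁ x))) := by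
      refine ENNReal.Tendsto.mul_const ?_ (Or.inr ENNReal.ofReal_ne_top)
      exact ENNReal.tendsto_ofReal (((hx.sub_const _).abs).pow 2)
    exact h1.liminf_eq.ge
  · exact aemeasurable_fidelity (hum n) hf hρ₀ hρ₁

lemma eLpNorm_two_sq_eq {α : Type*} [MeasurableSpace α] (μ : Measure α) (g : α → ℝ) :
    eLpNorm g 2 μ ^ 2 = ∫⁻ x, ENNReal.ofReal (|g x| ^ 2) ∂μ := by
  have h := eLpNorm_nnreal_pow_eq_lintegral (μ := μ) (f := g) (p := 2) (by norm_num)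
  norm_num at h
  rw [h]
  refine lintegral_congr fun x => ?_
  rw [ENNReal.ofReal_pow (abs_nonneg _), ← Real.norm_eq_abs, ofReal_norm]

/-- By uniform convexity near-minimizers are close in L², so a minimizing sequence converges
strongly. Lower semicontinuity is then needed only along an a.e. convergent subsequence, where it is
Fatou's lemma. -/
lemma exists_isMinimizer (hε : 0 < ε) (hΩ : MeasurableSet Ω)
    (hρ₀ : AEMeasurable ρ₀ (volume.restrict Ω))
    (hρ₁ : AEMeasurable ρ₁ (volume.restrict Ω)) (hf : AEMeasurable f (volume.restrict Ω))
    {c : ℝ} (hc0 : 0 < c) (hc : ∀ x ∈ Ω, c ≤ ρ₀ x + ρ₁ x)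
    (hfin : energy Ω ρ₀ ρ₁ ε f 0 ≠ ⊤) :
    ∃ w, IsMinimizer Ω ρ₀ ρ₁ ε f w := by
  set I : ENNReal := ⨅ u : {u : EuclideanSpace ℝ (Fin N) → ℝ // MemLp u 2 (volume.restrict Ω)},
    energy Ω ρ₀ ρ₁ ε f u.1 with hI
  have hI_le : ∀ u, MemLp u 2 (volume.restrict Ω) → I ≤ energy Ω ρ₀ ρ₁ ε f u :=
    fun u hu => iInf_le (fun u : {u : EuclideanSpace ℝ (Fin N) → ℝ //
      MemLp u 2 (volume.restrict Ω)} => energy Ω ρ₀ ρ₁ ε f u.1) ⟨u, hu⟩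
  have hI_top : I ≠ ⊤ := ne_top_of_le_ne_top hfin (hI_le 0 MemLp.zero)
  set κ : ENNReal := ENNReal.ofReal (1 / (2 * ε)) * ENNReal.ofReal (c / 4) with hκ
  have hκ0 : κ ≠ 0 := by
    simp only [hκ, ne_eq, mul_eq_zero, ENNReal.ofReal_eq_zero, not_or, not_le]
    constructor <;> positivity
  have hκt : κ ≠ ⊤ := ENNReal.mul_ne_top ENNReal.ofReal_ne_top ENNReal.ofReal_ne_top
  set B : ℕ → ENNReal := fun n => 2⁻¹ ^ n with hB
  have hBpos : ∀ n, B n ≠ 0 := fun n => pow_ne_zero _ (by simp)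
  have hBtop : ∀ n, B n ≠ ⊤ := fun n => ENNReal.pow_ne_top (by simp)
  have hBanti : Antitone B := fun m n h => pow_le_pow_right_of_le_one' (by simp) h
  -- The tolerance is chosen so that energies within δ K of the infimum force an L² distance of at
  -- most B K / 2. The halving gives the strict bound by B K, and B is summable, as the completeness
  -- lemma requires.
  set δ : ℕ → ENNReal := fun n => κ * (B n / 2) ^ 2 with hδ
  have hδanti : Antitone δ := fun m n h => by
    simp only [hδ]
    exact mul_le_mul_right (pow_le_pow_left' (ENNReal.div_le_div_right (hBanti h) _) 2) _
  have hδpos : ∀ n, δ n ≠ 0 := fun n =>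
    mul_ne_zero hκ0 (pow_ne_zero _ (ENNReal.div_ne_zero.2 ⟨hBpos n, by simp⟩))
  have hex : ∀ n, ∃ u : EuclideanSpace ℝ (Fin N) → ℝ, MemLp u 2 (volume.restrict Ω) ∧
      energy Ω ρ₀ ρ₁ ε f u < I + δ n := by
    intro n
    have hlt : I < I + δ n := ENNReal.lt_add_right hI_top (hδpos n)
    obtain ⟨u, hu⟩ := iInf_lt_iff.1 (hI ▸ hlt)
    exact ⟨u.1, u.2, hu⟩
  choose u hum hu using hex
  have hcauchy : ∀ K n m : ℕ, K ≤ n → K ≤ m →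
      eLpNorm (u n - u m) 2 (volume.restrict Ω) < B K := by
    intro K n m hn hm
    have hmid := energy_midpoint_add_le (ε := ε) hΩ hρ₀ hρ₁ hf (hum n).aemeasurable
      (hum m).aemeasurable hc0.le hc
    have h1 : I ≤ energy Ω ρ₀ ρ₁ ε f (fun y => (u n y + u m y) / 2) := by
      refine hI_le _ ?_
      have := ((hum n).add (hum m)).const_mul (1 / 2)
      refine this.ae_eq (Eventually.of_forall fun y => ?_)
      simp only [Pi.add_apply]; ring
    have h2 : ENNReal.ofReal (1 / 2) * (energy Ω ρ₀ ρ₁ ε f (u n) + energy Ω ρ₀ ρ₁ ε f (u m)) ≤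
        I + δ K := by
      calc _ ≤ ENNReal.ofReal (1 / 2) * ((I + δ K) + (I + δ K)) := by
            refine mul_le_mul_right (add_le_add ?_ ?_) _
            · exact (hu n).le.trans (add_le_add le_rfl (hδanti hn))
            · exact (hu m).le.trans (add_le_add le_rfl (hδanti hm))
        _ = I + δ K := by
            rw [← two_mul, ← mul_assoc, one_div, ENNReal.ofReal_inv_of_pos (by norm_num)]
            norm_num
            rw [ENNReal.inv_mul_cancel (by norm_num) (by norm_num), one_mul]
    have h3 : I + κ * eLpNorm (u n - u m) 2 (volume.restrict Ω) ^ 2 ≤ I + δ K := by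
      refine le_trans ?_ (hmid.trans h2)
      rw [eLpNorm_two_sq_eq, hκ, mul_assoc]
      exact add_le_add h1 le_rfl
    have h4 := (ENNReal.add_le_add_iff_left hI_top).1 h3
    have h5 := (ENNReal.mul_le_mul_iff_right hκ0 hκt).1 h4
    have h6 : eLpNorm (u n - u m) 2 (volume.restrict Ω) ≤ B K / 2 :=
      le_of_not_gt fun hlt => absurd h5 (not_le.2 (ENNReal.pow_lt_pow_left (by norm_num) hlt))
    exact h6.trans_lt (ENNReal.half_lt_self (hBpos K) (hBtop K))
  have hBsum : ∑' i, B i ≠ ⊤ := by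
    simp only [hB, ENNReal.tsum_geometric]
    simp
  obtain ⟨w, hw, hlim⟩ := Lp.cauchy_complete_eLpNorm (by norm_num) hum hBsum hcauchy
  have hmeas := tendstoInMeasure_of_tendsto_eLpNorm (p := 2) (by norm_num)
    (fun n => (hum n).1) hw.1 hlim
  obtain ⟨ns, hns, hae⟩ := hmeas.exists_seq_tendsto_ae
  refine ⟨w, hw, fun u' hu' => le_trans ?_ (hI_le u' hu')⟩
  refine le_trans (energy_le_liminf hΩ hρ₀ hρ₁ hf (fun n => (hum (ns n)).aemeasurable) hae) ?_
  have hδ0 : Tendsto (fun n => I + δ (ns n)) atTop (𝓝 I) := by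
    have hB0 : Tendsto B atTop (𝓝 0) := ENNReal.tendsto_pow_atTop_nhds_zero_of_lt_one (by simp)
    have h1 : Tendsto δ atTop (𝓝 (κ * (0 / 2) ^ 2)) := by
      refine ENNReal.Tendsto.const_mul ?_ (Or.inr hκt)
      exact ENNReal.Tendsto.pow (ENNReal.Tendsto.div_const hB0 (Or.inr (by simp)))
    have h2 := (h1.comp hns.tendsto_atTop).const_add I
    simpa using h2
  calc _ ≤ liminf (fun n => I + δ (ns n)) atTop :=
        liminf_le_liminf (Eventually.of_forall fun n => (hu (ns n)).le)
    _ = I := hδ0.liminf_eq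

/-- The midpoint of two minimizers cannot have smaller energy, so the convexity defect vanishes.
Finiteness of the energy allows the cancellation. -/
lemma IsMinimizer.ae_eq (hε : 0 < ε) (hΩ : MeasurableSet Ω)
    (hρ₀ : AEMeasurable ρ₀ (volume.restrict Ω))
    (hρ₁ : AEMeasurable ρ₁ (volume.restrict Ω)) (hf : AEMeasurable f (volume.restrict Ω))
    {c : ℝ} (hc0 : 0 < c) (hc : ∀ x ∈ Ω, c ≤ ρ₀ x + ρ₁ x)
    (hfin : energy Ω ρ₀ ρ₁ ε f 0 ≠ ⊤)
    (hu : IsMinimizer Ω ρ₀ ρ₁ ε f u) (hv : IsMinimizer Ω ρ₀ ρ₁ ε f v) :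
    u =ᵐ[volume.restrict Ω] v := by
  have hmid := energy_midpoint_add_le (ε := ε) hΩ hρ₀ hρ₁ hf hu.1.aemeasurable
      hv.1.aemeasurable hc0.le hc
  have huv : energy Ω ρ₀ ρ₁ ε f u = energy Ω ρ₀ ρ₁ ε f v :=
    le_antisymm (hu.2 v hv.1) (hv.2 u hu.1)
  have ht : energy Ω ρ₀ ρ₁ ε f v ≠ ⊤ := ne_top_of_le_ne_top hfin (hv.2 0 MemLp.zero)
  have h1 : energy Ω ρ₀ ρ₁ ε f v ≤ energy Ω ρ₀ ρ₁ ε f (fun y => (u y + v y) / 2) := by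
    refine hv.2 _ ?_
    have := (hu.1.add hv.1).const_mul (1 / 2)
    refine this.ae_eq (Eventually.of_forall fun y => ?_)
    simp only [Pi.add_apply]; ring
  have h2 : ENNReal.ofReal (1 / 2) * (energy Ω ρ₀ ρ₁ ε f u + energy Ω ρ₀ ρ₁ ε f v) =
      energy Ω ρ₀ ρ₁ ε f v + 0 := by
    rw [huv, ← two_mul, ← mul_assoc, one_div, ENNReal.ofReal_inv_of_pos (by norm_num)]
    norm_num
    rw [ENNReal.inv_mul_cancel (by norm_num) (by norm_num), one_mul]
  rw [h2] at hmid
  have h3 := (ENNReal.add_le_add_iff_left ht).1 ((add_le_add h1 le_rfl).trans hmid)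
  have h4 : ∫⁻ x in Ω, ENNReal.ofReal (|u x - v x| ^ 2) = 0 := by
    have h5 := le_antisymm h3 (zero_le)
    rw [mul_eq_zero, mul_eq_zero, ENNReal.ofReal_eq_zero, ENNReal.ofReal_eq_zero] at h5
    rcases h5 with h5 | h5 | h5
    · have : 0 < 1 / (2 * ε) := by positivity
      linarith
    · linarith
    · exact h5
  rw [lintegral_eq_zero_iff'
    (aemeasurable_ofReal_abs_sub_sq hu.1.aemeasurable hv.1.aemeasurable)] at h4
  filter_upwards [h4] with x hx
  simp only [Pi.zero_apply, ENNReal.ofReal_eq_zero] at hx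
  have : |u x - v x| = 0 := by
    have := pow_eq_zero_iff (n := 2) (by norm_num) |>.1 (le_antisymm hx (by positivity))
    exact this
  linarith [abs_eq_zero.1 this]

/-- Comparison principle: larger data have larger minimizers. -/
lemma IsMinimizer.ae_le (hε : 0 < ε) (hΩ : MeasurableSet Ω)
    (hρ₀ : AEMeasurable ρ₀ (volume.restrict Ω))
    (hρ₁ : AEMeasurable ρ₁ (volume.restrict Ω)) (hf : AEMeasurable f (volume.restrict Ω))
    {c : ℝ} (hc0 : 0 < c) (hc : ∀ x ∈ Ω, c ≤ ρ₀ x + ρ₁ x)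
    (hfin : energy Ω ρ₀ ρ₁ ε f 0 ≠ ⊤) (hfin' : energy Ω ρ₀ ρ₁ ε g 0 ≠ ⊤)
    (hfg : ∀ x ∈ Ω, f x ≤ g x)
    (hu : IsMinimizer Ω ρ₀ ρ₁ ε f u) (hv : IsMinimizer Ω ρ₀ ρ₁ ε g v) :
    u ≤ᵐ[volume.restrict Ω] v := by
  have hum := hu.1.aemeasurable
  have hvm := hv.1.aemeasurable
  -- Submodularity handles the total variation. In the fidelity, exchanging the values where u > v
  -- changes the integrand by 2(u - v)(g - f)ρ ≥ 0 in the favourable direction.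
  have hsub : energy Ω ρ₀ ρ₁ ε f (u ⊓ v) + energy Ω ρ₀ ρ₁ ε g (u ⊔ v) ≤
      energy Ω ρ₀ ρ₁ ε f u + energy Ω ρ₀ ρ₁ ε g v := by
    have hQ : (∫⁻ x in Ω, ENNReal.ofReal (|(u ⊓ v) x - f x| ^ 2) * ENNReal.ofReal (ρ₀ x + ρ₁ x)) +
        (∫⁻ x in Ω, ENNReal.ofReal (|(u ⊔ v) x - g x| ^ 2) * ENNReal.ofReal (ρ₀ x + ρ₁ x)) ≤
        (∫⁻ x in Ω, ENNReal.ofReal (|u x - f x| ^ 2) * ENNReal.ofReal (ρ₀ x + ρ₁ x)) +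
        ∫⁻ x in Ω, ENNReal.ofReal (|v x - g x| ^ 2) * ENNReal.ofReal (ρ₀ x + ρ₁ x) := by
      rw [← lintegral_add_left' (aemeasurable_fidelity (hum.inf hvm) hf hρ₀ hρ₁),
        ← lintegral_add_left' (aemeasurable_fidelity hum hf hρ₀ hρ₁)]
      refine setLIntegral_mono' hΩ fun x hx => ?_
      rw [← add_mul, ← add_mul, ← ENNReal.ofReal_add (by positivity) (by positivity),
        ← ENNReal.ofReal_add (by positivity) (by positivity)]
      refine mul_le_mul_left (ENNReal.ofReal_le_ofReal ?_) _
      simp only [sq_abs, Pi.inf_apply, Pi.sup_apply]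
      rcases le_total (u x) (v x) with h | h
      · rw [inf_eq_left.2 h, sup_eq_right.2 h]
      · rw [inf_eq_right.2 h, sup_eq_left.2 h]
        nlinarith [mul_nonneg (sub_nonneg.2 h) (sub_nonneg.2 (hfg x hx))]
    have hT := nonlocalTV_sup_add_nonlocalTV_inf_le (ε := ε) (v := v) hΩ hρ₀ hρ₁ hum
    unfold energy
    refine le_trans (le_of_eq ?_) ((add_le_add (mul_le_mul_right hQ
      (ENNReal.ofReal (1 / (2 * ε)))) hT).trans_eq ?_) <;> ring
  have htop : energy Ω ρ₀ ρ₁ ε g v ≠ ⊤ := ne_top_of_le_ne_top hfin' (hv.2 0 MemLp.zero)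
  have hsup : energy Ω ρ₀ ρ₁ ε g v ≤ energy Ω ρ₀ ρ₁ ε g (u ⊔ v) := hv.2 _ (hu.1.sup hv.1)
  have hinf : energy Ω ρ₀ ρ₁ ε f (u ⊓ v) ≤ energy Ω ρ₀ ρ₁ ε f u :=
    (ENNReal.add_le_add_iff_right htop).1 ((add_le_add le_rfl hsup).trans hsub)
  have hmin : IsMinimizer Ω ρ₀ ρ₁ ε f (u ⊓ v) :=
    ⟨hu.1.inf hv.1, fun z hz => hinf.trans (hu.2 z hz)⟩
  -- Since u ⊓ v is again a minimizer for f, uniqueness gives u = u ⊓ v.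
  have hae := hu.ae_eq hε hΩ hρ₀ hρ₁ hf hc0 hc hfin hmin
  filter_upwards [hae] with x hx
  rw [hx]
  exact inf_le_right

end Energy

/-! ### Points of density one and the signed distance -/

section Density

variable {N : ℕ} {Ω A B : Set (EuclideanSpace ℝ (Fin N))} {x : EuclideanSpace ℝ (Fin N)}

lemma densityOne_subset : densityOne Ω A ⊆ Ω := fun _ hx => hx.1

lemma ae_mem_densityOne (hA : MeasurableSet A) (hAΩ : A ⊆ Ω) :
    ∀ᵐ x ∂volume.restrict A, x ∈ densityOne Ω A := by
  filter_upwards [Besicovitch.ae_tendsto_measure_inter_div volume A, ae_restrict_mem hA]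
    with x hx hxA
  refine ⟨hAΩ hxA, hx.congr' ?_⟩
  filter_upwards [self_mem_nhdsWithin] with r hr
  have hr0 : (r : ℝ) ≠ 0 := ne_of_gt hr
  have hs : volume (Metric.sphere x r) = 0 := Measure.addHaar_sphere_of_ne_zero volume x hr0
  -- The density theorem speaks of closed balls; spheres of nonzero radius are null.
  have hae : (Metric.closedBall x r : Set (EuclideanSpace ℝ (Fin N))) =ᵐ[volume]
      Metric.ball x r := by
    rw [← Metric.ball_union_sphere]
    exact union_ae_eq_left_of_ae_eq_empty (ae_eq_empty.2 hs)
  rw [measure_congr hae, measure_congr ((ae_eq_refl A).inter hae)]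

lemma eventually_measure_inter_ball_ne_zero (hx : x ∈ densityOne Ω A) :
    ∀ᶠ r in 𝓝[>] (0 : ℝ), volume (A ∩ Metric.ball x r) ≠ 0 := by
  filter_upwards [hx.2.eventually_ne one_ne_zero] with r hr h0
  simp [h0] at hr

lemma measure_inter_ball_ne_zero (hx : x ∈ densityOne Ω A) {r : ℝ} (hr : 0 < r) :
    volume (A ∩ Metric.ball x r) ≠ 0 := by
  obtain ⟨s, hs, hs', hsr⟩ := ((eventually_measure_inter_ball_ne_zero hx).and
    (Ioo_mem_nhdsGT hr)).exists
  exact fun h0 => hs (measure_mono_null (inter_subset_inter_right _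
    (Metric.ball_subset_ball hsr.le)) h0)

/-- The density ratios of two disjoint sets add up to at most one, so both cannot tend to one. -/
lemma disjoint_densityOne (hA : MeasurableSet A) (hAB : Disjoint A B) :
    Disjoint (densityOne Ω A) (densityOne Ω B) := by
  rw [Set.disjoint_left]
  intro x hxA hxB
  have h := hxA.2.add hxB.2
  have hle : ∀ᶠ r in 𝓝[>] (0 : ℝ),
      volume (A ∩ Metric.ball x r) / volume (Metric.ball x r) +
        volume (B ∩ Metric.ball x r) / volume (Metric.ball x r) ≤ 1 := by
    refine Eventually.of_forall fun r => ?_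
    rw [← ENNReal.add_div]
    refine ENNReal.div_le_of_le_mul ?_
    rw [one_mul, ← measure_union' (hAB.mono inter_subset_left inter_subset_left)
      (hA.inter Metric.isOpen_ball.measurableSet)]
    exact measure_mono (union_subset inter_subset_right inter_subset_right)
  have := le_of_tendsto h hle
  norm_num at this

lemma densityOne_mono_ae (h : volume (A \ B) = 0) : densityOne Ω A ⊆ densityOne Ω B := by
  rintro x ⟨hxΩ, hx⟩
  refine ⟨hxΩ, tendsto_of_tendsto_of_tendsto_of_le_of_le hx tendsto_const_nhds
    (fun r => ?_) fun r => ?_⟩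
  · refine ENNReal.div_le_div_right ?_ _
    calc volume (A ∩ Metric.ball x r) ≤ volume ((B ∩ Metric.ball x r) ∪ (A \ B)) := by
          refine measure_mono fun y hy => ?_
          by_cases hyB : y ∈ B
          · exact Or.inl ⟨hyB, hy.2⟩
          · exact Or.inr ⟨hy.1, hyB⟩
      _ ≤ _ := measure_union_le _ _
      _ = _ := by rw [h, add_zero]
  · exact ENNReal.div_le_of_le_mul (by rw [one_mul]; exact measure_mono inter_subset_right)

lemma mem_densityOne_of_eventually (hx : x ∈ Ω)
    (h : ∀ᶠ r in 𝓝[>] (0 : ℝ), volume (Metric.ball x r \ A) = 0) : x ∈ densityOne Ω A := by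
  refine ⟨hx, tendsto_const_nhds.congr' ?_⟩
  filter_upwards [h, self_mem_nhdsWithin] with r hr hr0
  have : volume (A ∩ Metric.ball x r) = volume (Metric.ball x r) := by
    refine le_antisymm (measure_mono inter_subset_right) ?_
    calc volume (Metric.ball x r) ≤ volume ((A ∩ Metric.ball x r) ∪ (Metric.ball x r \ A)) := by
          refine measure_mono fun y hy => ?_
          by_cases hyA : y ∈ A
          · exact Or.inl ⟨hyA, hy⟩
          · exact Or.inr ⟨hy, hyA⟩
      _ ≤ _ := measure_union_le _ _
      _ = _ := by rw [hr, add_zero]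
  rw [this, ENNReal.div_self (Metric.measure_ball_pos volume x hr0).ne' measure_ball_lt_top.ne]

lemma densityOne_nonempty (hA : MeasurableSet A) (hAΩ : A ⊆ Ω) (h : volume A ≠ 0) :
    (densityOne Ω A).Nonempty := by
  have : NeBot (ae (volume.restrict A)) := by
    rw [ae_neBot]
    simpa using h
  exact (ae_mem_densityOne hA hAΩ).exists

lemma continuous_sdist (Ω A : Set (EuclideanSpace ℝ (Fin N))) : Continuous (sdist Ω A) :=
  (Metric.continuous_infDist_pt _).sub (Metric.continuous_infDist_pt _)

lemma exists_abs_sdist_le (hΩ : Bornology.IsBounded Ω) (A : Set (EuclideanSpace ℝ (Fin N))) :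
    ∃ C, 0 ≤ C ∧ ∀ x ∈ Ω, |sdist Ω A x| ≤ C := by
  obtain ⟨C, hC⟩ := hΩ.isCompact_closure.exists_bound_of_continuousOn
    (continuous_sdist Ω A).continuousOn
  exact ⟨max C 0, le_max_right _ _, fun x hx => (hC x (subset_closure hx)).trans (le_max_left _ _)⟩

/-- Both distances in `sdist` are antitone in the set to which they are measured. The positive
measures of B and Ω \ A keep the smaller of each pair of sets nonempty; the default value 0 of
`infDist` at the empty set would destroy the monotonicity. -/
lemma sdist_compl_mono (hB : MeasurableSet B) (hA : MeasurableSet A) (hBA : B ⊆ A)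
    (hΩ : MeasurableSet Ω) (hAΩ : A ⊆ Ω) (hB0 : volume B ≠ 0) (hA0 : volume (Ω \ A) ≠ 0) :
    sdist Ω (Ω \ B) x ≤ sdist Ω (Ω \ A) x := by
  have hsub : densityOne Ω (Ω \ A) ⊆ densityOne Ω (Ω \ B) :=
    densityOne_mono_ae (by rw [sdiff_eq_empty.2 (sdiff_subset_sdiff_right hBA), measure_empty])
  have hne : (Ω \ densityOne Ω (Ω \ B)).Nonempty := by
    obtain ⟨y, hy⟩ := densityOne_nonempty hB (hBA.trans hAΩ) hB0
    exact ⟨y, hy.1, (Set.disjoint_left.1 (disjoint_densityOne hB disjoint_sdiff_right)) hy⟩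
  have h1 := Metric.infDist_le_infDist_of_subset (x := x) hsub
    (densityOne_nonempty (hΩ.diff hA) sdiff_subset hA0)
  have h2 := Metric.infDist_le_infDist_of_subset (x := x) (sdiff_subset_sdiff_right hsub) hne
  unfold sdist
  linarith

end Density

/-! ### Well-posedness and monotonicity of the scheme -/

section Scheme

variable {N : ℕ} {Ω : Set (EuclideanSpace ℝ (Fin N))} {ε : ℝ}
  {ρ₀ ρ₁ : EuclideanSpace ℝ (Fin N) → ℝ}

lemma AdmissibleDensities.aemeasurable_zero (hρ : AdmissibleDensities Ω ρ₀ ρ₁) (hΩ : IsOpen Ω) :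
    AEMeasurable ρ₀ (volume.restrict Ω) :=
  hρ.contDiffOn_zero.continuousOn.aemeasurable hΩ.measurableSet

lemma AdmissibleDensities.aemeasurable_one (hρ : AdmissibleDensities Ω ρ₀ ρ₁) (hΩ : IsOpen Ω) :
    AEMeasurable ρ₁ (volume.restrict Ω) :=
  hρ.contDiffOn_one.continuousOn.aemeasurable hΩ.measurableSet

lemma AdmissibleDensities.symm (hρ : AdmissibleDensities Ω ρ₀ ρ₁) :
    AdmissibleDensities Ω ρ₁ ρ₀ where
  contDiffOn_zero := hρ.contDiffOn_one
  contDiffOn_one := hρ.contDiffOn_zero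
  nonneg_zero := hρ.nonneg_one
  nonneg_one := hρ.nonneg_zero
  bounds := by simpa only [add_comm] using hρ.bounds

lemma nonlocalTV_zero : nonlocalTV Ω ρ₀ ρ₁ ε 0 = 0 := by
  have h : ∀ x, gap Ω ε (0 : EuclideanSpace ℝ (Fin N) → ℝ) x = 0 := fun x => by
    simp only [gap, egap, Pi.zero_apply, sub_self, ENNReal.ofReal_zero]
    exact ENNReal.essSup_eq_zero_iff.2 (Eventually.of_forall fun _ => rfl)
  rw [nonlocalTV_eq]
  simp [h]

lemma energy_zero_ne_top (hΩ : IsOpen Ω) (hΩb : Bornology.IsBounded Ω)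
    (hρ : AdmissibleDensities Ω ρ₀ ρ₁) (A : Set (EuclideanSpace ℝ (Fin N))) :
    energy Ω ρ₀ ρ₁ ε (sdist Ω A) 0 ≠ ⊤ := by
  obtain ⟨C, hC0, hC⟩ := exists_abs_sdist_le hΩb A
  obtain ⟨c, hc0, hc⟩ := hρ.bounds
  rw [energy, nonlocalTV_zero, add_zero]
  refine ENNReal.mul_ne_top ENNReal.ofReal_ne_top (ne_of_lt ?_)
  calc _ ≤ ∫⁻ _ in Ω, ENNReal.ofReal (C ^ 2) * ENNReal.ofReal c⁻¹ := by
        refine setLIntegral_mono' hΩ.measurableSet fun x hx => ?_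
        refine mul_le_mul' (ENNReal.ofReal_le_ofReal ?_) (ENNReal.ofReal_le_ofReal (hc x hx).2.le)
        rw [Pi.zero_apply, zero_sub, abs_neg]
        exact pow_le_pow_left₀ (abs_nonneg _) (hC x hx) 2
    _ < ⊤ := by
        rw [setLIntegral_const]
        exact ENNReal.mul_lt_top (ENNReal.mul_lt_top ENNReal.ofReal_lt_top ENNReal.ofReal_lt_top)
          hΩb.measure_lt_top

lemma exists_isMinimizer_sdist (hε : 0 < ε) (hΩ : IsOpen Ω) (hΩb : Bornology.IsBounded Ω)
    (hρ : AdmissibleDensities Ω ρ₀ ρ₁) (A : Set (EuclideanSpace ℝ (Fin N))) :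
    ∃ w, IsMinimizer Ω ρ₀ ρ₁ ε (sdist Ω A) w := by
  obtain ⟨c, hc0, hc⟩ := hρ.bounds
  exact exists_isMinimizer hε hΩ.measurableSet (hρ.aemeasurable_zero hΩ) (hρ.aemeasurable_one hΩ)
    (continuous_sdist Ω A).measurable.aemeasurable hc0 (fun x hx => (hc x hx).1.le)
    (energy_zero_ne_top hΩ hΩb hρ A)

lemma isMinimizer_schemeMinimizer (hε : 0 < ε) (hΩ : IsOpen Ω) (hΩb : Bornology.IsBounded Ω)
    (hρ : AdmissibleDensities Ω ρ₀ ρ₁) (A : Set (EuclideanSpace ℝ (Fin N))) :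
    IsMinimizer Ω ρ₀ ρ₁ ε (sdist Ω (Ω \ A)) (schemeMinimizer Ω ρ₀ ρ₁ ε A) :=
  Classical.epsilon_spec (exists_isMinimizer_sdist hε hΩ hΩb hρ (Ω \ A))

lemma schemeWellPosed (hε : 0 < ε) (hΩ : IsOpen Ω) (hΩb : Bornology.IsBounded Ω)
    (hρ : AdmissibleDensities Ω ρ₀ ρ₁) : SchemeWellPosed Ω ρ₀ ρ₁ ε := by
  intro A _ _ _ _
  obtain ⟨w, hw⟩ := exists_isMinimizer_sdist (ε := ε) hε hΩ hΩb hρ (Ω \ A)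
  obtain ⟨c, hc0, hc⟩ := hρ.bounds
  exact ⟨w, hw, fun w' hw' => hw'.ae_eq hε hΩ.measurableSet (hρ.aemeasurable_zero hΩ)
    (hρ.aemeasurable_one hΩ) (continuous_sdist Ω _).measurable.aemeasurable hc0
    (fun x hx => (hc x hx).1.le) (energy_zero_ne_top hΩ hΩb hρ _) hw⟩

/-- Apart from the degenerate cases, ordered sets have ordered signed distances and hence a.e.
ordered minimizers. The positivity sets are then nested up to a null set, which `densityOne` does
not see. -/
lemma isMonotoneOperator_oneStep (hε : 0 < ε) (hΩ : IsOpen Ω) (hΩb : Bornology.IsBounded Ω)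
    (hρ : AdmissibleDensities Ω ρ₀ ρ₁) : IsMonotoneOperator Ω (oneStep Ω ρ₀ ρ₁ ε) := by
  intro B A hB hA hBA hAΩ
  unfold oneStep
  by_cases hB0 : volume B = 0
  · simp [hB0]
  have hA0 : volume A ≠ 0 := fun h => hB0 (measure_mono_null hBA h)
  by_cases hA1 : volume (Ω \ A) = 0
  · rw [if_neg hA0, if_pos hA1, if_neg hB0]
    split_ifs
    exacts [le_rfl, densityOne_subset]
  have hB1 : volume (Ω \ B) ≠ 0 := fun h => hA1 (measure_mono_null (sdiff_subset_sdiff_right hBA) h)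
  rw [if_neg hB0, if_neg hB1, if_neg hA0, if_neg hA1]
  obtain ⟨c, hc0, hc⟩ := hρ.bounds
  have hle := (isMinimizer_schemeMinimizer hε hΩ hΩb hρ B).ae_le hε hΩ.measurableSet
    (hρ.aemeasurable_zero hΩ) (hρ.aemeasurable_one hΩ)
    (continuous_sdist Ω _).measurable.aemeasurable hc0
    (fun x hx => (hc x hx).1.le) (energy_zero_ne_top hΩ hΩb hρ _) (energy_zero_ne_top hΩ hΩb hρ _)
    (fun x _ => sdist_compl_mono hB hA hBA hΩ.measurableSet hAΩ hB0 hA1)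
    (isMinimizer_schemeMinimizer hε hΩ hΩb hρ A)
  refine densityOne_mono_ae ?_
  rw [EventuallyLE, ae_restrict_iff' hΩ.measurableSet, ae_iff] at hle
  refine measure_mono_null ?_ hle
  rintro y ⟨⟨hyΩ, hy1⟩, hy2⟩
  simp only [mem_ofPred_eq, not_and, not_lt, Classical.not_imp, not_le] at hy2 ⊢
  exact ⟨hyΩ, (hy2 hyΩ).trans_lt hy1⟩

end Scheme

/-! ### A Jacobian estimate -/

section Det

variable {N : ℕ}

lemma trace_eq_sum_apply (H : EuclideanSpace ℝ (Fin N) →L[ℝ] EuclideanSpace ℝ (Fin N)) :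
    LinearMap.trace ℝ _ (H : EuclideanSpace ℝ (Fin N) →ₗ[ℝ] EuclideanSpace ℝ (Fin N)) =
      ∑ i : Fin N, (H (EuclideanSpace.single i 1)) i := by
  rw [LinearMap.trace_eq_sum_inner _ (EuclideanSpace.basisFun (Fin N) ℝ)]
  refine Finset.sum_congr rfl fun i _ => ?_
  rw [EuclideanSpace.basisFun_apply, EuclideanSpace.inner_single_left]
  simp

/-- For a symmetric `H` with `1 + sH` positive, `det (1 + sH) ≤ exp (s tr H)`. -/
lemma abs_det_one_add_smul_le (H : EuclideanSpace ℝ (Fin N) →L[ℝ] EuclideanSpace ℝ (Fin N))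
    (hH : ∀ u v, inner ℝ (H u) v = inner ℝ u (H v)) (s : ℝ) (hs : |s| * ‖H‖ ≤ 1) :
    |(ContinuousLinearMap.id ℝ (EuclideanSpace ℝ (Fin N)) + s • H).det| ≤
      Real.exp (s * ∑ i : Fin N, (H (EuclideanSpace.single i 1)) i) := by
  set M : EuclideanSpace ℝ (Fin N) →L[ℝ] EuclideanSpace ℝ (Fin N) :=
    ContinuousLinearMap.id ℝ _ + s • H with hM
  have hsymm : (M : EuclideanSpace ℝ (Fin N) →ₗ[ℝ] EuclideanSpace ℝ (Fin N)).IsSymmetric := by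
    intro u v
    simp only [hM, ContinuousLinearMap.coe_coe, add_apply,
      smul_apply, ContinuousLinearMap.id_apply, inner_add_left,
      inner_add_right, inner_smul_left, inner_smul_right, hH]
    simp
  have hn : Module.finrank ℝ (EuclideanSpace ℝ (Fin N)) = N := by simp
  have hdet : M.det = ∏ i, hsymm.eigenvalues hn i := hsymm.det_eq_prod_eigenvalues hn
  have htr : (N : ℝ) + s * ∑ i : Fin N, (H (EuclideanSpace.single i 1)) i =
      ∑ i, hsymm.eigenvalues hn i := by
    have := hsymm.trace_eq_sum_eigenvalues hn
    simp only [RCLike.ofReal_real_eq_id, id_eq] at this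
    rw [← this, trace_eq_sum_apply, Finset.mul_sum]
    simp [hM, Finset.sum_add_distrib]
  -- Each eigenvalue is the Rayleigh quotient 1 + s⟨He, e⟩ of a unit eigenvector e, and |s|‖H‖ ≤ 1.
  have hpos : ∀ i, 0 ≤ hsymm.eigenvalues hn i := by
    intro i
    set e := hsymm.eigenvectorBasis hn i
    have he : ‖e‖ = 1 := (hsymm.eigenvectorBasis hn).orthonormal.1 i
    have h1 : M e = hsymm.eigenvalues hn i • e := hsymm.apply_eigenvectorBasis hn i
    have h2 : inner ℝ (M e) e = hsymm.eigenvalues hn i := by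
      rw [h1, inner_smul_left, real_inner_self_eq_norm_sq, he]; simp
    have h3 : inner ℝ (M e) e = 1 + s * inner ℝ (H e) e := by
      simp only [hM, add_apply, smul_apply,
        ContinuousLinearMap.id_apply, inner_add_left, inner_smul_left,
        real_inner_self_eq_norm_sq, he]
      simp
    have h4 : |s * inner ℝ (H e) e| ≤ 1 := by
      rw [abs_mul]
      refine le_trans (mul_le_mul_of_nonneg_left ?_ (abs_nonneg s)) hs
      calc |inner ℝ (H e) e| ≤ ‖H e‖ * ‖e‖ := abs_real_inner_le_norm _ _
        _ ≤ ‖H‖ * ‖e‖ * ‖e‖ := by gcongr; exact H.le_opNorm e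
        _ = ‖H‖ := by rw [he]; ring
    rw [← h2, h3]
    linarith [neg_le_of_abs_le h4]
  rw [hdet, abs_of_nonneg (Finset.prod_nonneg fun i _ => hpos i)]
  -- Each factor satisfies λ ≤ exp(λ - 1), so the product is bounded by the exponential of the trace
  -- with no second-order remainder.
  calc ∏ i, hsymm.eigenvalues hn i ≤ ∏ i, Real.exp (hsymm.eigenvalues hn i - 1) :=
        Finset.prod_le_prod (fun i _ => hpos i) fun i _ => by
          linarith [Real.add_one_le_exp (hsymm.eigenvalues hn i - 1)]
    _ = Real.exp (s * ∑ i : Fin N, (H (EuclideanSpace.single i 1)) i) := by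
        rw [← Real.exp_sum, Finset.sum_sub_distrib, ← htr]
        congr 1
        simp

end Det

/-! ### Straight characteristics of the eikonal equation -/

/-- A `1`-Lipschitz function on `Ω` that is `C²` with unit gradient and Hessian bounded by `L`
in the tube `{|g| < 5a}`, which stays at distance `a` from the boundary of `Ω`. -/
structure IsTube {N : ℕ} (Ω : Set (EuclideanSpace ℝ (Fin N)))
    (g : EuclideanSpace ℝ (Fin N) → ℝ) (a L : ℝ) : Prop where
  pos : 0 < a
  lip : ∀ x ∈ Ω, ∀ y ∈ Ω, |g x - g y| ≤ dist x y
  ball_subset : ∀ x ∈ Ω, |g x| < 5 * a → Metric.ball x a ⊆ Ω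
  differentiableAt : ∀ x ∈ Ω, |g x| < 5 * a → DifferentiableAt ℝ g x
  norm_gradient : ∀ x ∈ Ω, |g x| < 5 * a → ‖gradient g x‖ = 1
  differentiableAt_gradient : ∀ x ∈ Ω, |g x| < 5 * a → DifferentiableAt ℝ (gradient g) x
  norm_hessian_le : ∀ x ∈ Ω, |g x| < 5 * a → ‖fderiv ℝ (gradient g) x‖ ≤ L

/-- The translation by `s` along the gradient of `g`. -/
def gradShift {N : ℕ} (g : EuclideanSpace ℝ (Fin N) → ℝ) (s : ℝ) (x : EuclideanSpace ℝ (Fin N)) :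
    EuclideanSpace ℝ (Fin N) :=
  x + s • gradient g x

lemma gradient_neg {F : Type*} [NormedAddCommGroup F] [InnerProductSpace ℝ F] [CompleteSpace F]
    (g : F → ℝ) : gradient (-g) = -gradient g := by
  ext x
  simp [gradient, fderiv_neg]

namespace IsTube

variable {N : ℕ} {Ω : Set (EuclideanSpace ℝ (Fin N))} {g : EuclideanSpace ℝ (Fin N) → ℝ}
  {a L s : ℝ} {x y : EuclideanSpace ℝ (Fin N)}

lemma eventually_mem (h : IsTube Ω g a L) (hx : x ∈ Ω) (hg : |g x| < 5 * a) :
    ∀ᶠ y in 𝓝 x, y ∈ Ω ∧ |g y| < 5 * a := by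
  have hc : ContinuousAt (fun y => |g y|) x := (h.differentiableAt x hx hg).continuousAt.abs
  filter_upwards [Metric.ball_mem_nhds x h.pos, hc.eventually_lt_const hg] with y hy hy'
  exact ⟨h.ball_subset x hx hg hy, hy'⟩

lemma hessian_symm (h : IsTube Ω g a L) (hx : x ∈ Ω) (hg : |g x| < 5 * a)
    (u v : EuclideanSpace ℝ (Fin N)) :
    inner ℝ (fderiv ℝ (gradient g) x u) v = inner ℝ u (fderiv ℝ (gradient g) x v) := by
  have h1 : ∀ᶠ y in 𝓝 x, HasFDerivAt g (fderiv ℝ g y) y := by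
    filter_upwards [h.eventually_mem hx hg] with y hy
    exact (h.differentiableAt y hy.1 hy.2).hasFDerivAt
  set Φ : EuclideanSpace ℝ (Fin N) →L[ℝ] StrongDual ℝ (EuclideanSpace ℝ (Fin N)) :=
    innerSL ℝ with hΦ
  have h2 : HasFDerivAt (fderiv ℝ g) (Φ ∘L fderiv ℝ (gradient g) x) x := by
    have := Φ.hasFDerivAt.comp x (h.differentiableAt_gradient x hx hg).hasFDerivAt
    refine this.congr_of_eventuallyEq (Eventually.of_forall fun y => ?_)
    ext v
    rw [Function.comp_apply, hΦ, innerSL_apply_apply, inner_gradient_left]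
  have h3 := second_derivative_symmetric_of_eventually h1 h2 u v
  have h4 : ∀ p q, (Φ ∘L fderiv ℝ (gradient g) x) p q =
    inner ℝ (fderiv ℝ (gradient g) x p) q := fun p q => rfl
  rw [h4, h4] at h3
  rw [h3, real_inner_comm]

/-- Differentiate |∇g|² = 1 and use the symmetry of the Hessian. -/
lemma hessian_apply_gradient (h : IsTube Ω g a L) (hx : x ∈ Ω) (hg : |g x| < 5 * a) :
    fderiv ℝ (gradient g) x (gradient g x) = 0 := by
  have hd := (h.differentiableAt_gradient x hx hg).hasFDerivAt
  have h1 := hd.inner ℝ hd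
  have h2 : HasFDerivAt (fun y => inner ℝ (gradient g y) (gradient g y) : _ → ℝ)
      (0 : EuclideanSpace ℝ (Fin N) →L[ℝ] ℝ) x := by
    refine (hasFDerivAt_const (1 : ℝ) x).congr_of_eventuallyEq ?_
    filter_upwards [h.eventually_mem hx hg] with y hy
    rw [real_inner_self_eq_norm_sq, h.norm_gradient y hy.1 hy.2]
    norm_num
  have h3 := h1.unique h2
  refine ext_inner_right ℝ fun v => ?_
  have h4 := congrArg (fun A : EuclideanSpace ℝ (Fin N) →L[ℝ] ℝ => A v) h3
  simp only [ContinuousLinearMap.comp_apply, fderivInnerCLM_apply, ContinuousLinearMap.prod_apply,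
    zero_apply] at h4
  rw [h.hessian_symm hx hg, inner_zero_left]
  rw [real_inner_comm] at h4
  rw [real_inner_comm] at h4 ⊢
  rw [real_inner_comm] at h4
  linarith [real_inner_comm (gradient g x) (fderiv ℝ (gradient g) x v)]

lemma mem_of_dist_lt (h : IsTube Ω g a L) (hx : x ∈ Ω) (hg : |g x| < 4 * a)
    (hxy : dist y x < a) : y ∈ Ω ∧ |g y| < 5 * a := by
  have hy : y ∈ Ω := h.ball_subset x hx (by linarith [h.pos]) hxy
  refine ⟨hy, ?_⟩
  have := h.lip y hy x hx
  have h2 := abs_sub_abs_le_abs_sub (g y) (g x)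
  linarith

lemma dist_gradShift (h : IsTube Ω g a L) (hx : x ∈ Ω) (hg : |g x| < 4 * a) :
    dist (gradShift g s x) x = |s| := by
  rw [gradShift, dist_self_add_left, norm_smul, h.norm_gradient x hx (by linarith [h.pos]),
    mul_one, Real.norm_eq_abs]

lemma dist_gradShift_of_unit_mul_lt (h : IsTube Ω g a L) (hx : x ∈ Ω) (hg : |g x| < 4 * a)
    (hs : |s| < a) {τ : ℝ} (hτ : τ ∈ Icc (0 : ℝ) 1) : dist (gradShift g (τ * s) x) x < a := by
  rw [h.dist_gradShift hx hg, abs_mul, abs_of_nonneg hτ.1]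
  exact (mul_le_of_le_one_left (abs_nonneg s) hτ.2).trans_lt hs

lemma hasDerivAt_line (v : EuclideanSpace ℝ (Fin N)) (s τ : ℝ) (x : EuclideanSpace ℝ (Fin N)) :
    HasDerivAt (fun τ : ℝ => x + (τ * s) • v) (s • v) τ := by
  have := (((hasDerivAt_id τ).mul_const s).smul_const v).const_add x
  simpa using this

/-- Let ν = ∇g(x) and f(τ) = ∇g(x + τsν) - ν. Since D²g annihilates ∇g, f' = sD²g ν = -sD²g f, a
linear equation with f(0) = 0. Grönwall's inequality with the Hessian bound gives f = 0, although
D²g is not assumed Lipschitz. -/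
lemma gradient_gradShift (h : IsTube Ω g a L) (hx : x ∈ Ω) (hg : |g x| < 4 * a) (hs : |s| < a) :
    gradient g (gradShift g s x) = gradient g x := by
  set ν := gradient g x with hν
  have hmem : ∀ τ ∈ Icc (0 : ℝ) 1, x + (τ * s) • ν ∈ Ω ∧ |g (x + (τ * s) • ν)| < 5 * a :=
    fun τ hτ => h.mem_of_dist_lt hx hg (h.dist_gradShift_of_unit_mul_lt hx hg hs hτ)
  have hder : ∀ τ ∈ Icc (0 : ℝ) 1, HasDerivAt (fun τ : ℝ => gradient g (x + (τ * s) • ν) - ν)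
      (fderiv ℝ (gradient g) (x + (τ * s) • ν) (s • ν)) τ := by
    intro τ hτ
    have h1 := (h.differentiableAt_gradient _ (hmem τ hτ).1 (hmem τ hτ).2).hasFDerivAt
    exact (h1.comp_hasDerivAt τ (hasDerivAt_line ν s τ x)).sub_const ν
  have hzero := eq_zero_of_abs_deriv_le_mul_abs_self_of_eq_zero_right (K := |s| * L)
    (f := fun τ : ℝ => gradient g (x + (τ * s) • ν) - ν)
    (fun τ hτ => (hder τ hτ).continuousAt.continuousWithinAt)
    (fun τ hτ => (hder τ ⟨hτ.1, hτ.2.le⟩).hasDerivWithinAt) (by simp [hν]) (by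
      intro τ hτ
      have hm := hmem τ ⟨hτ.1, hτ.2.le⟩
      set z := x + (τ * s) • ν
      have h0 := h.hessian_apply_gradient hm.1 hm.2
      have h1 : fderiv ℝ (gradient g) z (s • ν) =
          -(s • fderiv ℝ (gradient g) z (gradient g z - ν)) := by
        rw [map_sub, h0, zero_sub, smul_neg, neg_neg, map_smul]
      rw [h1, norm_neg, norm_smul, Real.norm_eq_abs, mul_assoc]
      refine mul_le_mul_of_nonneg_left ?_ (abs_nonneg s)
      refine (ContinuousLinearMap.le_opNorm _ _).trans ?_
      exact mul_le_mul_of_nonneg_right (h.norm_hessian_le z hm.1 hm.2) (norm_nonneg _))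
    1 ⟨zero_le_one, le_rfl⟩
  rw [one_mul, sub_eq_zero] at hzero
  exact hzero

/-- Along the segment the gradient stays equal to ν, so g grows at rate s⟨ν, ν⟩ = s. -/
lemma apply_gradShift (h : IsTube Ω g a L) (hx : x ∈ Ω) (hg : |g x| < 4 * a) (hs : |s| < a) :
    g (gradShift g s x) = g x + s := by
  set ν := gradient g x with hν
  have hder : ∀ τ ∈ Icc (0 : ℝ) 1, HasDerivAt (fun τ : ℝ => g (x + (τ * s) • ν) - τ * s) 0 τ := by
    intro τ hτ
    have hm := h.mem_of_dist_lt hx hg (h.dist_gradShift_of_unit_mul_lt hx hg hs hτ)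
    have h1 := (h.differentiableAt _ hm.1 hm.2).hasGradientAt.hasFDerivAt
    have h2 := (h1.comp_hasDerivAt τ (hasDerivAt_line ν s τ x)).sub
      ((hasDerivAt_id τ).mul_const s)
    refine h2.congr_deriv ?_
    have h3 : gradient g (gradShift g (τ * s) x) = ν := by
      refine h.gradient_gradShift hx hg ?_
      rw [← h.dist_gradShift hx hg]
      exact h.dist_gradShift_of_unit_mul_lt hx hg hs hτ
    rw [h3, InnerProductSpace.toDual_apply_apply, inner_smul_right, real_inner_self_eq_norm_sq,
      h.norm_gradient x hx (by linarith [h.pos])]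
    ring
  have hc := constant_of_has_deriv_right_zero
    (f := fun τ : ℝ => g (x + (τ * s) • ν) - τ * s)
    (fun τ hτ => (hder τ hτ).continuousAt.continuousWithinAt)
    (fun τ hτ => (hder τ ⟨hτ.1, hτ.2.le⟩).hasDerivWithinAt) 1 ⟨zero_le_one, le_rfl⟩
  simp only [one_mul, zero_mul, zero_smul, add_zero, sub_zero] at hc
  rw [gradShift, ← hν]
  linarith

lemma gradShift_neg_gradShift (h : IsTube Ω g a L) (hx : x ∈ Ω) (hg : |g x| < 4 * a)
    (hs : |s| < a) : gradShift g (-s) (gradShift g s x) = x := by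
  have h1 := h.gradient_gradShift hx hg hs
  rw [gradShift, h1, gradShift]
  simp

lemma gradShift_mem (h : IsTube Ω g a L) (hx : x ∈ Ω) (hg : |g x| < 4 * a) (hs : |s| < a) :
    gradShift g s x ∈ Ω :=
  (h.mem_of_dist_lt hx hg (by rwa [h.dist_gradShift hx hg])).1

lemma hasFDerivAt_gradShift (h : IsTube Ω g a L) (hx : x ∈ Ω) (hg : |g x| < 4 * a) :
    HasFDerivAt (gradShift g s) (ContinuousLinearMap.id ℝ (EuclideanSpace ℝ (Fin N)) +
      s • fderiv ℝ (gradient g) x) x :=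
  (hasFDerivAt_id x).add
    ((h.differentiableAt_gradient x hx (by linarith [h.pos])).hasFDerivAt.const_smul s)

lemma injOn_gradShift (h : IsTube Ω g a L) (hs : |s| < a) :
    InjOn (gradShift g s) {x ∈ Ω | |g x| < 4 * a} := by
  intro x hx y hy hxy
  rw [← h.gradShift_neg_gradShift hx.1 hx.2 hs, hxy, h.gradShift_neg_gradShift hy.1 hy.2 hs]

/-- The shift is injective, with inverse the shift by -s, and its derivative 1 + sD²g is symmetric;
the area formula and `abs_det_one_add_smul_le` apply. -/
lemma setLIntegral_image_gradShift_le (h : IsTube Ω g a L) (hs : |s| < a) (hsL : |s| * L ≤ 1)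
    {S : Set (EuclideanSpace ℝ (Fin N))} (hS : MeasurableSet S)
    (hSt : S ⊆ {x ∈ Ω | |g x| < 4 * a}) (G : EuclideanSpace ℝ (Fin N) → ENNReal) :
    ∫⁻ y in gradShift g s '' S, G y ≤
      ∫⁻ x in S, ENNReal.ofReal (Real.exp (s * divergence (gradient g) x)) *
        G (gradShift g s x) := by
  rw [lintegral_image_eq_lintegral_abs_det_fderiv_mul volume hS
    (fun x hx => (h.hasFDerivAt_gradShift (hSt hx).1 (hSt hx).2).hasFDerivWithinAt)
    ((h.injOn_gradShift hs).mono hSt)]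
  refine setLIntegral_mono' hS fun x hx => mul_le_mul_left (ENNReal.ofReal_le_ofReal ?_) _
  have h5 : |g x| < 5 * a := by linarith [(hSt hx).2, h.pos]
  refine abs_det_one_add_smul_le _ (h.hessian_symm (hSt hx).1 h5) s (le_trans ?_ hsL)
  exact mul_le_mul_of_nonneg_left (h.norm_hessian_le x (hSt hx).1 h5) (abs_nonneg s)

/-- The preimage of a null set under the shift is null. -/
lemma ae_gradShift (h : IsTube Ω g a L) (hs : |s| < a)
    {p : EuclideanSpace ℝ (Fin N) → Prop} (hp : ∀ᵐ z ∂volume.restrict Ω, p z)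
    (hΩ : MeasurableSet Ω) :
    ∀ᵐ x ∂volume.restrict Ω, |g x| < 3 * a → p (gradShift g s x) := by
  rw [ae_restrict_iff' hΩ, ae_iff] at hp ⊢
  set P := {z | ¬(z ∈ Ω → p z)}
  set Q := P ∩ {z | |g z| < 4 * a}
  have hQ : volume Q = 0 := measure_mono_null inter_subset_left hp
  -- The exceptional set is contained in the image of a null set under the inverse shift, and a
  -- differentiable map of the space to itself preserves null sets.
  have him : volume (gradShift g (-s) '' Q) = 0 := by
    refine addHaar_image_eq_zero_of_differentiableOn_of_addHaar_eq_zero volume (fun z hz => ?_) hQ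
    have hzΩ : z ∈ Ω := by
      by_contra hcon
      exact hz.1 fun hz' => absurd hz' hcon
    exact (h.hasFDerivAt_gradShift hzΩ hz.2).differentiableAt.differentiableWithinAt
  refine measure_mono_null (fun x hx => ?_) him
  simp only [mem_ofPred_eq, Classical.not_imp] at hx
  obtain ⟨hxΩ, hx3, hx⟩ := hx
  have hx4 : |g x| < 4 * a := by linarith [h.pos]
  refine ⟨gradShift g s x, ⟨fun hcon => hx (hcon (h.gradShift_mem hxΩ hx4 hs)), ?_⟩,
    h.gradShift_neg_gradShift hxΩ hx4 hs⟩
  change |g (gradShift g s x)| < 4 * a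
  rw [h.apply_gradShift hxΩ hx4 hs]
  linarith [abs_add_le (g x) s]

end IsTube

/-! ### Truncation and cutoff -/

/-- The truncation of `g` to the interval `[-a, a]`. -/
def clampFun {N : ℕ} (g : EuclideanSpace ℝ (Fin N) → ℝ) (a : ℝ) (x : EuclideanSpace ℝ (Fin N)) :
    ℝ :=
  max (-a) (min a (g x))

/-- The Lipschitz cutoff that vanishes for `g ≤ -3a` and equals `1` for `g ≥ -2a`. -/
def cutoff {N : ℕ} (g : EuclideanSpace ℝ (Fin N) → ℝ) (a : ℝ) (x : EuclideanSpace ℝ (Fin N)) :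
    ℝ :=
  max 0 (min 1 (3 + g x / a))

section Cutoff

variable {N : ℕ} {g : EuclideanSpace ℝ (Fin N) → ℝ} {a : ℝ} {x y : EuclideanSpace ℝ (Fin N)}

lemma cutoff_nonneg : 0 ≤ cutoff g a x := le_max_left _ _

lemma cutoff_le_one : cutoff g a x ≤ 1 := max_le zero_le_one (min_le_left _ _)

lemma cutoff_eq_one (ha : 0 < a) (h : -(2 * a) ≤ g x) : cutoff g a x = 1 := by
  have h1 : -2 ≤ g x / a := by rw [le_div_iff₀ ha]; linarith
  rw [cutoff, min_eq_left (by linarith), max_eq_right zero_le_one]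

lemma cutoff_eq_zero (ha : 0 < a) (h : g x ≤ -(3 * a)) : cutoff g a x = 0 := by
  have h1 : g x / a ≤ -3 := by rw [div_le_iff₀ ha]; linarith
  rw [cutoff, min_eq_right (by linarith), max_eq_left (by linarith)]

lemma cutoff_le_add (ha : 0 < a) {s : ℝ} (hs : 0 ≤ s) (h : g y ≤ g x + s) :
    cutoff g a y ≤ cutoff g a x + s / a := by
  have h1 : g y / a ≤ g x / a + s / a := by
    rw [← add_div]; exact div_le_div_of_nonneg_right h ha.le
  have h2 : 0 ≤ s / a := div_nonneg hs ha.le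
  unfold cutoff
  refine max_le (add_nonneg (le_max_left _ _) h2) ?_
  rcases le_total 1 (3 + g x / a) with h3 | h3
  · have : max 0 (min 1 (3 + g x / a)) = 1 := by rw [min_eq_left h3, max_eq_right zero_le_one]
    rw [this]
    exact (min_le_left _ _).trans (by linarith)
  · have : 3 + g x / a ≤ max 0 (min 1 (3 + g x / a)) := by
      rw [min_eq_right h3]; exact le_max_right _ _
    exact (min_le_right _ _).trans (by linarith)

lemma clampFun_eq_neg (ha : 0 < a) (h : g x ≤ -a) : clampFun g a x = -a := by
  rw [clampFun, min_eq_right (by linarith), max_eq_left h]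

lemma clampFun_eq (ha : 0 < a) (h : a ≤ g x) : clampFun g a x = a := by
  rw [clampFun, min_eq_left h, max_eq_right (by linarith)]

lemma neg_le_clampFun : -a ≤ clampFun g a x := le_max_left _ _

lemma clampFun_le (ha : 0 < a) : clampFun g a x ≤ a := max_le (by linarith) (min_le_left _ _)

lemma clampFun_le_add {s : ℝ} (hs : 0 ≤ s) (h : g y ≤ g x + s) :
    clampFun g a y ≤ clampFun g a x + s := by
  have h1 : min a (g y) ≤ min a (g x) + s := by
    rcases le_total a (g x) with h2 | h2
    · rw [min_eq_left h2]; exact (min_le_left _ _).trans (by linarith)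
    · rw [min_eq_right h2]; exact (min_le_right _ _).trans h
  unfold clampFun
  refine max_le ?_ ?_
  · linarith [le_max_left (-a) (min a (g x))]
  · linarith [le_max_right (-a) (min a (g x))]

lemma clampFun_mono (h : g y ≤ g x) : clampFun g a y ≤ clampFun g a x := by
  have := clampFun_le_add (a := a) le_rfl (h.trans_eq (add_zero _).symm)
  linarith

lemma measurable_cutoff (hg : Measurable g) (a : ℝ) : Measurable (cutoff g a) :=
  measurable_const.max (measurable_const.min (measurable_const.add (hg.div_const a)))

lemma measurable_clampFun (hg : Measurable g) (a : ℝ) : Measurable (clampFun g a) :=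
  measurable_const.max (measurable_const.min hg)

end Cutoff

/-! ### One-sided first variation of the total variation at a truncated distance -/

section FirstVariation

variable {N : ℕ} {Ω : Set (EuclideanSpace ℝ (Fin N))} {ε a L s : ℝ}
  {g φ ρ F : EuclideanSpace ℝ (Fin N) → ℝ}

/-- The part of the tube on which the first variation of the truncated function lives. -/
def activeTube (Ω : Set (EuclideanSpace ℝ (Fin N))) (g : EuclideanSpace ℝ (Fin N) → ℝ) (a : ℝ) :
    Set (EuclideanSpace ℝ (Fin N)) :=
  {x ∈ Ω | -(3 * a) < g x ∧ g x < 2 * a}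

lemma measurableSet_activeTube (hΩ : MeasurableSet Ω) (hg : Measurable g) :
    MeasurableSet (activeTube Ω g a) :=
  hΩ.inter ((measurableSet_lt measurable_const hg).inter (measurableSet_lt hg measurable_const))

lemma measurable_gradShift (g : EuclideanSpace ℝ (Fin N) → ℝ) (s : ℝ) : Measurable (gradShift g s) := by
  have h1 : Measurable (gradient g) :=
    (InnerProductSpace.toDual ℝ (EuclideanSpace ℝ (Fin N))).symm.continuous.measurable.comp
      (measurable_fderiv ℝ g)
  exact measurable_id.add (h1.const_smul s)

namespace IsTube

lemma gap_clampFun_le (h : IsTube Ω g a L) (hΩ : MeasurableSet Ω) (hε : 0 < ε) {x}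
    (hx : x ∈ Ω) : gap Ω ε (clampFun g a) x ≤ ENNReal.ofReal ε := by
  refine gap_le_of_forall hΩ hε.le fun y hy hyx => clampFun_le_add hε.le ?_
  linarith [le_of_abs_le (h.lip y hy x hx)]

lemma gap_neg_clampFun_le (h : IsTube Ω g a L) (hΩ : MeasurableSet Ω) (hε : 0 < ε) {x}
    (hx : x ∈ Ω) : gap Ω ε (-clampFun g a) x ≤ ENNReal.ofReal ε := by
  refine gap_le_of_forall hΩ hε.le fun y hy hyx => ?_
  have : clampFun g a x ≤ clampFun g a y + ε := clampFun_le_add hε.le (by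
    linarith [neg_le_of_abs_le (h.lip y hy x hx)])
  simp only [Pi.neg_apply]
  linarith

/-- Let v be the truncation and y = x + s∇g(x), a point of B(x, ε). Testing there gives gap(v + φ) ≥
(v + φ)(y) - (v + φ)(x), while gap(v) ≤ v(y) - v(x) + (ε - s) because g is 1-Lipschitz. Where v is
locally constant its gap vanishes, so the first bound may be weighted by any θ in [0, 1]. The cutoff
θ exploits this freedom to make the weight vanish continuously at the lower end of the tube, so that
the change of variables produces no boundary term there. -/
lemma ae_le_gap_clampFun_add (h : IsTube Ω g a L) (hΩ : MeasurableSet Ω) (hg : Measurable g)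
    (hφ : Measurable φ) (hφ0 : ∀ x, 0 ≤ φ x) (hs : 0 < s) (hsε : s < ε) (hεa : ε < a) :
    ∀ᵐ x ∂volume.restrict Ω,
      gap Ω ε (clampFun g a) x + (activeTube Ω g a).indicator
        (fun x => ENNReal.ofReal (cutoff g a x * φ (gradShift g s x))) x ≤
      gap Ω ε (clampFun g a + φ) x +
        (ENNReal.ofReal (cutoff g a x * φ x) + ENNReal.ofReal (ε - s)) := by
  have ha := h.pos
  have hs_abs : |s| < a := by rw [abs_of_pos hs]; linarith
  filter_upwards [h.ae_gradShift hs_abs (ae_forall_le_gap hΩ ε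
    ((measurable_clampFun hg a).add hφ)) hΩ, ae_restrict_mem hΩ] with x hgap hx
  by_cases hxR : x ∈ activeTube Ω g a
  · rw [indicator_of_mem hxR]
    have hx3 : |g x| < 3 * a := abs_lt.2 ⟨hxR.2.1, by linarith [hxR.2.2]⟩
    have hx4 : |g x| < 4 * a := by linarith
    have hgs := h.apply_gradShift hx hx4 hs_abs
    have hD := hgap hx3 x (by rwa [h.dist_gradShift hx hx4, abs_of_pos hs])
    set y := gradShift g s x
    set θ := cutoff g a x with hθ
    have hθ0 : 0 ≤ θ := cutoff_nonneg
    have hθ1 : θ ≤ 1 := cutoff_le_one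
    have hvy : clampFun g a x ≤ clampFun g a y := clampFun_mono (by linarith)
    have hgv : gap Ω ε (clampFun g a) x ≤
        ENNReal.ofReal (θ * (clampFun g a y - clampFun g a x) + (ε - s)) := by
      have h0 : 0 ≤ θ * (clampFun g a y - clampFun g a x) :=
        mul_nonneg hθ0 (sub_nonneg.2 hvy)
      refine gap_le_of_forall hΩ (by linarith) fun z hz hzx => ?_
      have hgz : g z ≤ g x + ε := by linarith [le_of_abs_le (h.lip z hz x hx)]
      -- Above -2a the cutoff is 1. Below it, ε < a keeps g ≤ -a on the whole ball, so v = -a there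
      -- and the gap is zero.
      by_cases h2 : -(2 * a) ≤ g x
      · have h1 : θ = 1 := cutoff_eq_one ha h2
        have h3 : clampFun g a z ≤ clampFun g a y + (ε - s) :=
          clampFun_le_add (by linarith) (by linarith)
        rw [h1]; linarith
      · have h3 : clampFun g a z = -a := clampFun_eq_neg ha (by linarith)
        have h4 : -a ≤ clampFun g a x := neg_le_clampFun
        linarith
    have hDθ : ENNReal.ofReal (θ * ((clampFun g a y + φ y) - (clampFun g a x + φ x))) ≤
        gap Ω ε (clampFun g a + φ) x := by
      refine le_trans ?_ hD
      rcases le_total 0 ((clampFun g a y + φ y) - (clampFun g a x + φ x)) with h5 | h5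
      · exact ENNReal.ofReal_le_ofReal (mul_le_of_le_one_left h5 hθ1)
      · rw [ENNReal.ofReal_of_nonpos (mul_nonpos_of_nonneg_of_nonpos hθ0 h5)]
        exact zero_le
    calc _ ≤ ENNReal.ofReal (θ * (clampFun g a y - clampFun g a x) + (ε - s)) +
          ENNReal.ofReal (θ * φ y) := add_le_add hgv le_rfl
      _ = ENNReal.ofReal (θ * ((clampFun g a y + φ y) - (clampFun g a x + φ x)) +
          (θ * φ x + (ε - s))) := by
          rw [← ENNReal.ofReal_add (by
            have := mul_nonneg hθ0 (sub_nonneg.2 hvy); linarith) (mul_nonneg hθ0 (hφ0 _))]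
          congr 1; ring
      _ ≤ _ := by
          refine ENNReal.ofReal_add_le.trans (add_le_add hDθ ENNReal.ofReal_add_le)
  · rw [indicator_of_notMem hxR, add_zero]
    have hgv : gap Ω ε (clampFun g a) x ≤ ENNReal.ofReal 0 := by
      refine gap_le_of_forall hΩ le_rfl fun z hz hzx => ?_
      rw [add_zero]
      by_cases h2 : -(3 * a) < g x
      · have h3 : 2 * a ≤ g x := not_lt.1 fun h3 => hxR ⟨hx, h2, h3⟩
        rw [clampFun_eq (x := x) ha (by linarith)]
        exact clampFun_le ha
      · have hgz : g z ≤ g x + ε := by linarith [le_of_abs_le (h.lip z hz x hx)]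
        rw [clampFun_eq_neg (x := z) ha (by linarith)]
        exact neg_le_clampFun
    rw [ENNReal.ofReal_zero] at hgv
    exact hgv.trans zero_le

/-- The counterpart for the infimum, tested at x - s∇g(x). The term φ(x) now stands on the small
side for every x in Ω, which is why φ must vanish where g ≥ a, in particular on the part of Ω above
the active tube. -/
lemma ae_le_gap_neg_clampFun_add (h : IsTube Ω g a L) (hΩ : MeasurableSet Ω) (hg : Measurable g)
    (hφ : Measurable φ) (hφ0 : ∀ x, 0 ≤ φ x) (hφa : ∀ x, a ≤ g x → φ x = 0) (hs : 0 < s)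
    (hsε : s < ε) (hεa : ε < a) :
    ∀ᵐ x ∂volume.restrict Ω,
      gap Ω ε (-clampFun g a) x + ENNReal.ofReal (cutoff g a x * φ x) ≤
      gap Ω ε (-(clampFun g a + φ)) x +
        ((activeTube Ω g a).indicator
          (fun x => ENNReal.ofReal (cutoff g a x * φ (gradShift g (-s) x))) x +
          ENNReal.ofReal (ε - s)) := by
  have ha := h.pos
  have hs_abs : |-s| < a := by rw [abs_neg, abs_of_pos hs]; linarith
  filter_upwards [h.ae_gradShift hs_abs (ae_forall_le_gap hΩ ε
    ((measurable_clampFun hg a).add hφ).neg) hΩ, ae_restrict_mem hΩ] with x hgap hx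
  by_cases hxR : x ∈ activeTube Ω g a
  · rw [indicator_of_mem hxR]
    have hx3 : |g x| < 3 * a := abs_lt.2 ⟨hxR.2.1, by linarith [hxR.2.2]⟩
    have hx4 : |g x| < 4 * a := by linarith
    have hgs := h.apply_gradShift hx hx4 hs_abs
    have hD := hgap hx3 x (by rwa [h.dist_gradShift hx hx4, abs_neg, abs_of_pos hs])
    set y := gradShift g (-s) x
    set θ := cutoff g a x with hθ
    have hθ0 : 0 ≤ θ := cutoff_nonneg
    have hθ1 : θ ≤ 1 := cutoff_le_one
    have hvy : clampFun g a y ≤ clampFun g a x := clampFun_mono (by linarith)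
    have hgv : gap Ω ε (-clampFun g a) x ≤
        ENNReal.ofReal (θ * (clampFun g a x - clampFun g a y) + (ε - s)) := by
      have h0 : 0 ≤ θ * (clampFun g a x - clampFun g a y) :=
        mul_nonneg hθ0 (sub_nonneg.2 hvy)
      refine gap_le_of_forall hΩ (by linarith) fun z hz hzx => ?_
      have hgz : g x ≤ g z + ε := by linarith [neg_le_of_abs_le (h.lip z hz x hx)]
      simp only [Pi.neg_apply]
      by_cases h2 : -(2 * a) ≤ g x
      · have h1 : θ = 1 := cutoff_eq_one ha h2
        have h3 : clampFun g a y ≤ clampFun g a z + (ε - s) :=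
          clampFun_le_add (by linarith) (by linarith)
        rw [h1]; linarith
      · have h3 : clampFun g a x = -a := clampFun_eq_neg ha (by linarith)
        have h4 : -a ≤ clampFun g a z := neg_le_clampFun
        linarith
    have hDθ : ENNReal.ofReal (θ * ((clampFun g a x + φ x) - (clampFun g a y + φ y))) ≤
        gap Ω ε (-(clampFun g a + φ)) x := by
      refine le_trans ?_ hD
      have e : -(clampFun g a y + φ y) - -(clampFun g a x + φ x) =
        (clampFun g a x + φ x) - (clampFun g a y + φ y) := by ring
      simp only [Pi.neg_apply, Pi.add_apply]
      rw [e]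
      rcases le_total 0 ((clampFun g a x + φ x) - (clampFun g a y + φ y)) with h5 | h5
      · exact ENNReal.ofReal_le_ofReal (mul_le_of_le_one_left h5 hθ1)
      · rw [ENNReal.ofReal_of_nonpos (mul_nonpos_of_nonneg_of_nonpos hθ0 h5)]
        exact zero_le
    calc _ ≤ ENNReal.ofReal (θ * (clampFun g a x - clampFun g a y) + (ε - s)) +
          ENNReal.ofReal (θ * φ x) := add_le_add hgv le_rfl
      _ = ENNReal.ofReal (θ * ((clampFun g a x + φ x) - (clampFun g a y + φ y)) +
          (θ * φ y + (ε - s))) := by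
          rw [← ENNReal.ofReal_add (by
            have := mul_nonneg hθ0 (sub_nonneg.2 hvy); linarith) (mul_nonneg hθ0 (hφ0 _))]
          congr 1; ring
      _ ≤ _ := by
          refine ENNReal.ofReal_add_le.trans (add_le_add hDθ ENNReal.ofReal_add_le)
  · rw [indicator_of_notMem hxR, zero_add]
    have hgv : gap Ω ε (-clampFun g a) x ≤ ENNReal.ofReal 0 := by
      refine gap_le_of_forall hΩ le_rfl fun z hz hzx => ?_
      simp only [Pi.neg_apply, add_zero, neg_le_neg_iff]
      by_cases h2 : -(3 * a) < g x
      · have h3 : 2 * a ≤ g x := not_lt.1 fun h3 => hxR ⟨hx, h2, h3⟩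
        have hgz : g x ≤ g z + ε := by linarith [neg_le_of_abs_le (h.lip z hz x hx)]
        rw [clampFun_eq (x := z) ha (by linarith)]
        exact clampFun_le ha
      · rw [clampFun_eq_neg (x := x) ha (by linarith)]
        exact neg_le_clampFun
    have hθφ : cutoff g a x * φ x = 0 := by
      by_cases h2 : -(3 * a) < g x
      · have h3 : 2 * a ≤ g x := not_lt.1 fun h3 => hxR ⟨hx, h2, h3⟩
        rw [hφa x (by linarith), mul_zero]
      · rw [cutoff_eq_zero ha (by linarith), zero_mul]
    rw [ENNReal.ofReal_zero] at hgv
    rw [hθφ, ENNReal.ofReal_zero, add_zero]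
    exact hgv.trans zero_le

/-- Lower bound for the transported density. -/
lemma lintegral_le_setLIntegral_activeTube (h : IsTube Ω g a L) (hΩ : MeasurableSet Ω)
    (hg : Measurable g) (hφ0 : ∀ x, 0 ≤ φ x) (hφa : ∀ x, a ≤ g x → φ x = 0) (hs : 0 < s)
    (hsa : s < a) (hsL : s * L ≤ 1) (hF0 : ∀ x ∈ Ω, g x ≤ -(3 * a) → 0 ≤ F x)
    (hJ : ∀ x ∈ Ω, |g x| < 4 * a → g (gradShift g s x) < a →
      Real.exp (s * divergence (gradient g) x) *
        (cutoff g a (gradShift g s x) * ρ (gradShift g s x) - s * F (gradShift g s x)) ≤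
      cutoff g a x * ρ x) :
    ∫⁻ x in Ω, ENNReal.ofReal (φ x * (cutoff g a x * ρ x - s * F x)) ≤
      ∫⁻ x in Ω, (activeTube Ω g a).indicator
        (fun x => ENNReal.ofReal (cutoff g a x * φ (gradShift g s x))) x *
          ENNReal.ofReal (ρ x) := by
  have ha := h.pos
  have hs_abs : |s| < a := by rwa [abs_of_pos hs]
  have hs_abs' : |-s| < a := by rwa [abs_neg]
  set G : EuclideanSpace ℝ (Fin N) → ENNReal :=
    fun x => ENNReal.ofReal (φ x * (cutoff g a x * ρ x - s * F x)) with hG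
  set Y : Set (EuclideanSpace ℝ (Fin N)) := Ω ∩ ({x | -(3 * a) < g x} ∩ {x | g x < a}) with hY
  set S : Set (EuclideanSpace ℝ (Fin N)) := Ω ∩ ({x | -(3 * a) - s < g x} ∩ {x | g x < a - s})
    with hS
  have hSm : MeasurableSet S :=
    hΩ.inter ((measurableSet_lt measurable_const hg).inter (measurableSet_lt hg measurable_const))
  have hYm : MeasurableSet Y :=
    hΩ.inter ((measurableSet_lt measurable_const hg).inter (measurableSet_lt hg measurable_const))
  have hSt : S ⊆ {x ∈ Ω | |g x| < 4 * a} := by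
    rintro x ⟨h1, h2, h3⟩
    have h2' : -(3 * a) - s < g x := h2
    have h3' : g x < a - s := h3
    exact ⟨h1, abs_lt.2 ⟨by linarith, by linarith⟩⟩
  have hYS : Y ⊆ gradShift g s '' S := by
    rintro y ⟨h1, h2, h3⟩
    have h2' : -(3 * a) < g y := h2
    have h3' : g y < a := h3
    have hy4 : |g y| < 4 * a := abs_lt.2 ⟨by linarith, by linarith⟩
    have h5 := h.apply_gradShift h1 hy4 hs_abs'
    have h6 := h.gradShift_neg_gradShift h1 hy4 hs_abs'
    rw [neg_neg] at h6
    refine ⟨gradShift g (-s) y, ⟨h.gradShift_mem h1 hy4 hs_abs', ?_, ?_⟩, h6⟩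
    · change -(3 * a) - s < g (gradShift g (-s) y)
      rw [h5]; linarith
    · change g (gradShift g (-s) y) < a - s
      rw [h5]; linarith
  calc ∫⁻ x in Ω, G x = ∫⁻ x in Ω, Y.indicator G x := by
        refine setLIntegral_congr_fun hΩ fun x hx => ?_
        by_cases hxY : x ∈ Y
        · rw [indicator_of_mem hxY]
        · rw [indicator_of_notMem hxY]
          by_cases h1 : a ≤ g x
          · simp [hG, hφa x h1]
          · have h2 : g x ≤ -(3 * a) := not_lt.1 fun h2 => hxY ⟨hx, h2, not_le.1 h1⟩
            simp only [hG, cutoff_eq_zero ha h2, zero_mul, zero_sub]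
            rw [ENNReal.ofReal_of_nonpos]
            have := mul_nonneg (hφ0 x) (mul_nonneg hs.le (hF0 x hx h2))
            linarith
    _ ≤ ∫⁻ x, Y.indicator G x := setLIntegral_le_lintegral _ _
    _ = ∫⁻ x in Y, G x := lintegral_indicator hYm _
    _ ≤ ∫⁻ y in gradShift g s '' S, G y := lintegral_mono_set hYS
    _ ≤ ∫⁻ x in S, ENNReal.ofReal (Real.exp (s * divergence (gradient g) x)) *
        G (gradShift g s x) :=
        h.setLIntegral_image_gradShift_le hs_abs (by rwa [abs_of_pos hs]) hSm hSt G
    _ ≤ ∫⁻ x in S, (activeTube Ω g a).indicator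
        (fun x => ENNReal.ofReal (cutoff g a x * φ (gradShift g s x))) x *
          ENNReal.ofReal (ρ x) := by
        refine setLIntegral_mono' hSm fun x hx => ?_
        have hx4 := hSt hx
        have hgs := h.apply_gradShift hx4.1 hx4.2 hs_abs
        have hx1 : -(3 * a) - s < g x := hx.2.1
        have hx2 : g x < a - s := hx.2.2
        have hJx := hJ x hx4.1 hx4.2 (by rw [hgs]; linarith)
        have h1 : ENNReal.ofReal (Real.exp (s * divergence (gradient g) x)) *
            G (gradShift g s x) ≤ ENNReal.ofReal (cutoff g a x * φ (gradShift g s x) * ρ x) := by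
          rw [hG, ← ENNReal.ofReal_mul (Real.exp_pos _).le]
          refine ENNReal.ofReal_le_ofReal ?_
          have := mul_le_mul_of_nonneg_left hJx (hφ0 (gradShift g s x))
          calc _ = φ (gradShift g s x) * (Real.exp (s * divergence (gradient g) x) *
              (cutoff g a (gradShift g s x) * ρ (gradShift g s x) -
                s * F (gradShift g s x))) := by ring
            _ ≤ _ := this
            _ = _ := by ring
        refine h1.trans ?_
        by_cases hxR : x ∈ activeTube Ω g a
        · rw [indicator_of_mem hxR, ENNReal.ofReal_mul (mul_nonneg cutoff_nonneg (hφ0 _))]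
        · have h2 : g x ≤ -(3 * a) := not_lt.1 fun h2 => hxR ⟨hx4.1, h2, by linarith⟩
          rw [cutoff_eq_zero ha h2, zero_mul, zero_mul, ENNReal.ofReal_zero]
          exact zero_le
    _ ≤ _ := lintegral_mono_set inter_subset_left

/-- Upper bound for the transported density. -/
lemma setLIntegral_activeTube_le_lintegral (h : IsTube Ω g a L) (hΩ : MeasurableSet Ω)
    (hg : Measurable g) (hφ0 : ∀ x, 0 ≤ φ x) (hφa : ∀ x, a ≤ g x → φ x = 0) (hs : 0 < s)
    (hsa : s < a) (hsL : s * L ≤ 1)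
    (hJ : ∀ x ∈ Ω, |g x| < 4 * a → g x < a →
      Real.exp (s * divergence (gradient g) x) *
        (cutoff g a (gradShift g s x) * ρ (gradShift g s x)) ≤ cutoff g a x * ρ x + s * F x) :
    ∫⁻ x in Ω, (activeTube Ω g a).indicator
        (fun x => ENNReal.ofReal (cutoff g a x * φ (gradShift g (-s) x))) x *
          ENNReal.ofReal (ρ x) ≤
    ∫⁻ x in Ω, ENNReal.ofReal (φ x * (cutoff g a x * ρ x + s * F x)) := by
  have ha := h.pos
  have hs_abs : |s| < a := by rwa [abs_of_pos hs]
  have hs_abs' : |-s| < a := by rwa [abs_neg]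
  set G : EuclideanSpace ℝ (Fin N) → ENNReal :=
    fun x => ENNReal.ofReal (cutoff g a x * φ (gradShift g (-s) x) * ρ x) with hG
  set Y : Set (EuclideanSpace ℝ (Fin N)) := Ω ∩ ({x | -(3 * a) < g x} ∩ {x | g x < a + s}) with hY
  set S : Set (EuclideanSpace ℝ (Fin N)) := Ω ∩ ({x | -(3 * a) - s < g x} ∩ {x | g x < a})
    with hS
  have hSm : MeasurableSet S :=
    hΩ.inter ((measurableSet_lt measurable_const hg).inter (measurableSet_lt hg measurable_const))
  have hYm : MeasurableSet Y :=
    hΩ.inter ((measurableSet_lt measurable_const hg).inter (measurableSet_lt hg measurable_const))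
  have hSt : S ⊆ {x ∈ Ω | |g x| < 4 * a} := by
    rintro x ⟨h1, h2, h3⟩
    have h2' : -(3 * a) - s < g x := h2
    have h3' : g x < a := h3
    exact ⟨h1, abs_lt.2 ⟨by linarith, by linarith⟩⟩
  have hYS : Y ⊆ gradShift g s '' S := by
    rintro y ⟨h1, h2, h3⟩
    have h2' : -(3 * a) < g y := h2
    have h3' : g y < a + s := h3
    have hy4 : |g y| < 4 * a := abs_lt.2 ⟨by linarith, by linarith⟩
    have h5 := h.apply_gradShift h1 hy4 hs_abs'
    have h6 := h.gradShift_neg_gradShift h1 hy4 hs_abs'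
    rw [neg_neg] at h6
    refine ⟨gradShift g (-s) y, ⟨h.gradShift_mem h1 hy4 hs_abs', ?_, ?_⟩, h6⟩
    · change -(3 * a) - s < g (gradShift g (-s) y)
      rw [h5]; linarith
    · change g (gradShift g (-s) y) < a
      rw [h5]; linarith
  calc _ ≤ ∫⁻ x in Ω, Y.indicator G x := by
        refine setLIntegral_mono' hΩ fun x hx => ?_
        by_cases hxR : x ∈ activeTube Ω g a
        · rw [indicator_of_mem hxR, ← ENNReal.ofReal_mul (mul_nonneg cutoff_nonneg (hφ0 _))]
          by_cases hxY : x ∈ Y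
          · rw [indicator_of_mem hxY]
          · have h1 : a + s ≤ g x := not_lt.1 fun h2 => hxY ⟨hx, hxR.2.1, h2⟩
            have hx4 : |g x| < 4 * a := abs_lt.2 ⟨by linarith [hxR.2.1], by linarith [hxR.2.2]⟩
            have h2 := h.apply_gradShift hx hx4 hs_abs'
            rw [hφa (gradShift g (-s) x) (by linarith), mul_zero, zero_mul, ENNReal.ofReal_zero]
            exact zero_le
        · rw [indicator_of_notMem hxR, zero_mul]
          exact zero_le
    _ ≤ ∫⁻ x, Y.indicator G x := setLIntegral_le_lintegral _ _
    _ = ∫⁻ x in Y, G x := lintegral_indicator hYm _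
    _ ≤ ∫⁻ y in gradShift g s '' S, G y := lintegral_mono_set hYS
    _ ≤ ∫⁻ x in S, ENNReal.ofReal (Real.exp (s * divergence (gradient g) x)) *
        G (gradShift g s x) :=
        h.setLIntegral_image_gradShift_le hs_abs (by rwa [abs_of_pos hs]) hSm hSt G
    _ ≤ ∫⁻ x in S, ENNReal.ofReal (φ x * (cutoff g a x * ρ x + s * F x)) := by
        refine setLIntegral_mono' hSm fun x hx => ?_
        have hx4 := hSt hx
        have hJx := hJ x hx4.1 hx4.2 hx.2.2
        rw [hG, ← ENNReal.ofReal_mul (Real.exp_pos _).le]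
        refine ENNReal.ofReal_le_ofReal ?_
        rw [h.gradShift_neg_gradShift hx4.1 hx4.2 hs_abs]
        calc _ = φ x * (Real.exp (s * divergence (gradient g) x) *
              (cutoff g a (gradShift g s x) * ρ (gradShift g s x))) := by ring
          _ ≤ _ := mul_le_mul_of_nonneg_left hJx (hφ0 x)
    _ ≤ _ := lintegral_mono_set inter_subset_left

end IsTube

end FirstVariation

lemma integral_le_toReal_lintegral_ofReal {α : Type*} [MeasurableSpace α] {μ : Measure α}
    {f : α → ℝ} (hf : Integrable f μ) : ∫ x, f x ∂μ ≤ (∫⁻ x, ENNReal.ofReal (f x) ∂μ).toReal := by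
  rw [integral_eq_lintegral_pos_part_sub_lintegral_neg_part hf]
  linarith [ENNReal.toReal_nonneg (a := ∫⁻ x, ENNReal.ofReal (-f x) ∂μ)]

lemma integrable_of_abs_le {α : Type*} [MeasurableSpace α] {μ : Measure α} {S : Set α}
    (hS : MeasurableSet S) (hμS : μ S ≠ ⊤) {f : α → ℝ} (hf : AEMeasurable f (μ.restrict S)) (C : ℝ)
    (hC : ∀ x ∈ S, |f x| ≤ C) : IntegrableOn f S μ := by
  have : IsFiniteMeasure (μ.restrict S) := ⟨by rw [Measure.restrict_apply_univ]; exact hμS.lt_top⟩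
  exact Integrable.of_bound hf.aestronglyMeasurable C
    ((ae_restrict_mem hS).mono fun x hx => hC x hx)

section FirstVariation

variable {N : ℕ} {Ω : Set (EuclideanSpace ℝ (Fin N))} {ε a L s : ℝ}
  {g φ ρ ρ₀ ρ₁ F F₀ F₁ : EuclideanSpace ℝ (Fin N) → ℝ}

/-- Bounds for the transport of the densities `ρ₀`, `ρ₁` along the gradient of `g`, with
errors `F₀`, `F₁`. -/
structure TransportBounds (Ω : Set (EuclideanSpace ℝ (Fin N))) (ε a : ℝ)
    (g ρ₀ ρ₁ F₀ F₁ : EuclideanSpace ℝ (Fin N) → ℝ) : Prop where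
  nonneg_zero : ∀ x ∈ Ω, g x ≤ -(3 * a) → 0 ≤ F₀ x
  nonneg_one : ∀ x ∈ Ω, g x ≤ -(3 * a) → 0 ≤ F₁ x
  backward : ∀ s, 0 < s → s < ε → ∀ x ∈ Ω, |g x| < 4 * a → g (gradShift g s x) < a →
      Real.exp (s * divergence (gradient g) x) *
        (cutoff g a (gradShift g s x) * ρ₀ (gradShift g s x) - s * F₀ (gradShift g s x)) ≤
      cutoff g a x * ρ₀ x
  forward : ∀ s, 0 < s → s < ε → ∀ x ∈ Ω, |g x| < 4 * a → g x < a →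
      Real.exp (s * divergence (gradient g) x) *
        (cutoff g a (gradShift g s x) * ρ₁ (gradShift g s x)) ≤ cutoff g a x * ρ₁ x + s * F₁ x

/-- Measurable densities with values in `[0, C]` on a set of finite measure. -/
structure BoundedDensity (Ω : Set (EuclideanSpace ℝ (Fin N)))
    (ρ : EuclideanSpace ℝ (Fin N) → ℝ) (C : ℝ) : Prop where
  aemeasurable : AEMeasurable ρ (volume.restrict Ω)
  nonneg : ∀ x ∈ Ω, 0 ≤ ρ x
  le : ∀ x ∈ Ω, ρ x ≤ C

namespace IsTube

lemma gapInt_clampFun_add_le (h : IsTube Ω g a L) (hΩ : MeasurableSet Ω) (hg : Measurable g)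
    (hφ : Measurable φ) (hφ0 : ∀ x, 0 ≤ φ x) (hs : 0 < s) (hsε : s < ε) (hεa : ε < a)
    (hρ : AEMeasurable ρ (volume.restrict Ω)) :
    gapInt Ω ε ρ (clampFun g a) + ∫⁻ x in Ω, (activeTube Ω g a).indicator
        (fun x => ENNReal.ofReal (cutoff g a x * φ (gradShift g s x))) x *
          ENNReal.ofReal (ρ x) ≤
      gapInt Ω ε ρ (clampFun g a + φ) +
        ((∫⁻ x in Ω, ENNReal.ofReal (cutoff g a x * φ x) * ENNReal.ofReal (ρ x)) +
          ∫⁻ x in Ω, ENNReal.ofReal (ε - s) * ENNReal.ofReal (ρ x)) := by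
  have hm : AEMeasurable (fun x => ENNReal.ofReal (cutoff g a x * φ x) * ENNReal.ofReal (ρ x))
      (volume.restrict Ω) :=
    (((measurable_cutoff hg a).mul hφ).ennreal_ofReal.aemeasurable).mul hρ.ennreal_ofReal
  have hm2 : AEMeasurable (fun x => ENNReal.ofReal (ε - s) * ENNReal.ofReal (ρ x))
      (volume.restrict Ω) := hρ.ennreal_ofReal.const_mul _
  have hm3 := hm.add hm2
  simp only [Pi.add_def] at hm3
  rw [gapInt, gapInt, ← lintegral_add_left' hm, ← lintegral_add_right' _ hm3]
  refine (le_lintegral_add _ _).trans (lintegral_mono_ae ?_)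
  filter_upwards [h.ae_le_gap_clampFun_add hΩ hg hφ hφ0 hs hsε hεa] with x hx
  rw [← add_mul, ← add_mul, ← add_mul]
  exact mul_le_mul_left hx _

lemma gapInt_neg_clampFun_add_le (h : IsTube Ω g a L) (hΩ : MeasurableSet Ω) (hg : Measurable g)
    (hφ : Measurable φ) (hφ0 : ∀ x, 0 ≤ φ x) (hφa : ∀ x, a ≤ g x → φ x = 0) (hs : 0 < s)
    (hsε : s < ε) (hεa : ε < a) (hρ : AEMeasurable ρ (volume.restrict Ω)) :
    gapInt Ω ε ρ (-clampFun g a) +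
        ∫⁻ x in Ω, ENNReal.ofReal (cutoff g a x * φ x) * ENNReal.ofReal (ρ x) ≤
      gapInt Ω ε ρ (-(clampFun g a + φ)) + ((∫⁻ x in Ω, (activeTube Ω g a).indicator
        (fun x => ENNReal.ofReal (cutoff g a x * φ (gradShift g (-s) x))) x *
          ENNReal.ofReal (ρ x)) +
          ∫⁻ x in Ω, ENNReal.ofReal (ε - s) * ENNReal.ofReal (ρ x)) := by
  have hm : AEMeasurable (fun x => (activeTube Ω g a).indicator
        (fun x => ENNReal.ofReal (cutoff g a x * φ (gradShift g (-s) x))) x *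
          ENNReal.ofReal (ρ x)) (volume.restrict Ω) :=
    (((measurable_cutoff hg a).mul (hφ.comp (measurable_gradShift g (-s)))).ennreal_ofReal.indicator
      (measurableSet_activeTube hΩ hg)).aemeasurable.mul hρ.ennreal_ofReal
  have hm2 : AEMeasurable (fun x => ENNReal.ofReal (ε - s) * ENNReal.ofReal (ρ x))
      (volume.restrict Ω) := hρ.ennreal_ofReal.const_mul _
  have hm3 := hm.add hm2
  simp only [Pi.add_def] at hm3
  rw [gapInt, gapInt, ← lintegral_add_left' hm, ← lintegral_add_right' _ hm3]
  refine (le_lintegral_add _ _).trans (lintegral_mono_ae ?_)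
  filter_upwards [h.ae_le_gap_neg_clampFun_add hΩ hg hφ hφ0 hφa hs hsε hεa] with x hx
  rw [← add_mul, ← add_mul, ← add_mul]
  exact mul_le_mul_left hx _

lemma gapInt_clampFun_ne_top (h : IsTube Ω g a L) (hΩ : MeasurableSet Ω) (hΩf : volume Ω ≠ ⊤)
    (hε : 0 < ε) {C : ℝ} (hρ : BoundedDensity Ω ρ C) :
    gapInt Ω ε ρ (clampFun g a) ≠ ⊤ ∧ gapInt Ω ε ρ (-clampFun g a) ≠ ⊤ := by
  have hfin : (∫⁻ _ in Ω, ENNReal.ofReal ε * ENNReal.ofReal C) ≠ ⊤ := by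
    rw [setLIntegral_const]
    exact ENNReal.mul_ne_top (ENNReal.mul_ne_top ENNReal.ofReal_ne_top ENNReal.ofReal_ne_top) hΩf
  constructor
  · refine ne_top_of_le_ne_top hfin (setLIntegral_mono' hΩ fun x hx => ?_)
    exact mul_le_mul' (h.gap_clampFun_le hΩ hε hx) (ENNReal.ofReal_le_ofReal (hρ.le x hx))
  · refine ne_top_of_le_ne_top hfin (setLIntegral_mono' hΩ fun x hx => ?_)
    exact mul_le_mul' (h.gap_neg_clampFun_le hΩ hε hx) (ENNReal.ofReal_le_ofReal (hρ.le x hx))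

/-- One-sided first variation of the nonlocal total variation at a truncated distance function,
with a fixed step `s < ε`. -/
lemma toReal_gapInt_clampFun_le_of_lt (h : IsTube Ω g a L) (hΩ : MeasurableSet Ω)
    (hΩf : volume Ω ≠ ⊤) (hg : Measurable g)
    (hφ : Measurable φ) (hφ0 : ∀ x, 0 ≤ φ x) (hφa : ∀ x, a ≤ g x → φ x = 0) {C : ℝ}
    (hφC : ∀ x, φ x ≤ C)
    (hs : 0 < s) (hsε : s < ε) (hεa : ε < a) (hεL : ε * L ≤ 1) {C₀ C₁ C₂ : ℝ}
    (hρ₀ : BoundedDensity Ω ρ₀ C₀) (hρ₁ : BoundedDensity Ω ρ₁ C₁)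
    (hF₀ : AEMeasurable F₀ (volume.restrict Ω)) (hF₁ : AEMeasurable F₁ (volume.restrict Ω))
    (hF₀C : ∀ x ∈ Ω, |F₀ x| ≤ C₂) (hF₁C : ∀ x ∈ Ω, |F₁ x| ≤ C₂)
    (hT : TransportBounds Ω ε a g ρ₀ ρ₁ F₀ F₁)
    (hfin : gapInt Ω ε ρ₀ (clampFun g a + φ) + gapInt Ω ε ρ₁ (-(clampFun g a + φ)) ≠ ⊤) :
    (gapInt Ω ε ρ₀ (clampFun g a) + gapInt Ω ε ρ₁ (-clampFun g a)).toReal ≤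
      (gapInt Ω ε ρ₀ (clampFun g a + φ) + gapInt Ω ε ρ₁ (-(clampFun g a + φ))).toReal +
        s * (∫ x in Ω, φ x * (F₀ x + F₁ x)) +
        (ε - s) * ((∫ x in Ω, ρ₀ x) + ∫ x in Ω, ρ₁ x) := by
  have ha := h.pos
  have hε : 0 < ε := hs.trans hsε
  by_cases hΩe : Ω = ∅
  · subst hΩe
    simp [gapInt]
  obtain ⟨x₀, hx₀⟩ := nonempty_iff_ne_empty.2 hΩe
  have hC : 0 ≤ C := (hφ0 x₀).trans (hφC x₀)
  have hC₀ : 0 ≤ C₀ := (hρ₀.nonneg x₀ hx₀).trans (hρ₀.le x₀ hx₀)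
  have hC₁ : 0 ≤ C₁ := (hρ₁.nonneg x₀ hx₀).trans (hρ₁.le x₀ hx₀)
  have hL : 0 ≤ L ∨ L ≤ 0 := le_total _ _
  have hsL : s * L ≤ 1 := by
    rcases hL with hL | hL
    · exact (mul_le_mul_of_nonneg_right hsε.le hL).trans hεL
    · exact (mul_nonpos_of_nonneg_of_nonpos hs.le hL).trans zero_le_one
  have hθ := measurable_cutoff hg a
  have A0 := h.gapInt_clampFun_add_le hΩ hg hφ hφ0 hs hsε hεa hρ₀.aemeasurable
  have A1 := h.gapInt_neg_clampFun_add_le hΩ hg hφ hφ0 hφa hs hsε hεa hρ₁.aemeasurable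
  have B0 := h.lintegral_le_setLIntegral_activeTube hΩ hg hφ0 hφa hs (hsε.trans hεa) hsL
    hT.nonneg_zero (hT.backward s hs hsε)
  have B1 := h.setLIntegral_activeTube_le_lintegral hΩ hg hφ0 hφa hs (hsε.trans hεa) hsL
    (hT.forward s hs hsε)
  have hφabs : ∀ x, |φ x| ≤ C := fun x => by rw [abs_of_nonneg (hφ0 x)]; exact hφC x
  have iθ : ∀ {ρ : EuclideanSpace ℝ (Fin N) → ℝ} {D : ℝ}, BoundedDensity Ω ρ D →
      IntegrableOn (fun x => φ x * (cutoff g a x * ρ x)) Ω := by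
    intro ρ D hρ
    refine integrable_of_abs_le hΩ hΩf (hφ.aemeasurable.mul (hθ.aemeasurable.mul hρ.aemeasurable))
      (C * (1 * D)) fun x hx => ?_
    rw [abs_mul, abs_mul, abs_of_nonneg (hρ.nonneg x hx), abs_of_nonneg cutoff_nonneg]
    exact mul_le_mul (hφabs x) (mul_le_mul cutoff_le_one (hρ.le x hx) (hρ.nonneg x hx) zero_le_one)
      (mul_nonneg cutoff_nonneg (hρ.nonneg x hx)) hC
  have iF : ∀ {F : EuclideanSpace ℝ (Fin N) → ℝ}, AEMeasurable F (volume.restrict Ω) →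
      (∀ x ∈ Ω, |F x| ≤ C₂) → IntegrableOn (fun x => φ x * F x) Ω := by
    intro F hF hFC
    refine integrable_of_abs_le hΩ hΩf (hφ.aemeasurable.mul hF) (C * C₂) fun x hx => ?_
    rw [abs_mul]
    exact mul_le_mul (hφabs x) (hFC x hx) (abs_nonneg _) hC
  have iρ : ∀ {ρ : EuclideanSpace ℝ (Fin N) → ℝ} {D : ℝ}, BoundedDensity Ω ρ D →
      IntegrableOn ρ Ω := by
    intro ρ D hρ
    refine integrable_of_abs_le hΩ hΩf hρ.aemeasurable D fun x hx => ?_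
    rw [abs_of_nonneg (hρ.nonneg x hx)]
    exact hρ.le x hx
  have eI : ∀ {ρ : EuclideanSpace ℝ (Fin N) → ℝ} {D : ℝ}, BoundedDensity Ω ρ D →
      ∫⁻ x in Ω, ENNReal.ofReal (cutoff g a x * φ x) * ENNReal.ofReal (ρ x) =
        ENNReal.ofReal (∫ x in Ω, φ x * (cutoff g a x * ρ x)) := by
    intro ρ D hρ
    rw [ofReal_integral_eq_lintegral_ofReal (iθ hρ)]
    · refine setLIntegral_congr_fun hΩ fun x hx => ?_
      rw [← ENNReal.ofReal_mul (mul_nonneg cutoff_nonneg (hφ0 x))]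
      congr 1; ring
    · filter_upwards [ae_restrict_mem hΩ] with x hx
      exact mul_nonneg (hφ0 x) (mul_nonneg cutoff_nonneg (hρ.nonneg x hx))
  have eE : ∀ {ρ : EuclideanSpace ℝ (Fin N) → ℝ} {D : ℝ}, BoundedDensity Ω ρ D →
      ∫⁻ x in Ω, ENNReal.ofReal (ε - s) * ENNReal.ofReal (ρ x) =
        ENNReal.ofReal ((ε - s) * ∫ x in Ω, ρ x) := by
    intro ρ D hρ
    rw [lintegral_const_mul' _ _ ENNReal.ofReal_ne_top, ENNReal.ofReal_mul (by linarith),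
      ofReal_integral_eq_lintegral_ofReal (iρ hρ)]
    filter_upwards [ae_restrict_mem hΩ] with x hx using hρ.nonneg x hx
  have i0 : IntegrableOn (fun x => φ x * (cutoff g a x * ρ₀ x - s * F₀ x)) Ω := by
    have := (iθ hρ₀).sub ((iF hF₀ hF₀C).const_mul s)
    refine this.congr (Eventually.of_forall fun x => ?_)
    simp only [Pi.sub_apply]; ring
  have i1 : IntegrableOn (fun x => φ x * (cutoff g a x * ρ₁ x + s * F₁ x)) Ω := by
    have := (iθ hρ₁).add ((iF hF₁ hF₁C).const_mul s)
    refine this.congr (Eventually.of_forall fun x => ?_)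
    simp only [Pi.add_apply]; ring
  have v0 : ∫ x in Ω, φ x * (cutoff g a x * ρ₀ x - s * F₀ x) =
      (∫ x in Ω, φ x * (cutoff g a x * ρ₀ x)) - s * ∫ x in Ω, φ x * F₀ x := by
    rw [← integral_const_mul, ← integral_sub (iθ hρ₀) ((iF hF₀ hF₀C).const_mul s)]
    refine integral_congr_ae (Eventually.of_forall fun x => ?_)
    simp only; ring
  have v1 : ∫ x in Ω, φ x * (cutoff g a x * ρ₁ x + s * F₁ x) =
      (∫ x in Ω, φ x * (cutoff g a x * ρ₁ x)) + s * ∫ x in Ω, φ x * F₁ x := by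
    rw [← integral_const_mul, ← integral_add (iθ hρ₁) ((iF hF₁ hF₁C).const_mul s)]
    refine integral_congr_ae (Eventually.of_forall fun x => ?_)
    simp only; ring
  have v2 : ∫ x in Ω, φ x * (F₀ x + F₁ x) =
      (∫ x in Ω, φ x * F₀ x) + ∫ x in Ω, φ x * F₁ x := by
    rw [← integral_add (iF hF₀ hF₀C) (iF hF₁ hF₁C)]
    refine integral_congr_ae (Eventually.of_forall fun x => ?_)
    simp only; ring
  -- The F₁-integral is needed from above, so the lower integral of its positive part must be the
  -- integral itself, that is, the integrand must be nonnegative. The F₀-integral is only needed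
  -- from below, where passing to the positive part goes in the right direction.
  have n1 : ∀ x ∈ Ω, 0 ≤ φ x * (cutoff g a x * ρ₁ x + s * F₁ x) := by
    intro x hx
    by_cases h1 : a ≤ g x
    · rw [hφa x h1, zero_mul]
    refine mul_nonneg (hφ0 x) ?_
    by_cases h2 : g x ≤ -(3 * a)
    · rw [cutoff_eq_zero ha h2, zero_mul, zero_add]
      exact mul_nonneg hs.le (hT.nonneg_one x hx h2)
    · have hx4 : |g x| < 4 * a := abs_lt.2 ⟨by linarith, by linarith⟩
      refine le_trans (mul_nonneg (Real.exp_pos _).le (mul_nonneg cutoff_nonneg (hρ₁.nonneg _ ?_)))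
        (hT.forward s hs hsε x hx hx4 (not_le.1 h1))
      exact h.gradShift_mem hx hx4 (by rw [abs_of_pos hs]; linarith)
  have eH1 : ∫⁻ x in Ω, ENNReal.ofReal (φ x * (cutoff g a x * ρ₁ x + s * F₁ x)) =
      ENNReal.ofReal (∫ x in Ω, φ x * (cutoff g a x * ρ₁ x + s * F₁ x)) := by
    rw [ofReal_integral_eq_lintegral_ofReal i1]
    filter_upwards [ae_restrict_mem hΩ] with x hx using n1 x hx
  have hH0 := integral_le_toReal_lintegral_ofReal i0
  rw [eI hρ₀, eE hρ₀] at A0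
  rw [eI hρ₁, eE hρ₁] at A1
  rw [eH1] at B1
  set H0 := ∫⁻ x in Ω, ENNReal.ofReal (φ x * (cutoff g a x * ρ₀ x - s * F₀ x)) with hH0def
  have hH0t : H0 ≠ ⊤ := by
    rw [hH0def]
    exact ((hasFiniteIntegral_iff_norm _).1 i0.2 |>.trans_le' (lintegral_mono fun x =>
      ENNReal.ofReal_le_ofReal (le_abs_self _))).ne
  obtain ⟨w0, w1⟩ := ENNReal.add_ne_top.1 hfin
  have g0 := (h.gapInt_clampFun_ne_top hΩ hΩf hε hρ₀).1
  have g1 := (h.gapInt_clampFun_ne_top hΩ hΩf hε hρ₁).2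
  have T0 : (gapInt Ω ε ρ₀ (clampFun g a)).toReal + H0.toReal ≤
      (gapInt Ω ε ρ₀ (clampFun g a + φ)).toReal +
        ((∫ x in Ω, φ x * (cutoff g a x * ρ₀ x)) + (ε - s) * ∫ x in Ω, ρ₀ x) := by
    have q1 : 0 ≤ ∫ x in Ω, φ x * (cutoff g a x * ρ₀ x) :=
      setIntegral_nonneg hΩ fun x hx => mul_nonneg (hφ0 x) (mul_nonneg cutoff_nonneg
        (hρ₀.nonneg x hx))
    have q2 : 0 ≤ (ε - s) * ∫ x in Ω, ρ₀ x :=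
      mul_nonneg (by linarith) (setIntegral_nonneg hΩ hρ₀.nonneg)
    have := (add_le_add le_rfl B0).trans A0
    rw [← ENNReal.ofReal_add q1 q2] at this
    have h2 := ENNReal.toReal_mono (ENNReal.add_ne_top.2 ⟨w0, ENNReal.ofReal_ne_top⟩) this
    rwa [ENNReal.toReal_add g0 hH0t, ENNReal.toReal_add w0 ENNReal.ofReal_ne_top,
      ENNReal.toReal_ofReal (add_nonneg q1 q2)] at h2
  have T1 : (gapInt Ω ε ρ₁ (-clampFun g a)).toReal + (∫ x in Ω, φ x * (cutoff g a x * ρ₁ x)) ≤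
      (gapInt Ω ε ρ₁ (-(clampFun g a + φ))).toReal +
        ((∫ x in Ω, φ x * (cutoff g a x * ρ₁ x + s * F₁ x)) + (ε - s) * ∫ x in Ω, ρ₁ x) := by
    have q1 : 0 ≤ ∫ x in Ω, φ x * (cutoff g a x * ρ₁ x) :=
      setIntegral_nonneg hΩ fun x hx => mul_nonneg (hφ0 x) (mul_nonneg cutoff_nonneg
        (hρ₁.nonneg x hx))
    have q2 : 0 ≤ (ε - s) * ∫ x in Ω, ρ₁ x :=
      mul_nonneg (by linarith) (setIntegral_nonneg hΩ hρ₁.nonneg)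
    have q3 := setIntegral_nonneg (μ := volume) hΩ n1
    have := A1.trans (add_le_add le_rfl (add_le_add B1 le_rfl))
    rw [← ENNReal.ofReal_add q3 q2] at this
    have h2 := ENNReal.toReal_mono (ENNReal.add_ne_top.2 ⟨w1, ENNReal.ofReal_ne_top⟩) this
    rwa [ENNReal.toReal_add g1 ENNReal.ofReal_ne_top, ENNReal.toReal_add w1 ENNReal.ofReal_ne_top,
      ENNReal.toReal_ofReal (add_nonneg q3 q2), ENNReal.toReal_ofReal q1] at h2
  rw [ENNReal.toReal_add g0 g1, ENNReal.toReal_add w0 w1, v2]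
  rw [v0] at hH0
  rw [v1] at T1
  linarith

/-- One-sided first variation of the nonlocal total variation at a truncated distance function. -/
lemma toReal_gapInt_clampFun_le (h : IsTube Ω g a L) (hΩ : MeasurableSet Ω)
    (hΩf : volume Ω ≠ ⊤) (hg : Measurable g)
    (hφ : Measurable φ) (hφ0 : ∀ x, 0 ≤ φ x) (hφa : ∀ x, a ≤ g x → φ x = 0) {C : ℝ}
    (hφC : ∀ x, φ x ≤ C)
    (hε : 0 < ε) (hεa : ε < a) (hεL : ε * L ≤ 1) {C₀ C₁ C₂ : ℝ}
    (hρ₀ : BoundedDensity Ω ρ₀ C₀) (hρ₁ : BoundedDensity Ω ρ₁ C₁)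
    (hF₀ : AEMeasurable F₀ (volume.restrict Ω)) (hF₁ : AEMeasurable F₁ (volume.restrict Ω))
    (hF₀C : ∀ x ∈ Ω, |F₀ x| ≤ C₂) (hF₁C : ∀ x ∈ Ω, |F₁ x| ≤ C₂)
    (hT : TransportBounds Ω ε a g ρ₀ ρ₁ F₀ F₁)
    (hfin : gapInt Ω ε ρ₀ (clampFun g a + φ) + gapInt Ω ε ρ₁ (-(clampFun g a + φ)) ≠ ⊤) :
    (gapInt Ω ε ρ₀ (clampFun g a) + gapInt Ω ε ρ₁ (-clampFun g a)).toReal ≤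
      (gapInt Ω ε ρ₀ (clampFun g a + φ) + gapInt Ω ε ρ₁ (-(clampFun g a + φ))).toReal +
        ε * (∫ x in Ω, φ x * (F₀ x + F₁ x)) := by
  set R : ℝ → ℝ := fun s =>
    (gapInt Ω ε ρ₀ (clampFun g a + φ) + gapInt Ω ε ρ₁ (-(clampFun g a + φ))).toReal +
        s * (∫ x in Ω, φ x * (F₀ x + F₁ x)) +
        (ε - s) * ((∫ x in Ω, ρ₀ x) + ∫ x in Ω, ρ₁ x) with hR
  have hcont : Continuous R := by fun_prop
  -- The balls are open, so only shifts s < ε are admissible; the defect (ε - s)∫ρ disappears in the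
  -- limit.
  have hlim : Tendsto R (𝓝[<] ε) (𝓝 (R ε)) := hcont.continuousAt.continuousWithinAt
  have hev : ∀ᶠ s in 𝓝[<] ε,
      (gapInt Ω ε ρ₀ (clampFun g a) + gapInt Ω ε ρ₁ (-clampFun g a)).toReal ≤ R s := by
    filter_upwards [Ioo_mem_nhdsLT hε] with s hs
    exact h.toReal_gapInt_clampFun_le_of_lt hΩ hΩf hg hφ hφ0 hφa hφC hs.1 hs.2 hεa hεL hρ₀ hρ₁
      hF₀ hF₁ hF₀C hF₁C hT hfin
  have := ge_of_tendsto hlim hev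
  simpa [hR] using this

end IsTube

end FirstVariation

/-! ### Subadditivity and finiteness of the energy -/

section Subadditivity

variable {N : ℕ} {Ω : Set (EuclideanSpace ℝ (Fin N))} {ε : ℝ}
  {ρ ρ₀ ρ₁ u v : EuclideanSpace ℝ (Fin N) → ℝ}

lemma gap_add_le (u v : EuclideanSpace ℝ (Fin N) → ℝ) (x : EuclideanSpace ℝ (Fin N)) :
    gap Ω ε (u + v) x ≤ gap Ω ε u x + gap Ω ε v x := by
  refine (essSup_mono_ae (Eventually.of_forall fun y => ?_)).trans (ENNReal.essSup_add_le _ _)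
  simp only [Pi.add_apply, add_sub_add_comm]
  exact ENNReal.ofReal_add_le

lemma gapInt_add_le (hΩ : MeasurableSet Ω) (hρ : AEMeasurable ρ (volume.restrict Ω))
    (hu : AEMeasurable u (volume.restrict Ω)) :
    gapInt Ω ε ρ (u + v) ≤ gapInt Ω ε ρ u + gapInt Ω ε ρ v := by
  unfold gapInt
  rw [← lintegral_add_left' (aemeasurable_gap_mul hΩ hρ hu)]
  refine lintegral_mono fun x => ?_
  dsimp only
  rw [← add_mul]
  exact mul_le_mul_left (gap_add_le u v x) _

lemma nonlocalTV_add_le (hΩ : MeasurableSet Ω) (hρ₀ : AEMeasurable ρ₀ (volume.restrict Ω))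
    (hρ₁ : AEMeasurable ρ₁ (volume.restrict Ω)) (hu : AEMeasurable u (volume.restrict Ω)) :
    nonlocalTV Ω ρ₀ ρ₁ ε (u + v) ≤ nonlocalTV Ω ρ₀ ρ₁ ε u + nonlocalTV Ω ρ₀ ρ₁ ε v := by
  simp only [nonlocalTV_eq_gapInt]
  rw [← mul_add, neg_add]
  refine mul_le_mul_right ?_ _
  refine (add_le_add (gapInt_add_le hΩ hρ₀ hu) (gapInt_add_le hΩ hρ₁ hu.neg)).trans_eq ?_
  ring

lemma energy_ne_top_iff (hε : 0 < ε) {f : EuclideanSpace ℝ (Fin N) → ℝ} :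
    energy Ω ρ₀ ρ₁ ε f u ≠ ⊤ ↔
      (∫⁻ x in Ω, ENNReal.ofReal (|u x - f x| ^ 2) * ENNReal.ofReal (ρ₀ x + ρ₁ x)) ≠ ⊤ ∧
        nonlocalTV Ω ρ₀ ρ₁ ε u ≠ ⊤ := by
  rw [energy, ENNReal.add_ne_top, Ne, ENNReal.mul_eq_top]
  simp [hε]

end Subadditivity

/-! ### Comparison of the minimizer with a truncated barrier -/

section Comparison

variable {N : ℕ} {Ω : Set (EuclideanSpace ℝ (Fin N))} {ε a L : ℝ}
  {f g w ρ₀ ρ₁ F₀ F₁ : EuclideanSpace ℝ (Fin N) → ℝ}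

lemma BoundedDensity.integrable_mul_sq {C₀ C₁ : ℝ} (hΩ : MeasurableSet Ω)
    (hρ₀ : BoundedDensity Ω ρ₀ C₀) (hρ₁ : BoundedDensity Ω ρ₁ C₁)
    {u : EuclideanSpace ℝ (Fin N) → ℝ} (hu : MemLp u 2 (volume.restrict Ω)) :
    IntegrableOn (fun x => (ρ₀ x + ρ₁ x) * u x ^ 2) Ω := by
  refine Integrable.bdd_mul (c := C₀ + C₁) hu.integrable_sq
    (hρ₀.aemeasurable.add hρ₁.aemeasurable).aestronglyMeasurable ?_
  filter_upwards [ae_restrict_mem hΩ] with x hx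
  have h0 := hρ₀.nonneg x hx
  have h1 := hρ₁.nonneg x hx
  rw [Real.norm_eq_abs, abs_of_nonneg (add_nonneg h0 h1)]
  exact add_le_add (hρ₀.le x hx) (hρ₁.le x hx)

lemma BoundedDensity.lintegral_fidelity {C₀ C₁ : ℝ} (hΩ : MeasurableSet Ω)
    (hρ₀ : BoundedDensity Ω ρ₀ C₀) (hρ₁ : BoundedDensity Ω ρ₁ C₁)
    {u : EuclideanSpace ℝ (Fin N) → ℝ} (hu : MemLp (u - f) 2 (volume.restrict Ω)) :
    ∫⁻ x in Ω, ENNReal.ofReal (|u x - f x| ^ 2) * ENNReal.ofReal (ρ₀ x + ρ₁ x) =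
      ENNReal.ofReal (∫ x in Ω, (ρ₀ x + ρ₁ x) * (u x - f x) ^ 2) := by
  have hi := hρ₀.integrable_mul_sq hΩ hρ₁ hu
  simp only [Pi.sub_apply] at hi
  rw [ofReal_integral_eq_lintegral_ofReal hi]
  · refine setLIntegral_congr_fun hΩ fun x hx => ?_
    rw [← ENNReal.ofReal_mul (by positivity), sq_abs, mul_comm]
  · filter_upwards [ae_restrict_mem hΩ] with x hx
    exact mul_nonneg (add_nonneg (hρ₀.nonneg x hx) (hρ₁.nonneg x hx)) (sq_nonneg _)

namespace IsTube

/-- The minimizer is tested against w - φ, where φ is the excess of min(w, a) over the barrier v.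
Truncating w at a makes φ vanish where g ≥ a, as the first variation demands. Measurability of w,
not only a.e. measurability, makes φ measurable. -/
lemma min_le_clampFun_of_measurable (h : IsTube Ω g a L) (hΩ : MeasurableSet Ω)
    (hΩf : volume Ω ≠ ⊤) (hg : Measurable g)
    (hε : 0 < ε) (hεa : ε < a) (hεL : ε * L ≤ 1) {c C₀ C₁ C₂ : ℝ}
    (hρ₀ : BoundedDensity Ω ρ₀ C₀) (hρ₁ : BoundedDensity Ω ρ₁ C₁)
    (hc : 0 < c) (hρc : ∀ x ∈ Ω, c ≤ ρ₀ x + ρ₁ x)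
    (hF₀ : AEMeasurable F₀ (volume.restrict Ω)) (hF₁ : AEMeasurable F₁ (volume.restrict Ω))
    (hF₀C : ∀ x ∈ Ω, |F₀ x| ≤ C₂) (hF₁C : ∀ x ∈ Ω, |F₁ x| ≤ C₂)
    (hT : TransportBounds Ω ε a g ρ₀ ρ₁ F₀ F₁)
    (hf : MemLp f 2 (volume.restrict Ω)) (hfin : energy Ω ρ₀ ρ₁ ε f 0 ≠ ⊤)
    (hsup : ∀ x ∈ Ω, g x < a →
      F₀ x + F₁ x ≤ (ρ₀ x + ρ₁ x) * (clampFun g a x - f x) / ε)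
    (hw : IsMinimizer Ω ρ₀ ρ₁ ε f w) (hwm : Measurable w) :
    ∀ᵐ x ∂volume.restrict Ω, min (w x) a ≤ clampFun g a x := by
  have ha := h.pos
  set v := clampFun g a with hv
  have hvm : Measurable v := measurable_clampFun hg a
  set p : EuclideanSpace ℝ (Fin N) → ℝ := fun x => min (w x) a with hp
  set r : EuclideanSpace ℝ (Fin N) → ℝ := fun x => max (w x - a) 0 with hr
  set φ : EuclideanSpace ℝ (Fin N) → ℝ := fun x => max (p x - v x) 0 with hφ
  have hpm : Measurable p := hwm.min measurable_const
  have hφm : Measurable φ := (hpm.sub hvm).max measurable_const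
  have hφ0 : ∀ x, 0 ≤ φ x := fun x => le_max_right _ _
  have hφa : ∀ x, a ≤ g x → φ x = 0 := fun x hx => by
    have h1 : v x = a := clampFun_eq ha hx
    have h2 : p x ≤ a := min_le_right _ _
    exact max_eq_right (by linarith)
  have hφC : ∀ x, φ x ≤ 2 * a := fun x => by
    have h1 : -a ≤ v x := neg_le_clampFun
    have h2 : p x ≤ a := min_le_right _ _
    exact max_le (by linarith) (by linarith)
  have hpr : ∀ x, p x + r x = w x := fun x => by
    simp only [hp, hr]
    rcases le_total (w x) a with h1 | h1
    · rw [min_eq_left h1, max_eq_right (by linarith), add_zero]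
    · rw [min_eq_right h1, max_eq_left (by linarith)]; ring
  have hsup_eq : p ⊔ v = v + φ := by
    ext x
    simp only [Pi.sup_apply, Pi.add_apply, hφ]
    rcases le_total (p x) (v x) with h1 | h1
    · rw [sup_eq_right.2 h1, max_eq_right (by linarith), add_zero]
    · rw [sup_eq_left.2 h1, max_eq_left (by linarith)]; ring
  -- The competitor w - φ, written so that its total variation is at most TV(p ⊓ v) + TV(r), while
  -- TV(w) ≥ TV(p) + TV(r).
  set u : EuclideanSpace ℝ (Fin N) → ℝ := (p ⊓ v) + r with hu
  have hu_eq : ∀ x, u x = w x - φ x := fun x => by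
    rw [hu, Pi.add_apply, Pi.inf_apply, ← hpr x]
    simp only [hφ]
    rcases le_total (p x) (v x) with h1 | h1
    · rw [inf_eq_left.2 h1, max_eq_right (by linarith), sub_zero]
    · rw [inf_eq_right.2 h1, max_eq_left (by linarith)]; ring
  have : IsFiniteMeasure (volume.restrict Ω) :=
    ⟨by rw [Measure.restrict_apply_univ]; exact hΩf.lt_top⟩
  have hφL : MemLp φ 2 (volume.restrict Ω) :=
    MemLp.of_bound hφm.aestronglyMeasurable (2 * a) (Eventually.of_forall fun x => by
      rw [Real.norm_eq_abs, abs_of_nonneg (hφ0 x)]; exact hφC x)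
  have huL : MemLp u 2 (volume.restrict Ω) :=
    (hw.1.sub hφL).ae_eq (Eventually.of_forall fun x => (hu_eq x).symm)
  have hmin := hw.2 u huL
  have hTw := ((energy_ne_top_iff hε).1 (ne_top_of_le_ne_top hfin (hw.2 0 MemLp.zero))).2
  have hsplit : nonlocalTV Ω ρ₀ ρ₁ ε p + nonlocalTV Ω ρ₀ ρ₁ ε r ≤ nonlocalTV Ω ρ₀ ρ₁ ε w :=
    nonlocalTV_comp_add_nonlocalTV_comp_le (u := w) (F := fun s => min s a)
      (G := fun s => max (s - a) 0) (fun s t hst => min_le_min_right a hst)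
      (fun s t hst => max_le_max_right 0 (sub_le_sub_right hst a)) (fun s => by
        rcases le_total s a with h1 | h1
        · rw [min_eq_left h1, max_eq_right (by linarith), add_zero]
        · rw [min_eq_right h1, max_eq_left (by linarith)]; ring)
  have hTp : nonlocalTV Ω ρ₀ ρ₁ ε p ≠ ⊤ :=
    ne_top_of_le_ne_top hTw (le_self_add.trans hsplit)
  have hTr : nonlocalTV Ω ρ₀ ρ₁ ε r ≠ ⊤ :=
    ne_top_of_le_ne_top hTw (le_add_self.trans hsplit)
  have hTu : nonlocalTV Ω ρ₀ ρ₁ ε u ≤ nonlocalTV Ω ρ₀ ρ₁ ε (p ⊓ v) + nonlocalTV Ω ρ₀ ρ₁ ε r :=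
    nonlocalTV_add_le hΩ hρ₀.aemeasurable hρ₁.aemeasurable (hpm.inf hvm).aemeasurable
  have hsub := nonlocalTV_sup_add_nonlocalTV_inf_le (ε := ε) (v := v) hΩ hρ₀.aemeasurable
    hρ₁.aemeasurable hpm.aemeasurable
  rw [hsup_eq] at hsub
  have hwf : MemLp (w - f) 2 (volume.restrict Ω) := hw.1.sub hf
  have huf : MemLp (u - f) 2 (volume.restrict Ω) := huL.sub hf
  set κ := ENNReal.ofReal (1 / (2 * ε)) with hκ
  set qw := ∫ x in Ω, (ρ₀ x + ρ₁ x) * (w x - f x) ^ 2 with hqw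
  set qu := ∫ x in Ω, (ρ₀ x + ρ₁ x) * (u x - f x) ^ 2 with hqu
  rw [energy, energy, hρ₀.lintegral_fidelity hΩ hρ₁ hwf, hρ₀.lintegral_fidelity hΩ hρ₁ huf,
    ← hκ, ← hqw, ← hqu] at hmin
  -- The finite contribution of r, the part of w above a, cancels. Submodularity then replaces TV(p)
  -- - TV(p ⊓ v) by TV(v + φ) - TV(v).
  have s1 : κ * ENNReal.ofReal qw + nonlocalTV Ω ρ₀ ρ₁ ε p ≤
      κ * ENNReal.ofReal qu + nonlocalTV Ω ρ₀ ρ₁ ε (p ⊓ v) := by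
    refine (ENNReal.add_le_add_iff_right hTr).1 ?_
    rw [add_assoc, add_assoc]
    exact (add_le_add le_rfl hsplit).trans (hmin.trans (add_le_add le_rfl hTu))
  have s2 : κ * ENNReal.ofReal qw + nonlocalTV Ω ρ₀ ρ₁ ε (v + φ) ≤
      κ * ENNReal.ofReal qu + nonlocalTV Ω ρ₀ ρ₁ ε v := by
    refine (ENNReal.add_le_add_iff_right hTp).1 ?_
    calc _ = (κ * ENNReal.ofReal qw + nonlocalTV Ω ρ₀ ρ₁ ε p) +
          nonlocalTV Ω ρ₀ ρ₁ ε (v + φ) := by ring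
      _ ≤ (κ * ENNReal.ofReal qu + nonlocalTV Ω ρ₀ ρ₁ ε (p ⊓ v)) +
          nonlocalTV Ω ρ₀ ρ₁ ε (v + φ) := add_le_add s1 le_rfl
      _ = κ * ENNReal.ofReal qu + (nonlocalTV Ω ρ₀ ρ₁ ε (v + φ) +
          nonlocalTV Ω ρ₀ ρ₁ ε (p ⊓ v)) := by ring
      _ ≤ κ * ENNReal.ofReal qu + (nonlocalTV Ω ρ₀ ρ₁ ε p + nonlocalTV Ω ρ₀ ρ₁ ε v) :=
          add_le_add le_rfl hsub
      _ = _ := by ring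
  have hκt : κ ≠ ⊤ := ENNReal.ofReal_ne_top
  have hκ0 : (0 : ℝ) < 1 / (2 * ε) := by positivity
  have hgv := h.gapInt_clampFun_ne_top hΩ hΩf hε hρ₀
  have hgv' := h.gapInt_clampFun_ne_top hΩ hΩf hε hρ₁
  rw [nonlocalTV_eq_gapInt, nonlocalTV_eq_gapInt] at s2
  have hrhs : κ * ENNReal.ofReal qu +
      ENNReal.ofReal (1 / ε) * (gapInt Ω ε ρ₀ v + gapInt Ω ε ρ₁ (-v)) ≠ ⊤ :=
    ENNReal.add_ne_top.2 ⟨ENNReal.mul_ne_top hκt ENNReal.ofReal_ne_top,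
      ENNReal.mul_ne_top ENNReal.ofReal_ne_top (ENNReal.add_ne_top.2 ⟨hgv.1, hgv'.2⟩)⟩
  have hlhs := ne_top_of_le_ne_top hrhs s2
  have hε1 : ENNReal.ofReal (1 / ε) ≠ 0 := by
    rw [Ne, ENNReal.ofReal_eq_zero, not_le]; positivity
  have hgu : gapInt Ω ε ρ₀ (v + φ) + gapInt Ω ε ρ₁ (-(v + φ)) ≠ ⊤ := by
    intro htop
    rw [htop, ENNReal.mul_top hε1] at hlhs
    exact (ENNReal.add_ne_top.1 hlhs).2 rfl
  have hFV := h.toReal_gapInt_clampFun_le hΩ hΩf hg hφm hφ0 hφa hφC hε hεa hεL hρ₀ hρ₁ hF₀ hF₁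
    hF₀C hF₁C hT hgu
  rw [← hv] at hFV
  have s3 := ENNReal.toReal_mono hrhs s2
  have hqw0 : 0 ≤ qw := setIntegral_nonneg hΩ fun x hx =>
    mul_nonneg (hc.le.trans (hρc x hx)) (sq_nonneg _)
  have hqu0 : 0 ≤ qu := setIntegral_nonneg hΩ fun x hx =>
    mul_nonneg (hc.le.trans (hρc x hx)) (sq_nonneg _)
  rw [ENNReal.toReal_add (ENNReal.add_ne_top.1 hlhs).1 (ENNReal.add_ne_top.1 hlhs).2,
    ENNReal.toReal_add (ENNReal.add_ne_top.1 hrhs).1 (ENNReal.add_ne_top.1 hrhs).2,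
    ENNReal.toReal_mul, ENNReal.toReal_mul, ENNReal.toReal_mul, ENNReal.toReal_mul, hκ,
    ENNReal.toReal_ofReal hκ0.le, ENNReal.toReal_ofReal hqw0, ENNReal.toReal_ofReal hqu0,
    ENNReal.toReal_ofReal (by positivity)] at s3
  have hm2 : (1 / (2 * ε)) * (qw - qu) ≤ ∫ x in Ω, φ x * (F₀ x + F₁ x) := by
    have h1 := mul_le_mul_of_nonneg_left hFV (by positivity : 0 ≤ 1 / ε)
    rw [mul_add, ← mul_assoc (1 / ε) ε, one_div_mul_cancel hε.ne', one_mul] at h1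
    linarith
  have iF : IntegrableOn (fun x => φ x * (F₀ x + F₁ x)) Ω := by
    refine integrable_of_abs_le hΩ hΩf (hφm.aemeasurable.mul (hF₀.add hF₁))
      (2 * a * (C₂ + C₂)) fun x hx => ?_
    rw [abs_mul, abs_of_nonneg (hφ0 x)]
    exact mul_le_mul (hφC x) ((abs_add_le _ _).trans (add_le_add (hF₀C x hx) (hF₁C x hx)))
      (abs_nonneg _) (by linarith)
  have iw := hρ₀.integrable_mul_sq hΩ hρ₁ hwf
  have iu := hρ₀.integrable_mul_sq hΩ hρ₁ huf
  simp only [Pi.sub_apply] at iw iu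
  set D : EuclideanSpace ℝ (Fin N) → ℝ := fun x =>
    (1 / (2 * ε)) * ((ρ₀ x + ρ₁ x) * (w x - f x) ^ 2 - (ρ₀ x + ρ₁ x) * (u x - f x) ^ 2) -
      φ x * (F₀ x + F₁ x) with hD
  have iwu : IntegrableOn (fun x => (1 / (2 * ε)) * ((ρ₀ x + ρ₁ x) * (w x - f x) ^ 2 -
      (ρ₀ x + ρ₁ x) * (u x - f x) ^ 2)) Ω := (iw.sub iu).const_mul _
  have iD : IntegrableOn D Ω := iwu.sub iF
  have hDint : ∫ x in Ω, D x ≤ 0 := by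
    rw [integral_sub iwu iF, integral_const_mul, integral_sub iw iu]
    linarith
  -- From w = u + φ one has (w - f)² - (u - f)² = φ² + 2φ(u - f). Where φ > 0, u ≥ v, so the
  -- supersolution inequality absorbs φ(F₀ + F₁) into the linear term and the quadratic term
  -- remains. As ∫ D ≤ 0, φ vanishes a.e.
  have hDlow : ∀ x ∈ Ω, 1 / (2 * ε) * c * φ x ^ 2 ≤ D x := by
    intro x hx
    by_cases h0 : φ x = 0
    · simp [hD, hu_eq x, h0]
    · have hga : g x < a := not_le.1 fun h1 => h0 (hφa x h1)
      have hpos : 0 < φ x := lt_of_le_of_ne (hφ0 x) (Ne.symm h0)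
      have hpv : v x < p x := by
        by_contra hcon
        exact h0 (max_eq_right (by linarith [not_lt.1 hcon]))
      have huv : v x ≤ u x := by
        rw [hu, Pi.add_apply, Pi.inf_apply, inf_eq_right.2 hpv.le]
        exact le_add_of_nonneg_right (le_max_right _ _)
      have hs := hsup x hx hga
      have hρx := hρc x hx
      have hwu : w x = u x + φ x := by rw [hu_eq x]; ring
      have h2 : φ x * (F₀ x + F₁ x) ≤ φ x * ((ρ₀ x + ρ₁ x) * (u x - f x) / ε) := by
        refine mul_le_mul_of_nonneg_left (hs.trans ?_) hpos.le
        refine div_le_div_of_nonneg_right ?_ hε.le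
        exact mul_le_mul_of_nonneg_left (by linarith) (hc.le.trans hρx)
      have h3 : D x = 1 / (2 * ε) * (ρ₀ x + ρ₁ x) * φ x ^ 2 +
          (φ x * ((ρ₀ x + ρ₁ x) * (u x - f x) / ε) - φ x * (F₀ x + F₁ x)) := by
        simp only [hD]
        rw [hwu]
        field_simp
        ring
      rw [h3]
      have h4 : 1 / (2 * ε) * c * φ x ^ 2 ≤ 1 / (2 * ε) * (ρ₀ x + ρ₁ x) * φ x ^ 2 := by
        gcongr
      linarith
  have hD0 : ∀ x ∈ Ω, 0 ≤ D x := fun x hx => le_trans (by positivity) (hDlow x hx)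
  have hDz : ∫ x in Ω, D x = 0 := le_antisymm hDint (setIntegral_nonneg hΩ hD0)
  have hDae := (integral_eq_zero_iff_of_nonneg_ae
    ((ae_restrict_mem hΩ).mono fun x hx => hD0 x hx) iD).1 hDz
  filter_upwards [hDae, ae_restrict_mem hΩ] with x hx hxΩ
  have h1 := hDlow x hxΩ
  rw [hx, Pi.zero_apply] at h1
  have h2 : φ x ^ 2 ≤ 0 := by
    by_contra hcon
    have : 0 < 1 / (2 * ε) * c * φ x ^ 2 := mul_pos (by positivity) (not_le.1 hcon)
    linarith
  have h3 : φ x = 0 := by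
    have := le_antisymm h2 (sq_nonneg _)
    exact pow_eq_zero_iff (two_ne_zero) |>.1 this
  have h4 : p x - v x ≤ φ x := le_max_left _ _
  have : p x = min (w x) a := rfl
  linarith

/-- Comparison of the minimizer with a strict supersolution built from a distance function. -/
lemma min_le_clampFun (h : IsTube Ω g a L) (hΩ : MeasurableSet Ω)
    (hΩf : volume Ω ≠ ⊤) (hg : Measurable g)
    (hε : 0 < ε) (hεa : ε < a) (hεL : ε * L ≤ 1) {c C₀ C₁ C₂ : ℝ}
    (hρ₀ : BoundedDensity Ω ρ₀ C₀) (hρ₁ : BoundedDensity Ω ρ₁ C₁)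
    (hc : 0 < c) (hρc : ∀ x ∈ Ω, c ≤ ρ₀ x + ρ₁ x)
    (hF₀ : AEMeasurable F₀ (volume.restrict Ω)) (hF₁ : AEMeasurable F₁ (volume.restrict Ω))
    (hF₀C : ∀ x ∈ Ω, |F₀ x| ≤ C₂) (hF₁C : ∀ x ∈ Ω, |F₁ x| ≤ C₂)
    (hT : TransportBounds Ω ε a g ρ₀ ρ₁ F₀ F₁)
    (hf : MemLp f 2 (volume.restrict Ω)) (hfin : energy Ω ρ₀ ρ₁ ε f 0 ≠ ⊤)
    (hsup : ∀ x ∈ Ω, g x < a →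
      F₀ x + F₁ x ≤ (ρ₀ x + ρ₁ x) * (clampFun g a x - f x) / ε)
    (hw : IsMinimizer Ω ρ₀ ρ₁ ε f w) :
    ∀ᵐ x ∂volume.restrict Ω, min (w x) a ≤ clampFun g a x := by
  have hae := hw.1.aemeasurable.ae_eq_mk
  filter_upwards [h.min_le_clampFun_of_measurable hΩ hΩf hg hε hεa hεL hρ₀ hρ₁ hc hρc hF₀ hF₁
    hF₀C hF₁C hT hf hfin hsup (hw.congr_ae hae) hw.1.aemeasurable.measurable_mk, hae] with x h1 h2
  rwa [h2]

end IsTube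

end Comparison

/-! ### Transport of the densities along the gradient -/

section TransportEstimates

variable {N : ℕ} {Ω : Set (EuclideanSpace ℝ (Fin N))} {ε a L C C' M ω η K : ℝ}
  {g ρ ρ₀ ρ₁ : EuclideanSpace ℝ (Fin N) → ℝ}

/-- A density on `Ω` that is differentiable in the tube, with bounds and a modulus of continuity
along gradient shifts for its derivative. -/
structure TubeDensity (Ω : Set (EuclideanSpace ℝ (Fin N)))
    (g : EuclideanSpace ℝ (Fin N) → ℝ) (a ε : ℝ) (ρ : EuclideanSpace ℝ (Fin N) → ℝ)
    (C C' ω : ℝ) : Prop where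
  bounded : BoundedDensity Ω ρ C
  differentiableAt : ∀ x ∈ Ω, |g x| < 5 * a → DifferentiableAt ℝ ρ x
  norm_fderiv_le : ∀ x ∈ Ω, |g x| < 5 * a → ‖fderiv ℝ ρ x‖ ≤ C'
  modulus : ∀ x ∈ Ω, |g x| < 4 * a → ∀ s, 0 ≤ s → s < ε →
    ‖fderiv ℝ ρ (gradShift g s x) - fderiv ℝ ρ x‖ ≤ ω

/-- `div(ρ ∇g) + η` in the core of the tube, and the constant `K` elsewhere. -/
def errFun (g : EuclideanSpace ℝ (Fin N) → ℝ) (a K η : ℝ) (ρ : EuclideanSpace ℝ (Fin N) → ℝ)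
    (x : EuclideanSpace ℝ (Fin N)) : ℝ :=
  open Classical in
  if -(3 / 2 * a) ≤ g x ∧ g x < a then
    ρ x * divergence (gradient g) x + fderiv ℝ ρ x (gradient g x) + η
  else K

namespace IsTube

/-- First-order expansion of a density along a gradient shift. -/
lemma exists_apply_gradShift_sub (h : IsTube Ω g a L) (hρ : TubeDensity Ω g a ε ρ C C' ω)
    {x : EuclideanSpace ℝ (Fin N)} (hx : x ∈ Ω) (hg : |g x| < 4 * a) {s : ℝ} (hs : 0 < s)
    (hsa : s < a) : ∃ τ, 0 < τ ∧ τ < s ∧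
      ρ (gradShift g s x) - ρ x = s * fderiv ℝ ρ (gradShift g τ x) (gradient g x) := by
  have hder : ∀ τ ∈ Icc (0 : ℝ) s, HasDerivAt (fun τ : ℝ => ρ (x + τ • gradient g x))
      (fderiv ℝ ρ (gradShift g τ x) (gradient g x)) τ := by
    intro τ hτ
    have hm : gradShift g τ x ∈ Ω ∧ |g (gradShift g τ x)| < 5 * a :=
      h.mem_of_dist_lt hx hg (by
        rw [h.dist_gradShift hx hg, abs_of_nonneg hτ.1]; exact hτ.2.trans_lt hsa)
    have h1 := (hρ.differentiableAt _ hm.1 hm.2).hasFDerivAt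
    have h2 : HasDerivAt (fun τ : ℝ => x + τ • gradient g x) (gradient g x) τ := by
      simpa using ((hasDerivAt_id τ).smul_const (gradient g x)).const_add x
    exact h1.comp_hasDerivAt τ h2
  obtain ⟨τ, hτ, hτe⟩ := exists_hasDerivAt_eq_slope
    (fun τ : ℝ => ρ (x + τ • gradient g x))
    (fun τ => fderiv ℝ ρ (gradShift g τ x) (gradient g x)) hs
    (fun τ hτ => (hder τ hτ).continuousAt.continuousWithinAt)
    (fun τ hτ => hder τ ⟨hτ.1.le, hτ.2.le⟩)
  refine ⟨τ, hτ.1, hτ.2, ?_⟩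
  rw [hτe, gradShift, zero_smul, add_zero, sub_zero]
  field_simp

lemma abs_fderiv_gradient_le (h : IsTube Ω g a L) {z : EuclideanSpace ℝ (Fin N)} (hz : z ∈ Ω)
    (hgz : |g z| < 5 * a) (A : EuclideanSpace ℝ (Fin N) →L[ℝ] ℝ) :
    |A (gradient g z)| ≤ ‖A‖ := by
  have := A.le_opNorm (gradient g z)
  rwa [h.norm_gradient z hz hgz, mul_one] at this

lemma apply_gradShift_le (h : IsTube Ω g a L) (hρ : TubeDensity Ω g a ε ρ C C' ω)
    {x : EuclideanSpace ℝ (Fin N)} (hx : x ∈ Ω) (hg : |g x| < 4 * a) {s : ℝ} (hs : 0 < s)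
    (hsε : s < ε) (hsa : s < a) :
    ρ (gradShift g s x) ≤ ρ x + s * (fderiv ℝ ρ x (gradient g x) + ω) ∧
      ρ (gradShift g s x) ≤ ρ x + s * C' := by
  have hx5 : |g x| < 5 * a := by linarith [h.pos]
  obtain ⟨τ, hτ0, hτs, he⟩ := h.exists_apply_gradShift_sub hρ hx hg hs hsa
  have hm : gradShift g τ x ∈ Ω ∧ |g (gradShift g τ x)| < 5 * a :=
    h.mem_of_dist_lt hx hg (by
      rw [h.dist_gradShift hx hg, abs_of_pos hτ0]; exact hτs.trans hsa)
  have h1 := h.abs_fderiv_gradient_le hx hx5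
    (fderiv ℝ ρ (gradShift g τ x) - fderiv ℝ ρ x)
  rw [sub_apply] at h1
  have h2 := h1.trans (hρ.modulus x hx hg τ hτ0.le (hτs.trans hsε))
  have h3 := (h.abs_fderiv_gradient_le hx hx5
    (fderiv ℝ ρ (gradShift g τ x))).trans (hρ.norm_fderiv_le _ hm.1 hm.2)
  constructor
  · have := mul_le_mul_of_nonneg_left (le_of_abs_le h2) hs.le
    nlinarith
  · have := mul_le_mul_of_nonneg_left (le_of_abs_le h3) hs.le
    linarith

/-- The factor exp(sΔg), the cutoff (Lipschitz with constant 1/a in g) and ρ each change by O(s)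
under the shift; the constants are simply added. This suffices away from the interface, where a
fixed error is later beaten by 1/ε. -/
lemma crude_transport (h : IsTube Ω g a L) (hρ : TubeDensity Ω g a ε ρ C C' ω) (hε1 : ε ≤ 1)
    (hεa : ε < a) (hεM : ε * M ≤ 1 / 2) (hC' : 0 ≤ C')
    (hM : ∀ x ∈ Ω, |g x| < 5 * a → |divergence (gradient g) x| ≤ M)
    {x : EuclideanSpace ℝ (Fin N)} (hx : x ∈ Ω) (hg : |g x| < 4 * a) {s : ℝ} (hs : 0 < s)
    (hsε : s < ε) :
    Real.exp (s * divergence (gradient g) x) *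
      (cutoff g a (gradShift g s x) * ρ (gradShift g s x)) ≤
      cutoff g a x * ρ x + s * (C' + C / a + (M + M ^ 2) * C) := by
  have ha := h.pos
  have hsa := hsε.trans hεa
  have hs_abs : |s| < a := by rwa [abs_of_pos hs]
  have hm := hM x hx (by linarith)
  have hM0 : 0 ≤ M := (abs_nonneg _).trans hm
  set m := divergence (gradient g) x
  have hsm : |s * m| ≤ s * M := by rw [abs_mul, abs_of_pos hs]; gcongr
  have hsM : s * M ≤ 1 / 2 := (mul_le_mul_of_nonneg_right hsε.le hM0).trans hεM
  have hexp : Real.exp (s * m) ≤ 1 + s * (M + M ^ 2) := by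
    have h1 := Real.abs_exp_sub_one_sub_id_le (x := s * m) (by linarith)
    have h2 := le_of_abs_le h1
    have h3 : (s * m) ^ 2 ≤ (s * M) ^ 2 := sq_le_sq' (by linarith [neg_le_of_abs_le hsm])
      (le_of_abs_le hsm)
    have h4 : (s * M) ^ 2 ≤ s * M ^ 2 := by
      have : s ^ 2 ≤ s := by nlinarith
      nlinarith [sq_nonneg M]
    have := le_of_abs_le hsm
    linarith
  have hyΩ := h.gradShift_mem hx hg hs_abs
  have hgy := h.apply_gradShift hx hg hs_abs
  have hρy := (h.apply_gradShift_le hρ hx hg hs hsε hsa).2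
  have hθ := cutoff_le_add (g := g) (x := x) ha hs.le hgy.le
  set y := gradShift g s x
  have hρy0 := hρ.bounded.nonneg y hyΩ
  have hρyC := hρ.bounded.le y hyΩ
  have hθy0 : 0 ≤ cutoff g a y := cutoff_nonneg
  have hθy1 : cutoff g a y ≤ 1 := cutoff_le_one
  have hθx0 : 0 ≤ cutoff g a x := cutoff_nonneg
  have hθx1 : cutoff g a x ≤ 1 := cutoff_le_one
  have hb : cutoff g a y * ρ y ≤ C := (mul_le_of_le_one_left hρy0 hθy1).trans hρyC
  have hb0 : 0 ≤ cutoff g a y * ρ y := mul_nonneg hθy0 hρy0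
  have e1 : Real.exp (s * m) * (cutoff g a y * ρ y) ≤
      cutoff g a y * ρ y + s * ((M + M ^ 2) * C) := by
    have h1 := mul_le_mul_of_nonneg_right hexp hb0
    have h2 : s * (M + M ^ 2) * (cutoff g a y * ρ y) ≤ s * (M + M ^ 2) * C :=
      mul_le_mul_of_nonneg_left hb (by positivity)
    linarith
  have e2 : cutoff g a y * ρ y ≤ cutoff g a x * ρ y + s * (C / a) := by
    have h1 := mul_le_mul_of_nonneg_right hθ hρy0
    have h2 : s / a * ρ y ≤ s / a * C := mul_le_mul_of_nonneg_left hρyC (by positivity)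
    have h3 : s / a * C = s * (C / a) := by ring
    linarith
  have e3 : cutoff g a x * ρ y ≤ cutoff g a x * ρ x + s * C' := by
    have h1 := mul_le_mul_of_nonneg_left hρy hθx0
    have h2 : cutoff g a x * (s * C') ≤ s * C' := mul_le_of_le_one_left (by positivity) hθx1
    linarith
  linarith

/-- To first order in s the Jacobian, the variation of ρ and the subtracted divergence cancel. The
error is s times O(ω + ε), with ω the modulus of continuity of Δg and Dρ; half of η pays for each
contribution. -/
lemma backward_transport_core (h : IsTube Ω g a L) (hρ : TubeDensity Ω g a ε ρ C C' ω)
    (hεa : 2 * ε < a) (hεM : ε * M ≤ 1 / 2) (hC : 0 ≤ C) (hC' : 0 ≤ C') (hω : 0 ≤ ω) (hη : 0 ≤ η)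
    (hM : ∀ x ∈ Ω, |g x| < 5 * a → |divergence (gradient g) x| ≤ M)
    (hMω : ∀ x ∈ Ω, |g x| < 4 * a → ∀ s, 0 ≤ s → s < ε →
      |divergence (gradient g) (gradShift g s x) - divergence (gradient g) x| ≤ ω)
    (hωη : (2 + C) * ω ≤ η / 2) (hεη : ε * (2 * M * (C' + C * ω + η)) ≤ η / 2)
    {x : EuclideanSpace ℝ (Fin N)} (hx : x ∈ Ω) (hg : |g x| < 4 * a) {s : ℝ} (hs : 0 < s)
    (hsε : s < ε) :
    Real.exp (s * divergence (gradient g) x) * (ρ (gradShift g s x) -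
      s * (ρ (gradShift g s x) * divergence (gradient g) (gradShift g s x) +
        fderiv ℝ ρ (gradShift g s x) (gradient g (gradShift g s x)) + η)) ≤ ρ x := by
  have ha := h.pos
  have hsa : s < a := by linarith
  have hs_abs : |s| < a := by rwa [abs_of_pos hs]
  have hx5 : |g x| < 5 * a := by linarith
  have hm := hM x hx hx5
  have hM0 : 0 ≤ M := (abs_nonneg _).trans hm
  have hyΩ := h.gradShift_mem hx hg hs_abs
  have hy5 : |g (gradShift g s x)| < 5 * a := (h.mem_of_dist_lt hx hg (by
    rwa [h.dist_gradShift hx hg])).2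
  have hmy := neg_le_of_abs_le (hMω x hx hg s hs.le hsε)
  have hρy := (h.apply_gradShift_le hρ hx hg hs hsε hsa).1
  have hqy := (h.abs_fderiv_gradient_le hx hx5 (fderiv ℝ ρ (gradShift g s x))).trans
    (hρ.norm_fderiv_le _ hyΩ hy5)
  have hqd := (h.abs_fderiv_gradient_le hx hx5
    (fderiv ℝ ρ (gradShift g s x) - fderiv ℝ ρ x)).trans (hρ.modulus x hx hg s hs.le hsε)
  rw [sub_apply] at hqd
  rw [h.gradient_gradShift hx hg hs_abs]
  have hρy0 := hρ.bounded.nonneg _ hyΩ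
  have hρyC := hρ.bounded.le _ hyΩ
  set m := divergence (gradient g) x
  set y := gradShift g s x
  set my := divergence (gradient g) y
  set qy := fderiv ℝ ρ y (gradient g x)
  set qx := fderiv ℝ ρ x (gradient g x)
  have hsm : |s * m| ≤ s * M := by rw [abs_mul, abs_of_pos hs]; gcongr
  have hsM : s * M ≤ 1 / 2 := (mul_le_mul_of_nonneg_right hsε.le hM0).trans hεM
  have he0 := Real.exp_pos (s * m)
  have he1 : |Real.exp (s * m) - 1| ≤ 2 * (s * M) :=
    (Real.abs_exp_sub_one_le (by linarith)).trans (by linarith)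
  -- Since 1 - z ≤ exp(-z), the divergence term compensates the Jacobian without a remainder.
  have he2 : Real.exp (s * m) * (1 - s * m) ≤ 1 := by
    have h1 := mul_le_mul_of_nonneg_left (Real.one_sub_le_exp_neg (s * m)) he0.le
    rwa [← Real.exp_add, add_neg_cancel, Real.exp_zero] at h1
  have h1 : ρ y - s * (ρ y * my + qy + η) ≤ ρ y * (1 - s * m) + s * (C * ω - qy - η) := by
    have e1 : ρ y * (m - my) ≤ C * ω :=
      (mul_le_mul_of_nonneg_left (by linarith) hρy0).trans (mul_le_mul_of_nonneg_right hρyC hω)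
    have := mul_le_mul_of_nonneg_left e1 hs.le
    linarith
  have h2 : Real.exp (s * m) * (ρ y * (1 - s * m)) ≤ ρ y := by
    have := mul_le_mul_of_nonneg_left he2 hρy0
    linarith
  have h3 : (Real.exp (s * m) - 1) * (C * ω - qy - η) ≤ s * (2 * M * (C' + C * ω + η)) := by
    have hb : |C * ω - qy - η| ≤ C' + C * ω + η := by
      rw [abs_le] at hqy ⊢
      have := mul_nonneg hC hω
      constructor <;> linarith
    calc _ ≤ |(Real.exp (s * m) - 1) * (C * ω - qy - η)| := le_abs_self _
      _ = |Real.exp (s * m) - 1| * |C * ω - qy - η| := abs_mul _ _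
      _ ≤ 2 * (s * M) * (C' + C * ω + η) :=
        mul_le_mul he1 hb (abs_nonneg _) (by positivity)
      _ = _ := by ring
  have h4 : s * (2 * M * (C' + C * ω + η)) ≤ η / 2 := by
    refine (mul_le_mul_of_nonneg_right hsε.le ?_).trans hεη
    have := mul_nonneg hC hω
    positivity
  have h5 := mul_le_mul_of_nonneg_left h1 he0.le
  have h6 : s * (Real.exp (s * m) * (C * ω - qy - η)) ≤ s * (C * ω - qy - η + η / 2) :=
    mul_le_mul_of_nonneg_left (by linarith) hs.le
  have h7 : s * (qx + ω + (C * ω - qy - η + η / 2)) ≤ 0 :=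
    mul_nonpos_of_nonneg_of_nonpos hs.le (by linarith [neg_le_of_abs_le hqd])
  linarith

/-- The same first-order cancellation, now expanded at x instead of the shifted point, so exp(sΔg)
is expanded to second order. -/
lemma forward_transport_core (h : IsTube Ω g a L) (hρ : TubeDensity Ω g a ε ρ C C' ω)
    (hεa : 2 * ε < a) (hεM : ε * M ≤ 1 / 2) (hC : 0 ≤ C) (hC' : 0 ≤ C') (hω : 0 ≤ ω)
    (hM : ∀ x ∈ Ω, |g x| < 5 * a → |divergence (gradient g) x| ≤ M)
    (hωη : (2 + C) * ω ≤ η / 2) (hεη : ε * (M * (C' + ω) + M ^ 2 * C) ≤ η / 2)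
    {x : EuclideanSpace ℝ (Fin N)} (hx : x ∈ Ω) (hg : |g x| < 4 * a) {s : ℝ} (hs : 0 < s)
    (hsε : s < ε) :
    Real.exp (s * divergence (gradient g) x) * ρ (gradShift g s x) ≤
      ρ x + s * (ρ x * divergence (gradient g) x + fderiv ℝ ρ x (gradient g x) + η) := by
  have ha := h.pos
  have hsa : s < a := by linarith
  have hs_abs : |s| < a := by rwa [abs_of_pos hs]
  have hx5 : |g x| < 5 * a := by linarith
  have hm := hM x hx hx5
  have hM0 : 0 ≤ M := (abs_nonneg _).trans hm
  have hyΩ := h.gradShift_mem hx hg hs_abs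
  have hρy := (h.apply_gradShift_le hρ hx hg hs hsε hsa).1
  have hqx := (h.abs_fderiv_gradient_le hx hx5 (fderiv ℝ ρ x)).trans
    (hρ.norm_fderiv_le _ hx hx5)
  have hρy0 := hρ.bounded.nonneg _ hyΩ
  have hρyC := hρ.bounded.le _ hyΩ
  set m := divergence (gradient g) x
  set y := gradShift g s x
  set q := fderiv ℝ ρ x (gradient g x)
  have hsm : |s * m| ≤ s * M := by rw [abs_mul, abs_of_pos hs]; gcongr
  have hsM : s * M ≤ 1 / 2 := (mul_le_mul_of_nonneg_right hsε.le hM0).trans hεM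
  have hexp : Real.exp (s * m) ≤ 1 + s * m + s * (s * M ^ 2) := by
    have h1 := le_of_abs_le (Real.abs_exp_sub_one_sub_id_le (x := s * m) (by linarith))
    have h3 : (s * m) ^ 2 ≤ (s * M) ^ 2 := sq_le_sq' (by linarith [neg_le_of_abs_le hsm])
      (le_of_abs_le hsm)
    nlinarith
  have h1 := mul_le_mul_of_nonneg_right hexp hρy0
  have h2 := mul_le_mul_of_nonneg_left hρy
    (show 0 ≤ 1 + s * m by linarith [neg_le_of_abs_le hsm])
  have h3 : s * (s * M ^ 2) * ρ y ≤ s * (s * M ^ 2) * C :=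
    mul_le_mul_of_nonneg_left hρyC (by positivity)
  have h4 : m * (q + ω) ≤ M * (C' + ω) := by
    have hb : |q + ω| ≤ C' + ω := by
      rw [abs_le] at hqx ⊢
      constructor <;> linarith
    calc _ ≤ |m * (q + ω)| := le_abs_self _
      _ = |m| * |q + ω| := abs_mul _ _
      _ ≤ _ := mul_le_mul hm hb (abs_nonneg _) hM0
  have h5 : s * (M * (C' + ω) + M ^ 2 * C) ≤ η / 2 :=
    (mul_le_mul_of_nonneg_right hsε.le (by positivity)).trans hεη
  have h6 := mul_le_mul_of_nonneg_left h4 (mul_nonneg hs.le hs.le)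
  have h7 : s * (s * (M * (C' + ω) + M ^ 2 * C) + ω) ≤ s * η :=
    mul_le_mul_of_nonneg_left (by nlinarith) hs.le
  linarith

/-- The core is cut at -3a/2 so that, with 2ε < a, a point of the core and its shift both lie above
-2a, where the cutoff is 1 and the sharp expansion applies. Elsewhere the crude bound is used; the
factor 2 in K compensates exp(sΔg) ≥ 1/2 in the backward estimate. -/
lemma transportBounds (h : IsTube Ω g a L) (hρ₀ : TubeDensity Ω g a ε ρ₀ C C' ω)
    (hρ₁ : TubeDensity Ω g a ε ρ₁ C C' ω) (hε1 : ε ≤ 1) (hεa : 2 * ε < a)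
    (hεM : ε * M ≤ 1 / 2) (hM0 : 0 ≤ M) (hC : 0 ≤ C) (hC' : 0 ≤ C') (hω : 0 ≤ ω) (hη : 0 ≤ η)
    (hM : ∀ x ∈ Ω, |g x| < 5 * a → |divergence (gradient g) x| ≤ M)
    (hMω : ∀ x ∈ Ω, |g x| < 4 * a → ∀ s, 0 ≤ s → s < ε →
      |divergence (gradient g) (gradShift g s x) - divergence (gradient g) x| ≤ ω)
    (hωη : (2 + C) * ω ≤ η / 2) (hεη₀ : ε * (2 * M * (C' + C * ω + η)) ≤ η / 2)
    (hεη₁ : ε * (M * (C' + ω) + M ^ 2 * C) ≤ η / 2)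
    (hK : K = 2 * (C' + C / a + (M + M ^ 2) * C)) :
    TransportBounds Ω ε a g ρ₀ ρ₁ (errFun g a K η ρ₀) (errFun g a K η ρ₁) := by
  have ha := h.pos
  have hK0 : 0 ≤ C' + C / a + (M + M ^ 2) * C := by positivity
  have hfar : ∀ ρ : EuclideanSpace ℝ (Fin N) → ℝ, ∀ x ∈ Ω, g x ≤ -(3 * a) →
      0 ≤ errFun g a K η ρ x := by
    intro ρ x hx hgx
    rw [errFun, if_neg (fun hc => by linarith [hc.1]), hK]
    linarith
  refine ⟨hfar ρ₀, hfar ρ₁, ?_, ?_⟩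
  · intro s hs hsε x hx hg hgy
    have hs_abs : |s| < a := by rw [abs_of_pos hs]; linarith
    have hgxy := h.apply_gradShift hx hg hs_abs
    by_cases hc : -(3 / 2 * a) ≤ g (gradShift g s x)
    · rw [errFun, if_pos ⟨hc, hgy⟩, cutoff_eq_one ha (by linarith), cutoff_eq_one ha (by linarith),
        one_mul, one_mul]
      exact h.backward_transport_core hρ₀ hεa hεM hC hC' hω hη hM hMω hωη hεη₀ hx hg hs hsε
    · rw [errFun, if_neg (fun hc' => hc hc'.1)]
      have h1 := h.crude_transport hρ₀ hε1 (by linarith) hεM hC' hM hx hg hs hsε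
      have hsm : -(1 / 2) ≤ s * divergence (gradient g) x := by
        have h2 := neg_le_of_abs_le (hM x hx (by linarith))
        have h3 := mul_le_mul_of_nonneg_left h2 hs.le
        have h4 := mul_le_mul_of_nonneg_right hsε.le hM0
        linarith
      have he : 1 / 2 ≤ Real.exp (s * divergence (gradient g) x) := by
        linarith [Real.add_one_le_exp (s * divergence (gradient g) x)]
      have h5 : s * (C' + C / a + (M + M ^ 2) * C) ≤
          Real.exp (s * divergence (gradient g) x) * (s * K) := by
        have := mul_le_mul_of_nonneg_right he
          (show 0 ≤ s * K by rw [hK]; exact mul_nonneg hs.le (by linarith))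
        rw [hK] at this ⊢
        linarith
      rw [mul_sub]
      linarith
  · intro s hs hsε x hx hg hgx
    have hs_abs : |s| < a := by rw [abs_of_pos hs]; linarith
    have hgxy := h.apply_gradShift hx hg hs_abs
    by_cases hc : -(3 / 2 * a) ≤ g x
    · rw [errFun, if_pos ⟨hc, hgx⟩, cutoff_eq_one ha (by linarith), cutoff_eq_one ha (by linarith),
        one_mul, one_mul]
      exact h.forward_transport_core hρ₁ hεa hεM hC hC' hω hM hωη hεη₁ hx hg hs hsε
    · rw [errFun, if_neg (fun hc' => hc hc'.1)]
      have h1 := h.crude_transport hρ₁ hε1 (by linarith) hεM hC' hM hx hg hs hsε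
      have h2 : s * (C' + C / a + (M + M ^ 2) * C) ≤ s * K :=
        mul_le_mul_of_nonneg_left (by linarith) hs.le
      linarith

end IsTube

lemma measurable_gradient (g : EuclideanSpace ℝ (Fin N) → ℝ) : Measurable (gradient g) :=
  (InnerProductSpace.toDual ℝ (EuclideanSpace ℝ (Fin N))).symm.continuous.measurable.comp
    (measurable_fderiv ℝ g)

lemma measurable_divergence (F : EuclideanSpace ℝ (Fin N) → EuclideanSpace ℝ (Fin N)) :
    Measurable (divergence F) := by
  unfold divergence
  refine Finset.measurable_sum _ fun i _ => ?_
  exact (EuclideanSpace.proj (𝕜 := ℝ) i).continuous.measurable.comp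
    (measurable_fderiv_apply_const ℝ F _)

lemma aemeasurable_errFun (hg : Measurable g) (hρ : AEMeasurable ρ (volume.restrict Ω)) :
    AEMeasurable (errFun g a K η ρ) (volume.restrict Ω) := by
  have h1 : Measurable fun x => fderiv ℝ ρ x (gradient g x) :=
    (ContinuousLinearMap.measurable_apply₂ (E := EuclideanSpace ℝ (Fin N)) (F := ℝ)).comp
      ((measurable_fderiv ℝ ρ).prodMk (measurable_gradient g))
  have h2 : AEMeasurable (fun x => ρ x * divergence (gradient g) x + fderiv ℝ ρ x (gradient g x)
      + η) (volume.restrict Ω) :=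
    ((hρ.mul (measurable_divergence _).aemeasurable).add h1.aemeasurable).add_const η
  have hS : MeasurableSet {x | -(3 / 2 * a) ≤ g x ∧ g x < a} :=
    (measurableSet_le measurable_const hg).inter (measurableSet_lt hg measurable_const)
  obtain ⟨f, hf, hfe⟩ := h2
  classical
  refine ⟨fun x => if -(3 / 2 * a) ≤ g x ∧ g x < a then f x else K,
    Measurable.ite hS hf measurable_const, ?_⟩
  filter_upwards [hfe] with x hx
  simp only [errFun, hx]

lemma IsTube.abs_errFun_le (h : IsTube Ω g a L) (hρ : TubeDensity Ω g a ε ρ C C' ω)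
    (hM : ∀ x ∈ Ω, |g x| < 5 * a → |divergence (gradient g) x| ≤ M) (hη : 0 ≤ η)
    {x : EuclideanSpace ℝ (Fin N)} (hx : x ∈ Ω) :
    |errFun g a K η ρ x| ≤ max (C * M + C' + η) |K| := by
  rw [errFun]
  split_ifs with hc
  · refine le_max_of_le_left ?_
    have hx5 : |g x| < 5 * a := by rw [abs_lt]; constructor <;> linarith [h.pos, hc.1, hc.2]
    have h1 : |ρ x * divergence (gradient g) x| ≤ C * M := by
      rw [abs_mul, abs_of_nonneg (hρ.bounded.nonneg x hx)]
      exact mul_le_mul (hρ.bounded.le x hx) (hM x hx hx5) (abs_nonneg _)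
        ((hρ.bounded.nonneg x hx).trans (hρ.bounded.le x hx))
    have h2 := (h.abs_fderiv_gradient_le hx hx5 (fderiv ℝ ρ x)).trans
      (hρ.norm_fderiv_le _ hx hx5)
    rw [abs_le] at h1 h2 ⊢
    constructor <;> linarith
  · exact le_max_right _ _

end TransportEstimates

/-! ### Geometry of the signed distance -/

lemma exists_mem_segment_frontier {E : Type*} [NormedAddCommGroup E] [NormedSpace ℝ E] {A : Set E}
    {x y : E} (hx : x ∈ closure A) (hy : y ∉ interior A) :
    ∃ z ∈ segment ℝ x y, z ∈ frontier A := by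
  by_contra! hc
  have hx' : x ∈ interior A := by
    by_contra h
    exact hc x (left_mem_segment ℝ x y) ⟨hx, h⟩
  have hy' : y ∈ (closure A)ᶜ := fun h => hc y (right_mem_segment ℝ x y) ⟨h, hy⟩
  obtain ⟨z, -, hz1, hz2⟩ := (convex_segment x y).isPreconnected (interior A) (closure A)ᶜ
    isOpen_interior isClosed_closure.isOpen_compl
    (fun z hz => by
      by_cases h : z ∈ interior A
      · exact Or.inl h
      · exact Or.inr fun h' => hc z hz ⟨h', h⟩)
    ⟨x, left_mem_segment ℝ x y, hx'⟩ ⟨y, right_mem_segment ℝ x y, hy'⟩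
  exact hz2 (interior_subset_closure hz1)

/-- A set that is compactly contained in `Ω` and whose topological boundary is the
measure-theoretic one. -/
structure IsEssential {N : ℕ} (Ω A : Set (EuclideanSpace ℝ (Fin N))) : Prop where
  measurableSet : MeasurableSet A
  isCompact_closure : IsCompact (closure A)
  closure_subset : closure A ⊆ Ω
  boundary_essential : ∀ x ∈ frontier A, ∀ r : ℝ, 0 < r →
    volume (A ∩ Metric.ball x r) ≠ 0 ∧ volume (Metric.ball x r \ A) ≠ 0

namespace IsEssential

variable {N : ℕ} {Ω A : Set (EuclideanSpace ℝ (Fin N))} {x y : EuclideanSpace ℝ (Fin N)}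

lemma frontier_subset (h : IsEssential Ω A) : frontier A ⊆ Ω :=
  frontier_subset_closure.trans h.closure_subset

lemma isCompact_frontier (h : IsEssential Ω A) : IsCompact (frontier A) :=
  h.isCompact_closure.of_isClosed_subset isClosed_frontier frontier_subset_closure

lemma frontier_nonempty [Nontrivial (EuclideanSpace ℝ (Fin N))] (h : IsEssential Ω A)
    (hA : A.Nonempty) : (frontier A).Nonempty := by
  refine nonempty_frontier_iff.2 ⟨hA, ?_⟩
  rintro rfl
  have := h.isCompact_closure
  rw [closure_univ] at this
  exact noncompact_univ (EuclideanSpace ℝ (Fin N)) this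

lemma volume_ne_zero (h : IsEssential Ω A) (hF : (frontier A).Nonempty) : volume A ≠ 0 := by
  obtain ⟨x, hx⟩ := hF
  exact fun h0 => (h.boundary_essential x hx 1 one_pos).1 (measure_mono_null inter_subset_left h0)

lemma volume_diff_ne_zero (h : IsEssential Ω A) (hΩ : IsOpen Ω) (hF : (frontier A).Nonempty) :
    volume (Ω \ A) ≠ 0 := by
  obtain ⟨x, hx⟩ := hF
  obtain ⟨r, hr, hrΩ⟩ := Metric.isOpen_iff.1 hΩ x (h.frontier_subset hx)
  exact fun h0 => (h.boundary_essential x hx r hr).2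
    (measure_mono_null (sdiff_subset_sdiff_left hrΩ) h0)

lemma notMem_densityOne_of_mem_interior (hx : x ∈ interior A) : x ∉ densityOne Ω (Ω \ A) := by
  intro hD
  obtain ⟨r, hr, hrA⟩ := Metric.isOpen_iff.1 isOpen_interior x hx
  refine measure_inter_ball_ne_zero hD hr ?_
  have : (Ω \ A) ∩ Metric.ball x r = ∅ :=
    eq_empty_of_forall_notMem fun z hz => hz.1.2 (interior_subset (hrA hz.2))
  rw [this, measure_empty]

lemma mem_densityOne_of_notMem_closure (hΩ : IsOpen Ω) (hxΩ : x ∈ Ω) (hx : x ∉ closure A) :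
    x ∈ densityOne Ω (Ω \ A) := by
  obtain ⟨r, hr, hrA⟩ := Metric.isOpen_iff.1 (hΩ.sdiff (isClosed_closure (s := A))) x ⟨hxΩ, hx⟩
  refine mem_densityOne_of_eventually hxΩ ?_
  filter_upwards [Ioo_mem_nhdsGT hr] with s hs
  have : Metric.ball x s \ (Ω \ A) = ∅ := by
    refine sdiff_eq_empty.2 fun z hz => ?_
    have := hrA (Metric.ball_subset_ball hs.2.le hz)
    exact ⟨this.1, fun h => this.2 (subset_closure h)⟩
  rw [this, measure_empty]

/-- Every ball around a boundary point meets the complement of A in positive measure, and almost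
every point of Ω \ A is a density point of it. -/
lemma frontier_subset_closure_densityOne (h : IsEssential Ω A) (hΩ : IsOpen Ω) :
    frontier A ⊆ closure (densityOne Ω (Ω \ A)) := by
  intro x hx
  rw [Metric.mem_closure_iff]
  intro r hr
  obtain ⟨s, hs, hsΩ⟩ := Metric.isOpen_iff.1 hΩ x (h.frontier_subset hx)
  have h0 := (h.boundary_essential x hx (min r s) (lt_min hr hs)).2
  by_contra! hc
  refine h0 ?_
  have hae := ae_mem_densityOne (hΩ.measurableSet.diff h.measurableSet) (sdiff_subset (s := Ω))
  rw [ae_restrict_iff' (hΩ.measurableSet.diff h.measurableSet)] at hae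
  refine measure_mono_null (fun z hz => ?_) hae
  intro hz'
  have hz1 := Metric.mem_ball.1 hz.1
  have hzD := hz' ⟨hsΩ (Metric.mem_ball.2 (hz1.trans_le (min_le_right _ _))), hz.2⟩
  rw [dist_comm] at hz1
  exact absurd (hc z hzD) (not_le.2 (hz1.trans_le (min_le_left _ _)))

lemma frontier_subset_closure_diff_densityOne (h : IsEssential Ω A) :
    frontier A ⊆ closure (Ω \ densityOne Ω (Ω \ A)) := by
  intro x hx
  rw [Metric.mem_closure_iff]
  intro r hr
  have h0 := (h.boundary_essential x hx r hr).1
  by_contra! hc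
  refine h0 ?_
  have hAΩ : A ⊆ Ω := subset_closure.trans h.closure_subset
  have hae := ae_mem_densityOne h.measurableSet hAΩ
  rw [ae_restrict_iff' h.measurableSet] at hae
  refine measure_mono_null (fun z hz => ?_) hae
  intro hz'
  have hz1 := Metric.mem_ball.1 hz.2
  rw [dist_comm] at hz1
  exact absurd (hc z ⟨hAΩ hz.1, disjoint_left.1
    (disjoint_densityOne h.measurableSet disjoint_sdiff_right) (hz' hz.1)⟩) (not_le.2 hz1)

/-- A segment from x to a density point of Ω \ A must cross the boundary of A, so those points are
no closer than the boundary; conversely the boundary lies in their closure. The segment may leave Ω,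
since only its crossing point is used. -/
lemma sdist_of_mem_closure (h : IsEssential Ω A) (hΩ : IsOpen Ω) (hF : (frontier A).Nonempty)
    (hx : x ∈ closure A) : sdist Ω (Ω \ A) x = Metric.infDist x (frontier A) := by
  have hsub := h.frontier_subset_closure_densityOne hΩ
  have hxD : Metric.infDist x (Ω \ densityOne Ω (Ω \ A)) = 0 := by
    refine Metric.infDist_zero_of_mem_closure ?_
    by_cases hi : x ∈ interior A
    · exact subset_closure ⟨h.closure_subset hx, notMem_densityOne_of_mem_interior hi⟩
    · exact h.frontier_subset_closure_diff_densityOne ⟨hx, hi⟩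
  rw [sdist, hxD, sub_zero]
  refine le_antisymm ?_ ?_
  · rw [← Metric.infDist_closure (s := densityOne Ω (Ω \ A))]
    exact Metric.infDist_le_infDist_of_subset hsub hF
  · refine (Metric.le_infDist (closure_nonempty_iff.1 (hF.mono hsub))).2 fun {y} hy => ?_
    obtain ⟨z, hz, hzF⟩ := exists_mem_segment_frontier hx
      (fun hi => notMem_densityOne_of_mem_interior (Ω := Ω) hi hy)
    have h1 := dist_add_dist_of_mem_segment hz
    have h2 := dist_nonneg (x := z) (y := y)
    exact (Metric.infDist_le_dist_of_mem hzF).trans (by linarith)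

lemma sdist_of_notMem_interior (h : IsEssential Ω A) (hΩ : IsOpen Ω) (hF : (frontier A).Nonempty)
    (hxΩ : x ∈ Ω) (hx : x ∉ interior A) :
    sdist Ω (Ω \ A) x = -Metric.infDist x (frontier A) := by
  have hsub := h.frontier_subset_closure_diff_densityOne
  have hxD : Metric.infDist x (densityOne Ω (Ω \ A)) = 0 := by
    refine Metric.infDist_zero_of_mem_closure ?_
    by_cases hi : x ∈ closure A
    · exact h.frontier_subset_closure_densityOne hΩ ⟨hi, hx⟩
    · exact subset_closure (mem_densityOne_of_notMem_closure hΩ hxΩ hi)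
  rw [sdist, hxD, zero_sub, neg_inj]
  refine le_antisymm ?_ ?_
  · rw [← Metric.infDist_closure (s := Ω \ densityOne Ω (Ω \ A))]
    exact Metric.infDist_le_infDist_of_subset hsub hF
  · refine (Metric.le_infDist (closure_nonempty_iff.1 (hF.mono hsub))).2 fun {y} hy => ?_
    have hyA : y ∈ closure A := by
      by_contra hc
      exact hy.2 (mem_densityOne_of_notMem_closure hΩ hy.1 hc)
    obtain ⟨z, hz, hzF⟩ := exists_mem_segment_frontier hyA hx
    have h1 := dist_add_dist_of_mem_segment hz
    have h2 := dist_nonneg (x := y) (y := z)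
    rw [dist_comm x y]
    rw [dist_comm z x] at h1
    exact (Metric.infDist_le_dist_of_mem hzF).trans (by linarith)

lemma abs_sdist (h : IsEssential Ω A) (hΩ : IsOpen Ω) (hF : (frontier A).Nonempty) (hx : x ∈ Ω) :
    |sdist Ω (Ω \ A) x| = Metric.infDist x (frontier A) := by
  by_cases hi : x ∈ interior A
  · rw [h.sdist_of_mem_closure hΩ hF (interior_subset_closure hi),
      abs_of_nonneg Metric.infDist_nonneg]
  · rw [h.sdist_of_notMem_interior hΩ hF hx hi, abs_neg, abs_of_nonneg Metric.infDist_nonneg]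

lemma mem_interior_of_sdist_pos (h : IsEssential Ω A) (hΩ : IsOpen Ω) (hF : (frontier A).Nonempty)
    (hx : x ∈ Ω) (hpos : 0 < sdist Ω (Ω \ A) x) : x ∈ interior A := by
  by_contra hi
  rw [h.sdist_of_notMem_interior hΩ hF hx hi] at hpos
  linarith [Metric.infDist_nonneg (x := x) (s := frontier A)]

lemma sdist_eq_zero_iff (h : IsEssential Ω A) (hΩ : IsOpen Ω) (hF : (frontier A).Nonempty)
    (hx : x ∈ Ω) : sdist Ω (Ω \ A) x = 0 ↔ x ∈ frontier A := by
  rw [← abs_eq_zero, h.abs_sdist hΩ hF hx, isClosed_frontier.mem_iff_infDist_zero hF]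

/-- The distance to the boundary is 1-Lipschitz. For points on opposite sides the segment crosses
the boundary, so the two distances add up to at most the distance of the points. -/
lemma abs_sdist_sub_le (h : IsEssential Ω A) (hΩ : IsOpen Ω) (hF : (frontier A).Nonempty)
    (hx : x ∈ Ω) (hy : y ∈ Ω) :
    |sdist Ω (Ω \ A) x - sdist Ω (Ω \ A) y| ≤ dist x y := by
  have key : ∀ x ∈ Ω, ∀ y ∈ Ω, sdist Ω (Ω \ A) x - sdist Ω (Ω \ A) y ≤ dist x y := by
    intro x hx y hy
    have hxy := Metric.infDist_le_infDist_add_dist (s := frontier A) (x := x) (y := y)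
    have hyx := Metric.infDist_le_infDist_add_dist (s := frontier A) (x := y) (y := x)
    rw [dist_comm y x] at hyx
    have hx0 := Metric.infDist_nonneg (x := x) (s := frontier A)
    have hy0 := Metric.infDist_nonneg (x := y) (s := frontier A)
    by_cases hxi : x ∈ interior A
    · rw [h.sdist_of_mem_closure hΩ hF (interior_subset_closure hxi)]
      by_cases hyi : y ∈ interior A
      · rw [h.sdist_of_mem_closure hΩ hF (interior_subset_closure hyi)]
        linarith
      · rw [h.sdist_of_notMem_interior hΩ hF hy hyi]
        obtain ⟨z, hz, hzF⟩ := exists_mem_segment_frontier (interior_subset_closure hxi) hyi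
        have h1 := dist_add_dist_of_mem_segment hz
        have h2 := Metric.infDist_le_dist_of_mem (x := x) hzF
        have h3 := Metric.infDist_le_dist_of_mem (x := y) hzF
        rw [dist_comm y z] at h3
        linarith
    · rw [h.sdist_of_notMem_interior hΩ hF hx hxi]
      by_cases hyi : y ∈ interior A
      · rw [h.sdist_of_mem_closure hΩ hF (interior_subset_closure hyi)]
        linarith [dist_nonneg (x := x) (y := y)]
      · rw [h.sdist_of_notMem_interior hΩ hF hy hyi]
        linarith
  rw [abs_le]
  constructor
  · have := key y hy x hx
    rw [dist_comm] at this
    linarith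
  · exact key x hx y hy

/-- The eikonal equation away from the boundary. -/
lemma norm_gradient_sdist_of_notMem_frontier (h : IsEssential Ω A) (hΩ : IsOpen Ω)
    (hΩc : Convex ℝ Ω) (hF : (frontier A).Nonempty) (hx : x ∈ Ω) (hxF : x ∉ frontier A)
    (hd : DifferentiableAt ℝ (sdist Ω (Ω \ A)) x) : ‖gradient (sdist Ω (Ω \ A)) x‖ = 1 := by
  set d := sdist Ω (Ω \ A) with hd_def
  have hnorm : ‖gradient d x‖ = ‖fderiv ℝ d x‖ := by rw [gradient, LinearIsometryEquiv.norm_map]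
  rw [hnorm]
  refine le_antisymm ?_ ?_
  · refine norm_fderiv_le_of_lip' ℝ zero_le_one ?_
    filter_upwards [hΩ.mem_nhds hx] with y hy
    rw [Real.norm_eq_abs, one_mul, ← dist_eq_norm]
    exact h.abs_sdist_sub_le hΩ hF hy hx
  · obtain ⟨z, hzF, hz⟩ := h.isCompact_frontier.exists_infDist_eq_dist hF x
    rw [← h.abs_sdist hΩ hF hx, ← hd_def] at hz
    have hzΩ := h.frontier_subset hzF
    have hdz : d z = 0 := (h.sdist_eq_zero_iff hΩ hF hzΩ).2 hzF
    have hpos : 0 < dist x z := dist_pos.2 (fun hxz => hxF (hxz ▸ hzF))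
    -- The values d(x) and d(z) = 0 differ by exactly the distance of x and z, so the Lipschitz
    -- bounds from both ends force d to be affine on the segment. Convexity keeps the segment in Ω,
    -- where these bounds hold.
    have hline : ∀ t ∈ Icc (0 : ℝ) 1, d (x + t • (z - x)) = d x - t * d x := by
      intro t ht
      set y := x + t • (z - x) with hy_def
      have hyΩ : y ∈ Ω := hΩc.add_smul_sub_mem hx hzΩ ht
      have h1 := h.abs_sdist_sub_le hΩ hF hyΩ hx
      have h2 := h.abs_sdist_sub_le hΩ hF hyΩ hzΩ
      have e1 : dist y x = t * dist x z := by
        rw [dist_comm x z, dist_eq_norm, dist_eq_norm, hy_def, add_sub_cancel_left, norm_smul,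
          Real.norm_eq_abs, abs_of_nonneg ht.1]
      have e2 : dist y z = (1 - t) * dist x z := by
        have : y - z = (1 - t) • (x - z) := by rw [hy_def]; module
        rw [dist_eq_norm, dist_eq_norm, this, norm_smul, Real.norm_eq_abs,
          abs_of_nonneg (by linarith [ht.2])]
      rw [← hd_def] at h1 h2
      rw [e1, ← hz, abs_le] at h1
      rw [e2, hdz, sub_zero, ← hz, abs_le] at h2
      rcases abs_cases (d x) with ⟨h3, -⟩ | ⟨h3, -⟩ <;> rw [h3] at h1 h2 <;>
        linarith [h1.1, h1.2, h2.1, h2.2]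
    have hder : HasDerivAt (fun t : ℝ => d (x + t • (z - x))) (fderiv ℝ d x (z - x)) 0 := by
      have h1 : HasDerivAt (fun t : ℝ => x + t • (z - x)) (z - x) 0 := by
        simpa using ((hasDerivAt_id (0 : ℝ)).smul_const (z - x)).const_add x
      have h2 : HasFDerivAt d (fderiv ℝ d x) (x + (0 : ℝ) • (z - x)) := by
        simpa using hd.hasFDerivAt
      exact h2.comp_hasDerivAt 0 h1
    have hder2 : HasDerivWithinAt (fun t : ℝ => d (x + t • (z - x))) (-d x) (Icc 0 1) 0 := by
      have h1 : HasDerivWithinAt (fun t : ℝ => d x - t * d x) (-d x) (Icc 0 1) 0 := by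
        simpa using (((hasDerivAt_id (0 : ℝ)).mul_const (d x)).const_sub (d x)).hasDerivWithinAt
      exact h1.congr hline (hline 0 (left_mem_Icc.2 zero_le_one))
    have heq : fderiv ℝ d x (z - x) = -d x :=
      (uniqueDiffOn_Icc zero_lt_one 0 (left_mem_Icc.2 zero_le_one)).eq_deriv _
        hder.hasDerivWithinAt hder2
    have hle := (fderiv ℝ d x).le_opNorm (z - x)
    rw [heq, norm_neg, Real.norm_eq_abs, hz, ← dist_eq_norm, dist_comm z x] at hle
    exact le_of_mul_le_mul_right (by rwa [one_mul]) hpos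

/-- In the interior of the boundary d = 0, so ∇d = 0, and by continuity this persists on its
closure. Off the boundary |∇d| = 1, so all points near that closure belong to the boundary. The
interior is thus open and closed; being contained in a compact set, it is empty. -/
lemma interior_frontier_eq_empty [Nontrivial (EuclideanSpace ℝ (Fin N))] (h : IsEssential Ω A)
    (hΩ : IsOpen Ω) (hΩc : Convex ℝ Ω) {V : Set (EuclideanSpace ℝ (Fin N))} (hV : IsOpen V)
    (hVΩ : V ⊆ Ω) (hFV : frontier A ⊆ V)
    (hd : ∀ x ∈ V, DifferentiableAt ℝ (sdist Ω (Ω \ A)) x)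
    (hc : ContinuousOn (gradient (sdist Ω (Ω \ A))) V) : interior (frontier A) = ∅ := by
  rcases (frontier A).eq_empty_or_nonempty with hF | hF
  · rw [hF, interior_empty]
  set d := sdist Ω (Ω \ A) with hd_def
  have hzero : ∀ x ∈ interior (frontier A), gradient d x = 0 := by
    intro x hx
    have : d =ᶠ[𝓝 x] fun _ => (0 : ℝ) := by
      filter_upwards [isOpen_interior.mem_nhds hx] with y hy
      exact (h.sdist_eq_zero_iff hΩ hF (h.frontier_subset (interior_subset hy))).2
        (interior_subset hy)
    rw [this.gradient_eq, gradient_fun_const]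
  have hcl : IsClosed (interior (frontier A)) := by
    rw [← closure_subset_iff_isClosed]
    intro x hx
    have hxF : x ∈ frontier A := closure_minimal interior_subset isClosed_frontier hx
    have hcx : ContinuousAt (gradient d) x := hc.continuousAt (hV.mem_nhds (hFV hxF))
    have hx0 : gradient d x = 0 := by
      have hcl0 : IsClosed ({0} : Set (EuclideanSpace ℝ (Fin N))) := isClosed_singleton
      have := hcx.continuousWithinAt.mem_closure hx (t := {0}) hzero
      rwa [hcl0.closure_eq] at this
    have hlt : ∀ᶠ y in 𝓝 x, ‖gradient d y‖ < 1 := by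
      refine hcx.norm.eventually_lt_const ?_
      simp [hx0]
    rw [mem_interior_iff_mem_nhds]
    filter_upwards [hlt, hV.mem_nhds (hFV hxF)] with y hy hyV
    by_contra hyF
    exact hy.ne (h.norm_gradient_sdist_of_notMem_frontier hΩ hΩc hF (hVΩ hyV) hyF (hd y hyV))
  rcases isClopen_iff.1 ⟨hcl, isOpen_interior⟩ with h0 | h1
  · exact h0
  · exfalso
    have : IsCompact (univ : Set (EuclideanSpace ℝ (Fin N))) :=
      h.isCompact_frontier.of_isClosed_subset isClosed_univ (h1 ▸ interior_subset)
    exact noncompact_univ _ this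

/-- The eikonal equation in a neighbourhood of the boundary. -/
lemma norm_gradient_sdist [Nontrivial (EuclideanSpace ℝ (Fin N))] (h : IsEssential Ω A)
    (hΩ : IsOpen Ω) (hΩc : Convex ℝ Ω) (hF : (frontier A).Nonempty)
    {V : Set (EuclideanSpace ℝ (Fin N))} (hV : IsOpen V)
    (hVΩ : V ⊆ Ω) (hFV : frontier A ⊆ V)
    (hd : ∀ x ∈ V, DifferentiableAt ℝ (sdist Ω (Ω \ A)) x)
    (hc : ContinuousOn (gradient (sdist Ω (Ω \ A))) V) (hx : x ∈ V) :
    ‖gradient (sdist Ω (Ω \ A)) x‖ = 1 := by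
  have hcl : x ∈ closure (frontier A)ᶜ := by
    rw [closure_compl, h.interior_frontier_eq_empty hΩ hΩc hV hVΩ hFV hd hc, compl_empty]
    trivial
  have hcl' : x ∈ closure (V ∩ (frontier A)ᶜ) := hV.inter_closure ⟨hx, hcl⟩
  have hcx : ContinuousAt (fun y => ‖gradient (sdist Ω (Ω \ A)) y‖) x :=
    (hc.continuousAt (hV.mem_nhds hx)).norm
  have := hcx.continuousWithinAt.mem_closure hcl' (t := {1}) fun y hy =>
    h.norm_gradient_sdist_of_notMem_frontier hΩ hΩc hF (hVΩ hy.1) hy.2 (hd y hy.1)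
  rwa [isClosed_singleton.closure_eq] at this

end IsEssential

/-! ### Uniform constants, level shifts and the weighted Laplacian -/

lemma eventually_mul_le (X : ℝ) {Y : ℝ} (hY : 0 < Y) : ∀ᶠ ε in 𝓝[>] (0 : ℝ), ε * X ≤ Y := by
  have h : Tendsto (fun ε : ℝ => ε * X) (𝓝[>] 0) (𝓝 0) := by
    have : Tendsto (fun ε : ℝ => ε * X) (𝓝 0) (𝓝 (0 * X)) := tendsto_id.mul_const X
    rw [zero_mul] at this
    exact this.mono_left nhdsWithin_le_nhds
  exact (h.eventually_lt_const hY).mono fun _ h => h.le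

lemma exists_norm_le_of_isCompact {X F : Type*} [TopologicalSpace X] [NormedAddCommGroup F]
    {K : Set X} (hK : IsCompact K) {f : X → F} (hf : ContinuousOn f K) :
    ∃ C, 0 ≤ C ∧ ∀ p ∈ K, ‖f p‖ ≤ C := by
  obtain ⟨C, hC⟩ := hK.exists_bound_of_continuousOn hf
  exact ⟨max C 0, le_max_right _ _, fun p hp => (hC p hp).trans (le_max_left _ _)⟩

lemma exists_modulus_of_isCompact {X F : Type*} [PseudoMetricSpace X] [NormedAddCommGroup F]
    {K : Set X} (hK : IsCompact K) {f : X → F} (hf : ContinuousOn f K) {ω : ℝ} (hω : 0 < ω) :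
    ∃ h, 0 < h ∧ ∀ p ∈ K, ∀ q ∈ K, dist p q < h → ‖f p - f q‖ ≤ ω := by
  obtain ⟨h, hh, hf'⟩ := Metric.uniformContinuousOn_iff.1
    (hK.uniformContinuousOn_of_continuous hf) ω hω
  refine ⟨h, hh, fun p hp q hq hpq => ?_⟩
  rw [← dist_eq_norm]
  exact (hf' p hp q hq hpq).le

section

variable {N : ℕ} {Ω : Set (EuclideanSpace ℝ (Fin N))} {a L k : ℝ}
  {g u ρ : EuclideanSpace ℝ (Fin N) → ℝ} {x : EuclideanSpace ℝ (Fin N)}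

lemma gradient_sub_const (g : EuclideanSpace ℝ (Fin N) → ℝ) (k : ℝ) :
    gradient (fun x => g x - k) = gradient g := by
  ext x
  simp [gradient, fderiv_sub_const]

/-- The tube of half-width 5a about a level k with |k| ≤ 5a lies in the tube of half-width 10a about
level zero. This accommodates the barrier shift εc. -/
lemma IsTube.sub_const (h : IsTube Ω g (2 * a) L) (hk : |k| ≤ 5 * a) :
    IsTube Ω (fun x => g x - k) a L := by
  have ha : 0 < a := by linarith [h.pos]
  have hlt : ∀ x, |g x - k| < 5 * a → |g x| < 5 * (2 * a) := by
    intro x hx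
    rw [abs_lt] at hx ⊢
    rw [abs_le] at hk
    constructor <;> linarith [hx.1, hx.2]
  refine ⟨ha, fun x hx y hy => ?_, fun x hx hg => ?_, fun x hx hg => ?_, fun x hx hg => ?_,
    fun x hx hg => ?_, fun x hx hg => ?_⟩
  · rw [sub_sub_sub_cancel_right]
    exact h.lip x hx y hy
  · exact (Metric.ball_subset_ball (by linarith)).trans (h.ball_subset x hx (hlt x hg))
  · exact (h.differentiableAt x hx (hlt x hg)).sub_const k
  · rw [gradient_sub_const]
    exact h.norm_gradient x hx (hlt x hg)
  · rw [gradient_sub_const]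
    exact h.differentiableAt_gradient x hx (hlt x hg)
  · rw [gradient_sub_const]
    exact h.norm_hessian_le x hx (hlt x hg)

lemma weightedLaplacian_eq (hρ : DifferentiableAt ℝ ρ x)
    (hu : DifferentiableAt ℝ (gradient u) x) :
    weightedLaplacian ρ u x =
      1 / ρ x * (ρ x * divergence (gradient u) x + fderiv ℝ ρ x (gradient u x)) := by
  have h1 : fderiv ℝ (fun y => ρ y • gradient u y) x =
      ρ x • fderiv ℝ (gradient u) x + (fderiv ℝ ρ x).smulRight (gradient u x) :=
    (hρ.hasFDerivAt.smul hu.hasFDerivAt).fderiv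
  have h2 : ∑ i : Fin N, fderiv ℝ ρ x (EuclideanSpace.single i 1) * (gradient u x) i =
      fderiv ℝ ρ x (gradient u x) := by
    conv_rhs => rw [← (EuclideanSpace.basisFun (Fin N) ℝ).sum_repr (gradient u x)]
    rw [map_sum]
    refine Finset.sum_congr rfl fun i _ => ?_
    simp [mul_comm]
  rw [weightedLaplacian, divergence, h1]
  congr 1
  rw [← h2, divergence, Finset.mul_sum, ← Finset.sum_add_distrib]
  refine Finset.sum_congr rfl fun i _ => ?_
  simp

lemma weightedLaplacian_neg (ρ u : EuclideanSpace ℝ (Fin N) → ℝ) (x : EuclideanSpace ℝ (Fin N)) :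
    weightedLaplacian ρ (fun y => -u y) x = -weightedLaplacian ρ u x := by
  have h1 : (fun y => ρ y • gradient (fun y => -u y) y) = -fun y => ρ y • gradient u y := by
    have := gradient_neg u
    funext y
    rw [show (fun y => -u y) = -u from rfl, this]
    simp
  rw [weightedLaplacian, weightedLaplacian, h1, divergence, divergence, fderiv_neg]
  simp

end

/-! ### The barrier estimate, uniformly along a smooth evolution -/

/-- A family of functions `e(·, t)`, `t ∈ T`, which are `1`-Lipschitz with unit gradient near their
zero sets, and which is `C^{2,1}` on a compact neighbourhood of the zero sets. -/
structure FlowTube {N : ℕ} (Ω : Set (EuclideanSpace ℝ (Fin N))) (t₀ t₁ : ℝ) (T : Set ℝ)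
    (e : EuclideanSpace ℝ (Fin N) → ℝ → ℝ) (B K : Set (EuclideanSpace ℝ (Fin N) × ℝ))
    (r : ℝ) : Prop where
  pos : 0 < r
  subset_Icc : T ⊆ Icc t₀ t₁
  regular : IsC21On t₀ t₁ e B
  isCompact : IsCompact K
  subset : K ⊆ B
  fst_mem : ∀ p ∈ K, p.1 ∈ Ω
  mem : ∀ t ∈ T, ∀ s ∈ Icc t₀ t₁, |s - t| ≤ r → ∀ x ∈ Ω, |e x t| ≤ r → ∀ y, dist y x ≤ r →
    (y, s) ∈ K
  continuous : ∀ t, Continuous fun x => e x t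
  lip : ∀ t ∈ T, ∀ x ∈ Ω, ∀ y ∈ Ω, |e x t - e y t| ≤ dist x y
  norm_gradient : ∀ t ∈ T, ∀ x, (x, t) ∈ K → ‖gradient (fun y => e y t) x‖ = 1
  exists_zero : ∀ t ∈ T, ∃ p ∈ Ω, e p t = 0

lemma IsC21On.neg {N : ℕ} {t₀ t₁ : ℝ} {e : EuclideanSpace ℝ (Fin N) → ℝ → ℝ}
    {B : Set (EuclideanSpace ℝ (Fin N) × ℝ)} (h : IsC21On t₀ t₁ e B) :
    IsC21On t₀ t₁ (fun x t => -e x t) B := by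
  have hgrad : ∀ t, gradient (fun y => -e y t) = -gradient fun y => e y t :=
    fun t => gradient_neg fun y => e y t
  have hder : ∀ p : EuclideanSpace ℝ (Fin N) × ℝ,
      derivWithin (fun t => -e p.1 t) (Icc t₀ t₁) p.2 = -derivWithin (e p.1) (Icc t₀ t₁) p.2 :=
    fun p => derivWithin.fun_neg
  refine ⟨h.continuousOn.neg, fun p hp => (h.differentiable_time p hp).neg, ?_,
    fun p hp => (h.differentiable_space p hp).neg, ?_, fun p hp => ?_, ?_⟩
  · simp only [hder]
    exact h.continuousOn_time.neg
  · simp only [hgrad]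
    exact h.continuousOn_gradient.neg
  · rw [hgrad]
    exact (h.differentiable_gradient p hp).neg
  · simp only [hgrad, fderiv_neg]
    exact h.continuousOn_hessian.neg

namespace FlowTube

variable {N : ℕ} {Ω : Set (EuclideanSpace ℝ (Fin N))} {t₀ t₁ t ε a c δ r : ℝ} {T : Set ℝ}
  {e : EuclideanSpace ℝ (Fin N) → ℝ → ℝ} {B K : Set (EuclideanSpace ℝ (Fin N) × ℝ)}
  {ρ ρ₀ ρ₁ : EuclideanSpace ℝ (Fin N) → ℝ} {x : EuclideanSpace ℝ (Fin N)}

lemma neg (h : FlowTube Ω t₀ t₁ T e B K r) : FlowTube Ω t₀ t₁ T (fun x t => -e x t) B K r where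
  pos := h.pos
  subset_Icc := h.subset_Icc
  regular := h.regular.neg
  isCompact := h.isCompact
  subset := h.subset
  fst_mem := h.fst_mem
  mem t ht s hs hst x hx he := h.mem t ht s hs hst x hx (by rwa [abs_neg] at he)
  continuous t := (h.continuous t).neg
  lip t ht x hx y hy := by
    rw [neg_sub_neg, abs_sub_comm]
    exact h.lip t ht x hx y hy
  norm_gradient t ht x hx := by
    have : gradient (fun y => -e y t) = -gradient fun y => e y t := gradient_neg fun y => e y t
    rw [this, Pi.neg_apply, norm_neg]
    exact h.norm_gradient t ht x hx
  exists_zero t ht := by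
    obtain ⟨p, hp, he⟩ := h.exists_zero t ht
    exact ⟨p, hp, by rw [he, neg_zero]⟩

lemma mem_self (h : FlowTube Ω t₀ t₁ T e B K r) (ht : t ∈ T) (hx : x ∈ Ω) (he : |e x t| ≤ r) :
    (x, t) ∈ K :=
  h.mem t ht t (h.subset_Icc ht) (by simpa using h.pos.le) x hx he x (by simpa using h.pos.le)

lemma isTube (h : FlowTube Ω t₀ t₁ T e B K r) (ht : t ∈ T) {L : ℝ}
    (hL : ∀ p ∈ K, ‖fderiv ℝ (gradient fun y => e y p.2) p.1‖ ≤ L) (ha : 0 < a)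
    (har : 5 * a ≤ r) : IsTube Ω (fun x => e x t) a L := by
  have hmem : ∀ x ∈ Ω, |e x t| < 5 * a → (x, t) ∈ K := fun x hx he =>
    h.mem_self ht hx (he.le.trans har)
  refine ⟨ha, h.lip t ht, fun x hx he y hy => ?_,
    fun x hx he => h.regular.differentiable_space (x, t) (h.subset (hmem x hx he)),
    fun x hx he => h.norm_gradient t ht x (hmem x hx he),
    fun x hx he => h.regular.differentiable_gradient (x, t) (h.subset (hmem x hx he)),
    fun x hx he => hL (x, t) (hmem x hx he)⟩
  exact h.fst_mem (y, t) (h.mem t ht t (h.subset_Icc ht) (by simpa using h.pos.le) x hx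
    (he.le.trans har) y ((Metric.mem_ball.1 hy).le.trans (by linarith)))

/-- The mean value theorem in time. -/
lemma exists_time_derivative (h : FlowTube Ω t₀ t₁ T e B K r) (hε : 0 < ε) (hεr : ε ≤ r)
    (ht : t ∈ T) (ht' : t + ε ∈ T) (hx : x ∈ Ω) (he : |e x t| ≤ r ∨ |e x (t + ε)| ≤ r) :
    ∃ τ, t < τ ∧ τ < t + ε ∧ (x, τ) ∈ K ∧ (x, t + ε) ∈ K ∧
      e x (t + ε) - e x t = ε * derivWithin (e x) (Icc t₀ t₁) τ := by
  have hI := h.subset_Icc ht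
  have hI' := h.subset_Icc ht'
  have hmem : ∀ s ∈ Icc t (t + ε), (x, s) ∈ K := by
    intro s hs
    have hsI : s ∈ Icc t₀ t₁ := ⟨hI.1.trans hs.1, hs.2.trans hI'.2⟩
    rcases he with he | he
    · exact h.mem t ht s hsI (by rw [abs_le]; constructor <;> linarith [hs.1, hs.2]) x hx he x
        (by simpa using h.pos.le)
    · exact h.mem (t + ε) ht' s hsI (by rw [abs_le]; constructor <;> linarith [hs.1, hs.2]) x hx
        he x (by simpa using h.pos.le)
  obtain ⟨τ, hτ, hτe⟩ := exists_hasDerivAt_eq_slope (e x)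
    (fun τ => derivWithin (e x) (Icc t₀ t₁) τ) (show t < t + ε by linarith)
    (fun s hs => ((h.regular.differentiable_time _ (h.subset (hmem s hs))).mono
      (Icc_subset_Icc hI.1 hI'.2)).continuousWithinAt)
    (fun s hs => (h.regular.differentiable_time _
      (h.subset (hmem s ⟨hs.1.le, hs.2.le⟩))).hasDerivWithinAt.hasDerivAt
        (Icc_mem_nhds (hI.1.trans_lt hs.1) (hs.2.trans_le hI'.2)))
  refine ⟨τ, hτ.1, hτ.2, hmem τ ⟨hτ.1.le, hτ.2.le⟩, hmem _ (right_mem_Icc.2 (by linarith)), ?_⟩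
  rw [hτe, add_sub_cancel_left]
  field_simp

/-- Points far outside at time `t + ε` are far outside at time `t`. -/
lemma le_of_le (h : FlowTube Ω t₀ t₁ T e B K r) (hΩ : IsPreconnected Ω) (hε : 0 < ε)
    (hεr : ε ≤ r) (ht : t ∈ T) (ht' : t + ε ∈ T) {Λ : ℝ}
    (hΛ : ∀ p ∈ K, |derivWithin (e p.1) (Icc t₀ t₁) p.2| ≤ Λ) (ha : 0 < a) (har : 3 * a ≤ r)
    (hεΛ : ε * Λ ≤ a / 16) (hx : x ∈ Ω) (hex : e x (t + ε) ≤ -(23 / 16 * a)) :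
    e x t ≤ -(5 / 4 * a) := by
  have hclose : ∀ y ∈ Ω, |e y t| ≤ 3 * a ∨ |e y (t + ε)| ≤ 3 * a →
      |e y (t + ε) - e y t| ≤ a / 16 := by
    intro y hy hey
    obtain ⟨τ, -, -, hτK, -, hτ⟩ := h.exists_time_derivative hε hεr ht ht' hy
      (hey.imp (fun h => h.trans har) fun h => h.trans har)
    rw [hτ, abs_mul, abs_of_pos hε]
    exact (mul_le_mul_of_nonneg_left (hΛ _ hτK) hε.le).trans hεΛ
  by_cases hnear : |e x t| ≤ 3 * a ∨ |e x (t + ε)| ≤ 3 * a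
  · linarith [neg_le_of_abs_le (hclose x hx hnear)]
  · push Not at hnear
    by_contra hc
    have h1 : 3 * a < e x t := by
      rcases lt_abs.1 hnear.1 with h1 | h1
      · exact h1
      · linarith
    have h2 : 3 * a < -e x (t + ε) := by
      rcases lt_abs.1 hnear.2 with h2 | h2
      · linarith
      · exact h2
    obtain ⟨p, hp, hep⟩ := h.exists_zero _ ht'
    -- The remaining danger is a point far inside at time t and far outside at time t + ε. The
    -- minimum is at most 0 at a zero of e(·, t + ε) and above 3a at x, so on the connected set Ω it
    -- takes the value 2a. There one of the two distances is small, yet they differ by at least 4a,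
    -- against the bound on the time derivative.
    have hcont : ContinuousOn (fun y => min (e y t) (-e y (t + ε))) Ω :=
      ((h.continuous t).min (h.continuous (t + ε)).neg).continuousOn
    obtain ⟨y, hy, hey⟩ := hΩ.intermediate_value hp hx hcont (show 2 * a ∈ Icc _ _ from
      ⟨(min_le_right _ _).trans (by rw [hep]; linarith),
        le_min (by linarith) (by linarith)⟩)
    have hey1 : 2 * a ≤ e y t := hey ▸ min_le_left _ _
    have hey2 : 2 * a ≤ -e y (t + ε) := hey ▸ min_le_right _ _
    have hnear' : |e y t| ≤ 3 * a ∨ |e y (t + ε)| ≤ 3 * a := by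
      rcases min_choice (e y t) (-e y (t + ε)) with hm | hm <;> simp only [hm] at hey
      · left
        rw [hey, abs_of_pos (by linarith)]
        linarith
      · right
        rw [← abs_neg, hey, abs_of_pos (by linarith)]
        linarith
    linarith [neg_le_of_abs_le (hclose y hy hnear')]

end FlowTube

namespace FlowTube

variable {N : ℕ} {Ω : Set (EuclideanSpace ℝ (Fin N))} {t₀ t₁ t ε a c δ r k L ω : ℝ} {T : Set ℝ}
  {e : EuclideanSpace ℝ (Fin N) → ℝ → ℝ} {B K : Set (EuclideanSpace ℝ (Fin N) × ℝ)}
  {ρ ρ₀ ρ₁ : EuclideanSpace ℝ (Fin N) → ℝ} {x : EuclideanSpace ℝ (Fin N)}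

lemma mem_of_abs_sub_lt (h : FlowTube Ω t₀ t₁ T e B K r) (ht : t ∈ T) (hk : |k| ≤ 5 * a)
    (har : 10 * a ≤ r) (hx : x ∈ Ω) (hg : |e x t - k| < 5 * a) : (x, t) ∈ K := by
  refine h.mem_self ht hx ?_
  have : |e x t| ≤ |e x t - k| + |k| := by
    calc |e x t| = |(e x t - k) + k| := by rw [sub_add_cancel]
      _ ≤ _ := abs_add_le _ _
  linarith

lemma norm_gradShift_sub_le (h : FlowTube Ω t₀ t₁ T e B K r) (ht : t ∈ T)
    (hg : IsTube Ω (fun x => e x t - k) a L) (hk : |k| ≤ 5 * a) (har : 10 * a ≤ r)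
    {F : Type*} [NormedAddCommGroup F] {Φ : EuclideanSpace ℝ (Fin N) × ℝ → F} {η : ℝ}
    (hΦ : ∀ p ∈ K, ∀ q ∈ K, dist p q < η → ‖Φ p - Φ q‖ ≤ ω) (hεη : ε ≤ η) (hεa : ε ≤ a)
    (hx : x ∈ Ω) (hgx : |e x t - k| < 4 * a) {s : ℝ} (hs : 0 ≤ s) (hsε : s < ε) :
    ‖Φ (gradShift (fun x => e x t - k) s x, t) - Φ (x, t)‖ ≤ ω := by
  have ha := hg.pos
  have hd := hg.dist_gradShift (s := s) hx hgx
  rw [abs_of_nonneg hs] at hd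
  have hsa : s < a := hsε.trans_le hεa
  have hy := hg.gradShift_mem hx hgx (s := s) (by rwa [abs_of_nonneg hs])
  have hy5 : |e (gradShift (fun x => e x t - k) s x) t - k| < 5 * a :=
    (hg.mem_of_dist_lt hx hgx (by rwa [hd])).2
  refine hΦ _ (h.mem_of_abs_sub_lt ht hk har hy hy5) _
    (h.mem_of_abs_sub_lt ht hk har hx (by linarith)) ?_
  rw [Prod.dist_eq, dist_self, hd]
  exact max_lt (hsε.trans_le hεη) (by linarith)

lemma tubeDensity (h : FlowTube Ω t₀ t₁ T e B K r) (ht : t ∈ T)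
    (hg : IsTube Ω (fun x => e x t - k) a L) (hk : |k| ≤ 5 * a) (har : 10 * a ≤ r)
    {C C' η : ℝ} (hρ : BoundedDensity Ω ρ C) (hd : ∀ x ∈ Ω, DifferentiableAt ℝ ρ x)
    (hC' : ∀ p ∈ K, ‖fderiv ℝ ρ p.1‖ ≤ C')
    (hmod : ∀ p ∈ K, ∀ q ∈ K, dist p q < η → ‖fderiv ℝ ρ p.1 - fderiv ℝ ρ q.1‖ ≤ ω)
    (hεη : ε ≤ η) (hεa : ε ≤ a) : TubeDensity Ω (fun x => e x t - k) a ε ρ C C' ω where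
  bounded := hρ
  differentiableAt x hx _ := hd x hx
  norm_fderiv_le x hx hgx := hC' (x, t) (h.mem_of_abs_sub_lt ht hk har hx hgx)
  modulus _ hx hgx _ hs hsε :=
    h.norm_gradShift_sub_le ht hg hk har (Φ := fun p => fderiv ℝ ρ p.1) hmod hεη hεa hx hgx hs hsε

lemma continuousOn_divergence (h : FlowTube Ω t₀ t₁ T e B K r) :
    ContinuousOn (fun p : EuclideanSpace ℝ (Fin N) × ℝ =>
      divergence (gradient fun y => e y p.2) p.1) K := by
  unfold divergence
  refine continuousOn_finsetSum _ fun i _ => ?_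
  exact (EuclideanSpace.proj (𝕜 := ℝ) i).continuous.comp_continuousOn
    ((h.regular.continuousOn_hessian.mono h.subset).clm_apply continuousOn_const)

/-- A strict subsolution of the weighted mean curvature flow equation lies above the minimizers of
the scheme. -/
theorem eventually_min_le_clampFun (h : FlowTube Ω t₀ t₁ T e B K r) (hΩ : IsOpen Ω)
    (hΩb : Bornology.IsBounded Ω) (hΩc : IsPreconnected Ω) (hρ : AdmissibleDensities Ω ρ₀ ρ₁)
    (hδ : 0 < δ)
    (hflow : ∀ p ∈ K, weightedLaplacian (fun x => ρ₀ x + ρ₁ x) (fun y => e y p.2) p.1 + δ ≤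
      derivWithin (e p.1) (Icc t₀ t₁) p.2) :
    ∃ a, 0 < a ∧ ∃ c, 0 < c ∧ ∀ᶠ ε in 𝓝[>] (0 : ℝ), ∀ t ∈ T, t + ε ∈ T →
      energy Ω ρ₀ ρ₁ ε (fun x => e x t) 0 ≠ ⊤ → ∀ w, IsMinimizer Ω ρ₀ ρ₁ ε (fun x => e x t) w →
        ∀ᵐ x ∂volume.restrict Ω, min (w x) a ≤ clampFun (fun x => e x (t + ε) - ε * c) a x := by
  obtain ⟨b, hb0, hb⟩ := hρ.bounds
  have hd₀ : ∀ x ∈ Ω, DifferentiableAt ℝ ρ₀ x := fun x hx =>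
    (hρ.contDiffOn_zero.differentiableOn one_ne_zero).differentiableAt (hΩ.mem_nhds hx)
  have hd₁ : ∀ x ∈ Ω, DifferentiableAt ℝ ρ₁ x := fun x hx =>
    (hρ.contDiffOn_one.differentiableOn one_ne_zero).differentiableAt (hΩ.mem_nhds hx)
  have hmaps : MapsTo (Prod.fst : EuclideanSpace ℝ (Fin N) × ℝ → _) K Ω := fun p hp =>
    h.fst_mem p hp
  have hc₀ : ContinuousOn (fun p : EuclideanSpace ℝ (Fin N) × ℝ => fderiv ℝ ρ₀ p.1) K :=
    (hρ.contDiffOn_zero.continuousOn_fderiv_of_isOpen hΩ le_rfl).comp continuousOn_fst hmaps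
  have hc₁ : ContinuousOn (fun p : EuclideanSpace ℝ (Fin N) × ℝ => fderiv ℝ ρ₁ p.1) K :=
    (hρ.contDiffOn_one.continuousOn_fderiv_of_isOpen hΩ le_rfl).comp continuousOn_fst hmaps
  obtain ⟨L, hL0, hL⟩ := exists_norm_le_of_isCompact h.isCompact
    (h.regular.continuousOn_hessian.mono h.subset)
  obtain ⟨Λ, hΛ0, hΛ⟩ := exists_norm_le_of_isCompact h.isCompact
    (h.regular.continuousOn_time.mono h.subset)
  obtain ⟨M, hM0, hM⟩ := exists_norm_le_of_isCompact h.isCompact h.continuousOn_divergence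
  obtain ⟨C₀, hC₀0, hC₀⟩ := exists_norm_le_of_isCompact h.isCompact hc₀
  obtain ⟨C₁, hC₁0, hC₁⟩ := exists_norm_le_of_isCompact h.isCompact hc₁
  set C' := max C₀ C₁ with hC'
  have hC'0 : 0 ≤ C' := le_max_of_le_left hC₀0
  set C := b⁻¹ with hC
  have hC0 : 0 < C := inv_pos.2 hb0
  -- The margin δ is divided: δ/4 for the oscillation of the time derivative, δ/4 for the barrier
  -- shift c, and the remaining δ/2, multiplied by ρ ≥ b, covers the two errors η of ρ₀ and ρ₁.
  set η := b * δ / 4 with hη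
  have hη0 : 0 < η := by positivity
  set ω := η / (2 * (2 + C)) with hω
  have hω0 : 0 < ω := by positivity
  have hωη : (2 + C) * ω ≤ η / 2 := by
    rw [hω]
    refine le_of_eq ?_
    field_simp
  obtain ⟨h₁, hh₁, hm₁⟩ := exists_modulus_of_isCompact h.isCompact
    (h.regular.continuousOn_time.mono h.subset) (show 0 < δ / 4 by positivity)
  obtain ⟨h₂, hh₂, hm₂⟩ := exists_modulus_of_isCompact h.isCompact h.continuousOn_divergence hω0
  obtain ⟨h₃, hh₃, hm₃⟩ := exists_modulus_of_isCompact h.isCompact hc₀ hω0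
  obtain ⟨h₄, hh₄, hm₄⟩ := exists_modulus_of_isCompact h.isCompact hc₁ hω0
  have hr := h.pos
  -- The unshifted tube has parameter 2a and hence half-width 10a = r; the level shift halves the
  -- parameter.
  set a := r / 10 with ha_def
  have ha : 0 < a := by positivity
  have har : 10 * a ≤ r := by rw [ha_def]; linarith
  set c := δ / 4 with hc_def
  have hc : 0 < c := by positivity
  set K₀ := 2 * (C' + C / a + (M + M ^ 2) * C) with hK₀
  have hK₀0 : 0 ≤ K₀ := by positivity
  have hbd₀ : BoundedDensity Ω ρ₀ C := ⟨hρ.aemeasurable_zero hΩ, hρ.nonneg_zero, fun x hx => by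
    linarith [(hb x hx).2, hρ.nonneg_one x hx]⟩
  have hbd₁ : BoundedDensity Ω ρ₁ C := ⟨hρ.aemeasurable_one hΩ, hρ.nonneg_one, fun x hx => by
    linarith [(hb x hx).2, hρ.nonneg_zero x hx]⟩
  refine ⟨a, ha, c, hc, ?_⟩
  filter_upwards [self_mem_nhdsWithin, eventually_mul_le 1 one_pos,
    eventually_mul_le 4 ha, eventually_mul_le L one_pos,
    eventually_mul_le M (show (0 : ℝ) < 1 / 2 by norm_num),
    eventually_mul_le (2 * M * (C' + C * ω + η)) (half_pos hη0),
    eventually_mul_le (M * (C' + ω) + M ^ 2 * C) (half_pos hη0),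
    eventually_mul_le 2 hh₁, eventually_mul_le 1 hh₂, eventually_mul_le 1 hh₃,
    eventually_mul_le 1 hh₄, eventually_mul_le c (show 0 < a / 16 by positivity),
    eventually_mul_le Λ (show 0 < a / 16 by positivity),
    eventually_mul_le (8 * K₀) (show 0 < b * a by positivity)]
    with ε hε hε1 hε2 hεL hεM hεη₀ hεη₁ hεh₁ hεh₂ hεh₃ hεh₄ hεc hεΛ hεK t ht ht' hfin w hw
  replace hε : 0 < ε := hε
  rw [mul_one] at hε1 hεh₂ hεh₃ hεh₄
  have hεa : 2 * ε < a := by linarith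
  have hεr : ε ≤ r := by linarith
  have hk : |ε * c| ≤ 5 * a := by
    rw [abs_of_pos (mul_pos hε hc)]
    linarith
  have hcont := h.continuous (t + ε)
  have htube : IsTube Ω (fun x => e x (t + ε) - ε * c) a L :=
    (h.isTube ht' hL (a := 2 * a) (by linarith) (by linarith)).sub_const hk
  have hgrad := gradient_sub_const (fun x => e x (t + ε)) (ε * c)
  have hMg : ∀ x ∈ Ω, |e x (t + ε) - ε * c| < 5 * a →
      |divergence (gradient fun x => e x (t + ε) - ε * c) x| ≤ M := by
    intro x hx hgx
    rw [hgrad]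
    exact hM (x, t + ε) (h.mem_of_abs_sub_lt ht' hk har hx hgx)
  have htd₀ := h.tubeDensity (ε := ε) ht' htube hk har hbd₀ hd₀
    (fun p hp => (hC₀ p hp).trans (le_max_left C₀ C₁)) hm₃ hεh₃ (by linarith)
  have htd₁ := h.tubeDensity (ε := ε) ht' htube hk har hbd₁ hd₁
    (fun p hp => (hC₁ p hp).trans (le_max_right C₀ C₁)) hm₄ hεh₄ (by linarith)
  have hT := htube.transportBounds (K := K₀) htd₀ htd₁ hε1 hεa hεM hM0 hC0.le hC'0 hω0.le hη0.le
    hMg (fun x hx hgx s hs hsε => by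
      have := h.norm_gradShift_sub_le ht' htube hk har hm₂ hεh₂ (by linarith) hx hgx hs hsε
      rw [hgrad]
      exact this) hωη hεη₀ hεη₁ rfl
  have hf : MemLp (fun x => e x t) 2 (volume.restrict Ω) := by
    have : IsFiniteMeasure (volume.restrict Ω) :=
      ⟨by rw [Measure.restrict_apply_univ]; exact hΩb.measure_lt_top⟩
    obtain ⟨R, hR⟩ := hΩb.isCompact_closure.exists_bound_of_continuousOn
      (h.continuous t).continuousOn
    exact MemLp.of_bound (h.continuous t).aestronglyMeasurable R
      ((ae_restrict_mem hΩ.measurableSet).mono fun x hx => hR x (subset_closure hx))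
  refine htube.min_le_clampFun hΩ.measurableSet hΩb.measure_lt_top.ne
    (hcont.measurable.sub_const _) hε (by linarith) hεL hbd₀ hbd₁ hb0 (fun x hx => (hb x hx).1.le)
    (aemeasurable_errFun (hcont.measurable.sub_const _) hbd₀.aemeasurable)
    (aemeasurable_errFun (hcont.measurable.sub_const _) hbd₁.aemeasurable)
    (fun x hx => htube.abs_errFun_le htd₀ hMg hη0.le hx)
    (fun x hx => htube.abs_errFun_le htd₁ hMg hη0.le hx) hT hf hfin ?_ hw
  intro x hx hgx
  have hbx := (hb x hx).1
  have hρpos : 0 < ρ₀ x + ρ₁ x := hb0.trans hbx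
  rw [le_div_iff₀ hε]
  by_cases hcore : -(3 / 2 * a) ≤ e x (t + ε) - ε * c
  · rw [errFun, errFun, if_pos ⟨hcore, hgx⟩, if_pos ⟨hcore, hgx⟩, hgrad]
    have hεc0 : 0 < ε * c := mul_pos hε hc
    have hex : |e x (t + ε)| ≤ r := by
      rw [abs_le]
      constructor <;> linarith
    obtain ⟨τ, hτ1, hτ2, hτK, hK, hτ⟩ := h.exists_time_derivative hε hεr ht ht' hx (Or.inr hex)
    have hmod := hm₁ _ hτK _ hK (by
      rw [Prod.dist_eq, dist_self, Real.dist_eq]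
      refine max_lt hh₁ ?_
      rw [abs_lt]
      constructor <;> linarith)
    rw [Real.norm_eq_abs] at hmod
    have hwl := hflow _ hK
    have hgd := h.regular.differentiable_gradient _ (h.subset hK)
    dsimp only at hwl hmod hgd
    rw [weightedLaplacian_eq (ρ := fun x => ρ₀ x + ρ₁ x) ((hd₀ x hx).add (hd₁ x hx)) hgd] at hwl
    have hfd : fderiv ℝ (fun x => ρ₀ x + ρ₁ x) x = fderiv ℝ ρ₀ x + fderiv ℝ ρ₁ x :=
      fderiv_fun_add (hd₀ x hx) (hd₁ x hx)
    rw [hfd, add_apply] at hwl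
    set m := divergence (gradient fun y => e y (t + ε)) x
    set q₀ := fderiv ℝ ρ₀ x (gradient (fun y => e y (t + ε)) x)
    set q₁ := fderiv ℝ ρ₁ x (gradient (fun y => e y (t + ε)) x)
    have hclamp : e x (t + ε) - ε * c ≤ clampFun (fun x => e x (t + ε) - ε * c) a x := by
      rw [clampFun]
      exact le_max_of_le_right (le_min hgx.le le_rfl)
    -- The subflow inequality holds at time t + ε, while the difference quotient equals the time
    -- derivative at τ; the modulus of continuity compares the two.
    have h1 : (ρ₀ x + ρ₁ x) * (1 / (ρ₀ x + ρ₁ x) * ((ρ₀ x + ρ₁ x) * m + (q₀ + q₁)) + δ / 2) ≤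
        (ρ₀ x + ρ₁ x) * (derivWithin (e x) (Icc t₀ t₁) τ - c) :=
      mul_le_mul_of_nonneg_left (by linarith [neg_le_of_abs_le hmod]) hρpos.le
    have h2 : (ρ₀ x + ρ₁ x) * (1 / (ρ₀ x + ρ₁ x) * ((ρ₀ x + ρ₁ x) * m + (q₀ + q₁)) + δ / 2) =
        (ρ₀ x + ρ₁ x) * m + (q₀ + q₁) + (ρ₀ x + ρ₁ x) * (δ / 2) := by
      field_simp
    have h3 : b * (δ / 2) ≤ (ρ₀ x + ρ₁ x) * (δ / 2) :=
      mul_le_mul_of_nonneg_right hbx.le (by positivity)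
    have h4 := mul_le_mul_of_nonneg_right
      (show ρ₀ x * m + q₀ + η + (ρ₁ x * m + q₁ + η) ≤
        (ρ₀ x + ρ₁ x) * (derivWithin (e x) (Icc t₀ t₁) τ - c) by linarith) hε.le
    refine h4.trans ?_
    rw [mul_assoc]
    refine mul_le_mul_of_nonneg_left ?_ hρpos.le
    linarith
  · rw [errFun, errFun, if_neg (fun hc' => hcore hc'.1), if_neg (fun hc' => hcore hc'.1)]
    -- Outside the core d(x, t) ≤ -5a/4 and the barrier is at least -a, which leaves a gap a/4.
    -- Dividing by ε dominates the constant 2K₀, by the choice of ε with 8K₀ε ≤ ba.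
    have hfar := h.le_of_le hΩc hε hεr ht ht' hΛ ha (by linarith) hεΛ hx (by linarith)
    have hcl := neg_le_clampFun (g := fun x => e x (t + ε) - ε * c) (a := a) (x := x)
    have h1 : b * (a / 4) ≤ (ρ₀ x + ρ₁ x) *
        (clampFun (fun x => e x (t + ε) - ε * c) a x - e x t) :=
      mul_le_mul hbx.le (by linarith) (by positivity) hρpos.le
    linarith

end FlowTube

/-! ### From the barrier estimate to sub- and superflows -/

section Evolution

variable {N : ℕ} {Ω : Set (EuclideanSpace ℝ (Fin N))} {t₀ t₁ t ε : ℝ}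
  {A : ℝ → Set (EuclideanSpace ℝ (Fin N))} {B : Set (EuclideanSpace ℝ (Fin N) × ℝ)}
  {ρ₀ ρ₁ : EuclideanSpace ℝ (Fin N) → ℝ} {x : EuclideanSpace ℝ (Fin N)}

/-- A consequence of the default value 0 of `infDist` at the empty set. It makes the empty set
detectable through the vanishing gradient of its signed distance. -/
lemma sdist_diff_empty (hΩ : IsOpen Ω) (hx : x ∈ Ω) : sdist Ω (Ω \ ∅) x = 0 := by
  have hD : densityOne Ω (Ω \ ∅) = Ω := by
    refine densityOne_subset.antisymm fun y hy => ?_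
    exact IsEssential.mem_densityOne_of_notMem_closure hΩ hy (by simp)
  rw [sdist, hD, sdiff_self, Metric.infDist_zero_of_mem hx]
  simp

namespace IsSmoothEvolution

lemma isEssential (h : IsSmoothEvolution Ω t₀ t₁ A B) (ht : t ∈ Icc t₀ t₁) :
    IsEssential Ω (A t) :=
  ⟨h.measurableSet t ht, h.isCompact_closure t ht, h.closure_subset t ht,
    h.boundary_essential t ht⟩

lemma norm_gradient_flowDist [Nontrivial (EuclideanSpace ℝ (Fin N))]
    (h : IsSmoothEvolution Ω t₀ t₁ A B) (hΩ : IsOpen Ω) (hΩc : Convex ℝ Ω)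
    (hA : (A t).Nonempty) (hx : (x, t) ∈ B) :
    ‖gradient (fun y => flowDist Ω A y t) x‖ = 1 := by
  obtain ⟨U, hU, hB⟩ := h.relatively_open
  have ht : t ∈ Icc t₀ t₁ := by
    rw [hB] at hx
    exact hx.2.2
  have hE := h.isEssential ht
  set V := {y | (y, t) ∈ U} ∩ Ω with hV_def
  have hVB : ∀ y ∈ V, (y, t) ∈ B := fun y hy => by
    rw [hB]
    exact ⟨hy.1, hy.2, ht⟩
  have hBV : ∀ y, (y, t) ∈ B → y ∈ V := fun y hy => by
    rw [hB] at hy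
    exact ⟨hy.1, hy.2.1⟩
  have hV : IsOpen V := (hU.preimage (Continuous.prodMk_left t)).inter hΩ
  have hd : ∀ y ∈ V, DifferentiableAt ℝ (fun y => flowDist Ω A y t) y := fun y hy =>
    h.regular.differentiable_space (y, t) (hVB y hy)
  have hc : ContinuousOn (gradient fun y => flowDist Ω A y t) V := by
    have hmaps : MapsTo (fun y => (y, t)) V B := hVB
    have := h.regular.continuousOn_gradient.comp (Continuous.prodMk_left t).continuousOn hmaps
    exact this
  have hFV : frontier (A t) ⊆ V := fun y hy => by
    have hmem : ((y, t) : EuclideanSpace ℝ (Fin N) × ℝ) ∈ spaceTimeBoundary t₀ t₁ A := ⟨ht, hy⟩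
    exact hBV y (h.boundary_subset hmem)
  exact hE.norm_gradient_sdist hΩ hΩc (hE.frontier_nonempty hA) hV inter_subset_right hFV hd hc
    (hBV x hx)

/-- Compactness of the space-time boundary gives a closed thickening inside the regularity
neighbourhood, with one radius for all times. Times with empty A(t) are left out, because d is then
not a distance to a boundary. -/
lemma exists_flowTube [Nontrivial (EuclideanSpace ℝ (Fin N))]
    (h : IsSmoothEvolution Ω t₀ t₁ A B) (hΩ : IsOpen Ω) (hΩc : Convex ℝ Ω) :
    ∃ K r, FlowTube Ω t₀ t₁ {t ∈ Icc t₀ t₁ | (A t).Nonempty} (flowDist Ω A) B K r := by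
  obtain ⟨U, hU, hB⟩ := h.relatively_open
  have hO : IsOpen (U ∩ Prod.fst ⁻¹' Ω) := hU.inter (hΩ.preimage continuous_fst)
  have hΓ : spaceTimeBoundary t₀ t₁ A ⊆ U ∩ Prod.fst ⁻¹' Ω := by
    refine h.boundary_subset.trans ?_
    rw [hB]
    exact fun p hp => ⟨hp.1, hp.2.1⟩
  obtain ⟨δ, hδ, hsub⟩ := h.isCompact_boundary.exists_cthickening_subset_open hO hΓ
  have hKB : Metric.cthickening δ (spaceTimeBoundary t₀ t₁ A) ∩ Prod.snd ⁻¹' Icc t₀ t₁ ⊆ B := by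
    intro p hp
    rw [hB]
    exact ⟨(hsub hp.1).1, (hsub hp.1).2, hp.2⟩
  refine ⟨_, δ / 2, half_pos hδ, fun t ht => ht.1, h.regular,
    h.isCompact_boundary.cthickening.inter_right (isClosed_Icc.preimage continuous_snd), hKB,
    fun p hp => (hsub hp.1).2, ?_, fun t => continuous_sdist Ω (Ω \ A t), ?_,
    fun t ht x hx => h.norm_gradient_flowDist hΩ hΩc ht.2 (hKB hx), ?_⟩
  · intro t ht s hs hst x hx hd y hy
    have hE := h.isEssential ht.1
    have hF := hE.frontier_nonempty ht.2
    obtain ⟨z, hz, hxz⟩ := hE.isCompact_frontier.exists_infDist_eq_dist hF x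
    rw [flowDist, hE.abs_sdist hΩ hF hx, hxz] at hd
    refine ⟨Metric.mem_cthickening_of_dist_le (y, s) (z, t) _ _ ⟨ht.1, hz⟩ ?_, hs⟩
    rw [Prod.dist_eq]
    refine max_le ?_ ?_
    · linarith [dist_triangle y x z]
    · dsimp only
      rw [Real.dist_eq]
      linarith
  · intro t ht x hx y hy
    have hE := h.isEssential ht.1
    exact hE.abs_sdist_sub_le hΩ (hE.frontier_nonempty ht.2) hx hy
  · intro t ht
    have hE := h.isEssential ht.1
    have hF := hE.frontier_nonempty ht.2
    obtain ⟨z, hz⟩ := hF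
    exact ⟨z, hE.frontier_subset hz,
      (hE.sdist_eq_zero_iff hΩ ⟨z, hz⟩ (hE.frontier_subset hz)).2 hz⟩

/-- Nonempty sets neither appear nor vanish suddenly. -/
lemma exists_nonempty_of_nonempty [Nontrivial (EuclideanSpace ℝ (Fin N))]
    (h : IsSmoothEvolution Ω t₀ t₁ A B) (hΩ : IsOpen Ω) (hΩc : Convex ℝ Ω) :
    ∃ η, 0 < η ∧ ∀ t ∈ Icc t₀ t₁, ∀ s ∈ Icc t₀ t₁, |s - t| < η → (A t).Nonempty →
      (A s).Nonempty := by
  obtain ⟨K, r, hK⟩ := h.exists_flowTube hΩ hΩc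
  obtain ⟨η, hη, hmod⟩ := exists_modulus_of_isCompact hK.isCompact
    (hK.regular.continuousOn_gradient.mono hK.subset) (show (0 : ℝ) < 1 / 2 by norm_num)
  refine ⟨min η r, lt_min hη hK.pos, fun t ht s hs hst hA => ?_⟩
  by_contra hAs
  rw [not_nonempty_iff_eq_empty] at hAs
  obtain ⟨z, hz, hz0⟩ := hK.exists_zero t ⟨ht, hA⟩
  have hdz : |flowDist Ω A z t| ≤ r := by
    rw [hz0, abs_zero]
    exact hK.pos.le
  have hzs : (z, s) ∈ K := hK.mem t ⟨ht, hA⟩ s hs (hst.le.trans (min_le_right _ _)) z hz hdz z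
    (by simpa using hK.pos.le)
  have hzt : (z, t) ∈ K := hK.mem_self ⟨ht, hA⟩ hz hdz
  have h1 := hmod _ hzs _ hzt (by
    rw [Prod.dist_eq, dist_self, Real.dist_eq]
    exact max_lt hη (hst.trans_le (min_le_left _ _)))
  -- If A(s) were empty, d(·, s) would vanish in Ω, whereas |∇d(z, t)| = 1 at the nearby time t,
  -- against the uniform continuity of ∇d on K.
  have h2 : gradient (fun y => flowDist Ω A y s) z = 0 := by
    have : (fun y => flowDist Ω A y s) =ᶠ[𝓝 z] fun _ => (0 : ℝ) := by
      filter_upwards [hΩ.mem_nhds hz] with y hy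
      rw [flowDist, hAs, sdist_diff_empty hΩ hy]
    rw [this.gradient_eq, gradient_fun_const]
  dsimp only at h1
  rw [h2, zero_sub, norm_neg, h.norm_gradient_flowDist hΩ hΩc hA (hK.subset hzt)] at h1
  norm_num at h1

end IsSmoothEvolution

lemma exists_pos_forall_of_eventually {P : ℝ → Prop} (h : ∀ᶠ ε in 𝓝[>] (0 : ℝ), P ε) :
    ∃ ε₀, 0 < ε₀ ∧ ∀ ε, 0 < ε → ε < ε₀ → P ε := by
  obtain ⟨ε₀, hε₀, hP⟩ := mem_nhdsGT_iff_exists_Ioo_subset.1 h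
  exact ⟨ε₀, hε₀, fun ε h1 h2 => hP ⟨h1, h2⟩⟩

variable [Nontrivial (EuclideanSpace ℝ (Fin N))]

/-- A point with d(x, t + ε) < εc has a ball on which the barrier is negative, hence w ≤ 0 a.e., so
it is not a density point of {w > 0}. The positive margin εc puts the remaining points in the
interior of A(t + ε), so it does not matter which boundary points belong to that set. -/
lemma oneStep_subset_of_isSubflow (hΩ : IsOpen Ω) (hΩb : Bornology.IsBounded Ω)
    (hΩc : Convex ℝ Ω) (hρ : AdmissibleDensities Ω ρ₀ ρ₁)
    (h : IsSubflow Ω (fun x => ρ₀ x + ρ₁ x) t₀ t₁ A) :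
    ∃ ε₀ : ℝ, 0 < ε₀ ∧ ∀ ε : ℝ, 0 < ε → ε < ε₀ → ∀ t ∈ Icc t₀ (t₁ - ε),
      oneStep Ω ρ₀ ρ₁ ε (A t) ⊆ A (t + ε) := by
  obtain ⟨B, hev, δ, hδ, hflow⟩ := h
  obtain ⟨K, r, hK⟩ := hev.exists_flowTube hΩ hΩc
  obtain ⟨η, hη, hne⟩ := hev.exists_nonempty_of_nonempty hΩ hΩc
  obtain ⟨a, ha, c, hc, hmin⟩ := hK.eventually_min_le_clampFun hΩ hΩb hΩc.isPreconnected hρ hδ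
    (fun p hp => hflow p (hK.subset hp))
  refine exists_pos_forall_of_eventually ?_
  filter_upwards [hmin, self_mem_nhdsWithin, Ioo_mem_nhdsGT hη] with ε hmin hε hεη t ht x hx
  replace hε : 0 < ε := hε
  have htI : t ∈ Icc t₀ t₁ := ⟨ht.1, by linarith [ht.2]⟩
  have htI' : t + ε ∈ Icc t₀ t₁ := ⟨by linarith [ht.1], by linarith [ht.2]⟩
  unfold oneStep at hx
  split_ifs at hx with h1 h2
  · exact hx.elim
  · rcases (A t).eq_empty_or_nonempty with h0 | h0
    · exact absurd (by rw [h0, measure_empty]) h1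
    · have hE := hev.isEssential htI
      exact absurd h2 (hE.volume_diff_ne_zero hΩ (hE.frontier_nonempty h0))
  · have hAt : (A t).Nonempty := by
      rw [nonempty_iff_ne_empty]
      intro h0
      exact h1 (by rw [h0, measure_empty])
    have hAt' : (A (t + ε)).Nonempty := hne t htI _ htI'
      (by rw [add_sub_cancel_left, abs_of_pos hε]; exact hεη.2) hAt
    have hae := hmin t ⟨htI, hAt⟩ ⟨htI', hAt'⟩ (energy_zero_ne_top hΩ hΩb hρ _) _
      (isMinimizer_schemeMinimizer hε hΩ hΩb hρ (A t))
    rw [ae_restrict_iff' hΩ.measurableSet] at hae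
    have hE := hev.isEssential htI'
    have hεc := mul_pos hε hc
    suffices hd : ε * c ≤ flowDist Ω A x (t + ε) from
      interior_subset (hE.mem_interior_of_sdist_pos hΩ (hE.frontier_nonempty hAt') hx.1
        (hεc.trans_le hd))
    by_contra! hlt
    obtain ⟨s, hs, hball⟩ := Metric.mem_nhds_iff.1
      ((hK.continuous (t + ε)).continuousAt.eventually_lt_const hlt)
    refine measure_inter_ball_ne_zero hx hs (measure_mono_null (fun y hy => ?_) hae)
    intro hy'
    have hyd : flowDist Ω A y (t + ε) < ε * c := hball hy.2
    have hle := hy' hy.1.1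
    have h3 : clampFun (fun x => flowDist Ω A x (t + ε) - ε * c) a y < 0 :=
      max_lt (by linarith) ((min_le_right _ _).trans_lt (by linarith))
    exact absurd (hle.trans_lt h3) (not_lt.2 (le_min hy.1.2.le ha.le))

/-- The barrier estimate is applied to -d with the densities exchanged. For x in A(t + ε), d ≥ 0 >
-εc, so the reflected barrier is negative on a ball around x and w > 0 a.e. there; the margin again
covers boundary points. -/
lemma subset_oneStep_of_isSuperflow (hΩ : IsOpen Ω) (hΩb : Bornology.IsBounded Ω)
    (hΩc : Convex ℝ Ω) (hρ : AdmissibleDensities Ω ρ₀ ρ₁)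
    (h : IsSuperflow Ω (fun x => ρ₀ x + ρ₁ x) t₀ t₁ A) :
    ∃ ε₀ : ℝ, 0 < ε₀ ∧ ∀ ε : ℝ, 0 < ε → ε < ε₀ → ∀ t ∈ Icc t₀ (t₁ - ε),
      A (t + ε) ⊆ oneStep Ω ρ₀ ρ₁ ε (A t) := by
  obtain ⟨B, hev, δ, hδ, hflow⟩ := h
  obtain ⟨K, r, hK⟩ := hev.exists_flowTube hΩ hΩc
  obtain ⟨η, hη, hne⟩ := hev.exists_nonempty_of_nonempty hΩ hΩc
  have hflow' : ∀ p ∈ K, weightedLaplacian (fun x => ρ₁ x + ρ₀ x)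
      (fun y => -flowDist Ω A y p.2) p.1 + -δ ≤
        derivWithin (fun t => -flowDist Ω A p.1 t) (Icc t₀ t₁) p.2 := by
    intro p hp
    have h1 := hflow p (hK.subset hp)
    rw [weightedLaplacian_neg, derivWithin.fun_neg]
    simp only [add_comm (ρ₁ _)]
    linarith
  obtain ⟨a, ha, c, hc, hmin⟩ := hK.neg.eventually_min_le_clampFun hΩ hΩb hΩc.isPreconnected
    hρ.symm (neg_pos.2 hδ) hflow'
  refine exists_pos_forall_of_eventually ?_
  filter_upwards [hmin, self_mem_nhdsWithin, Ioo_mem_nhdsGT hη] with ε hmin hε hεη t ht x hx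
  replace hε : 0 < ε := hε
  have htI : t ∈ Icc t₀ t₁ := ⟨ht.1, by linarith [ht.2]⟩
  have htI' : t + ε ∈ Icc t₀ t₁ := ⟨by linarith [ht.1], by linarith [ht.2]⟩
  have hAt : (A t).Nonempty := hne _ htI' t htI
    (by rw [sub_add_cancel_left, abs_neg, abs_of_pos hε]; exact hεη.2) ⟨x, hx⟩
  have hEt := hev.isEssential htI
  have hE := hev.isEssential htI'
  have hxΩ := hE.closure_subset (subset_closure hx)
  have hF := hE.frontier_nonempty ⟨x, hx⟩
  rw [oneStep, if_neg (hEt.volume_ne_zero (hEt.frontier_nonempty hAt)),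
    if_neg (hEt.volume_diff_ne_zero hΩ (hEt.frontier_nonempty hAt))]
  have hfin : energy Ω ρ₁ ρ₀ ε (-sdist Ω (Ω \ A t)) (-0) ≠ ⊤ := by
    rw [energy_neg]
    exact energy_zero_ne_top hΩ hΩb hρ _
  rw [neg_zero] at hfin
  have hae := hmin t ⟨htI, hAt⟩ ⟨htI', ⟨x, hx⟩⟩ hfin _
    (isMinimizer_schemeMinimizer hε hΩ hΩb hρ (A t)).neg
  rw [ae_restrict_iff' hΩ.measurableSet] at hae
  have hεc := mul_pos hε hc
  have hd : -(ε * c) < flowDist Ω A x (t + ε) := by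
    rw [flowDist, hE.sdist_of_mem_closure hΩ hF (subset_closure hx)]
    linarith [Metric.infDist_nonneg (x := x) (s := frontier (A (t + ε)))]
  obtain ⟨s, hs, hball⟩ := Metric.mem_nhds_iff.1
    (((hK.continuous (t + ε)).continuousAt.eventually_const_lt hd).and (hΩ.mem_nhds hxΩ))
  refine mem_densityOne_of_eventually hxΩ ?_
  filter_upwards [Ioo_mem_nhdsGT hs] with s' hs'
  refine measure_mono_null (fun y hy => ?_) hae
  obtain ⟨hyd, hyΩ⟩ := hball (Metric.ball_subset_ball hs'.2.le hy.1)
  have hyd' : -(ε * c) < flowDist Ω A y (t + ε) := hyd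
  intro hy'
  have hle := hy' hyΩ
  have h3 : clampFun (fun x => -flowDist Ω A x (t + ε) - ε * c) a y < 0 :=
    max_lt (by linarith) ((min_le_right _ _).trans_lt (by linarith))
  have h4 : schemeMinimizer Ω ρ₀ ρ₁ ε (A t) y ≤ 0 := not_lt.1 fun h5 => hy.2 ⟨hyΩ, h5⟩
  exact absurd (hle.trans_lt h3) (not_lt.2 (le_min (neg_nonneg.2 h4) ha.le))

end Evolution

end AdvMCF

end

theorem theorem4p3 {N : ℕ} (hN : 1 ≤ N) (Ω : Set (EuclideanSpace ℝ (Fin N)))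
    (hΩ_open : IsOpen Ω) (hΩ_nonempty : Ω.Nonempty) (hΩ_bounded : Bornology.IsBounded Ω)
    (hΩ_convex : Convex ℝ Ω) (ρ₀ ρ₁ : EuclideanSpace ℝ (Fin N) → ℝ)
    (hρ : AdvMCF.AdmissibleDensities Ω ρ₀ ρ₁) :
    (∀ ε : ℝ, 0 < ε → AdvMCF.SchemeWellPosed Ω ρ₀ ρ₁ ε) ∧
    (∀ ε : ℝ, 0 < ε → AdvMCF.IsMonotoneOperator Ω (AdvMCF.oneStep Ω ρ₀ ρ₁ ε)) ∧
    AdvMCF.IsConsistent Ω (fun x => ρ₀ x + ρ₁ x) (AdvMCF.oneStep Ω ρ₀ ρ₁) := by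
  have : Nonempty (Fin N) := ⟨⟨0, hN⟩⟩
  -- Positive dimension makes the space noncompact, so a nonempty set with compact closure has a
  -- nonempty boundary.
  have : Nontrivial (EuclideanSpace ℝ (Fin N)) := inferInstance
  exact ⟨fun ε hε => AdvMCF.schemeWellPosed hε hΩ_open hΩ_bounded hρ,
    fun ε hε => AdvMCF.isMonotoneOperator_oneStep hε hΩ_open hΩ_bounded hρ,
    fun _ _ _ h => AdvMCF.oneStep_subset_of_isSubflow hΩ_open hΩ_bounded hΩ_convex hρ h,
    fun _ _ _ h => AdvMCF.subset_oneStep_of_isSuperflow hΩ_open hΩ_bounded hΩ_convex hρ h⟩
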